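/- **Conventions.** Let $H$ be a finite dimensional $C^*$-Hopf algebra (a finite dimensional Hopf algebra over $\mathbb C$ which is a $C^*$-algebra and whose comultiplication is a $*$-homomorphism) with dual $C^*$-Hopf algebra $H^0$, whose comultiplication, counit, antipode and involution are $\Delta^0(\phi)(h\otimes k)=\phi(hk)$, $\epsilon^0(\phi)=\phi(1)$, $S^0(\phi)=\phi\circ S$, $\phi^*(h)=\overline{\phi(S(h)^*)}$, and let $A$ be a unital $C^*$-algebra. A *coaction* of $H^0$ on $A$ is a unital $*$-homomorphism $\rho:A\to A\otimes H^0$ with $(\rho\otimes\mathrm{id})\circ\rho=(\mathrm{id}\otimes\Delta^0)\circ\rho$ and $(\mathrm{id}\otimes\epsilon^0)\circ\rho=\mathrm{id}$. It induces an action of $H$ on $A$ by $h\cdot a=(\mathrm{id}\otimes h)(\rho(a))$. The crossed product $A\rtimes_\rho H$ is $A\otimes H$ with $(a\rtimes h)(b\rtimes k)=a(h_{(1)}\cdot b)\rtimes h_{(2)}k$ and $(a\rtimes h)^*=(h_{(1)}^*\cdot a^*)\rtimes h_{(2)}^*$, and the *dual coaction* $\widehat\rho$ of $H$ on it is $\widehat\rho(a\rtimes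 h)=(a\rtimes h_{(1)})\otimes h_{(2)}$. Let $A^\infty=\ell^\infty(\mathbb N,A)/c_0(A)$, which contains $A$ as the classes of constant sequences, and let $\rho^\infty$ be the coaction $\rho^\infty((a_n))=(\rho(a_n))$ of $H^0$ on $A^\infty$. Identify $(A\rtimes_\rho H)^\infty$ with $A^\infty\rtimes_{\rho^\infty}H$, and thereby $\widehat\rho^{\,\infty}$ with the dual coaction of $\rho^\infty$. The coaction $\rho$ has the *Rohlin property* if $\widehat\rho$ is approximately representable, i.e. if there is a unitary $w\in(A^\infty\rtimes_{\rho^\infty}H)\otimes H$ such that 1. $\widehat\rho(x)=w(x\otimes1)w^*$ for all $x\in A\rtimes_\rho H$; 2. $(w\otimes1)\,(\iota\otimes\mathrm{id})(w)=(\mathrm{id}\otimes\Delta)(w)$, where $\iota(y)=y\otimes1$ for $y\in A^\infty\rtimes_{\rho^\infty}H$; 3. $(\widehat\rho^{\,\infty}\otimes\mathrm{id})(w)\,(w\otimes1)=(\mathrm{id}\otimes\Delta)(w)$. **Theorem (1-cohomology vanishing).** Let $\rho$ and $\sigma$ be coactions of $H^0$ on $A$ which are exterior equivalent through $v$, that is,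 $v\in A\otimes H^0$ is a unitary with $$\sigma=\mathrm{Ad}(v)\circ\rho,\qquad (v\otimes1^0)(\rho\otimes\mathrm{id})(v)=(\mathrm{id}\otimes\Delta^0)(v).$$ Suppose that $\rho$ has the Rohlin property. Then there is a unitary $x\in A$ such that $$\sigma=\mathrm{Ad}(x\otimes1^0)\circ\rho\circ\mathrm{Ad}(x^*)\qquad\text{and}\qquad v=(x\otimes1^0)\,\rho(x^*),$$ so $v$ is a coboundary. -/

import Mathlib

open scoped TensorProduct ComplexConjugate
open Coalgebra HopfAlgebra

/-- A finite dimensional C⋆-Hopf algebra: a finite dimensional Hopf algebra over `ℂ` with an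
involution, for which the underlying ⋆-algebra is a C⋆-algebra (it carries a submultiplicative norm
with the C⋆-identity; completeness is automatic) and the comultiplication is a
⋆-homomorphism. -/
class CStarHopfAlgebra (H : Type*) [Ring H] [HopfAlgebra ℂ H] [StarRing H] : Prop extends
    StarModule ℂ H, Module.Finite ℂ H where
  comul_star : ∀ h : H, comul (R := ℂ) (star h) = star (comul (R := ℂ) h)
  exists_cstarNorm : ∃ N : AlgebraNorm ℂ H, ∀ h : H, N (star h * h) = N h * N h

namespace CStarHopfAlgebra

variable {H : Type*} [Ring H] [HopfAlgebra ℂ H] [StarRing H] [CStarHopfAlgebra H]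

/-- The image under the involution of a Sweedler representation. -/
def starRepr {ι : Type*} {h : H} (r : Repr ℂ h ι) : Repr ℂ (star h) ι where
  index := r.index
  left i := star (r.left i)
  right i := star (r.right i)
  eq := by
    rw [comul_star, ← r.eq, star_sum]
    simp

theorem counit_star (h : H) : counit (R := ℂ) (star h) = conj (counit (R := ℂ) h) := by
  let r := Repr.arbitrary ℂ h
  have h1 : h = ∑ i ∈ r.index, counit (R := ℂ) (r.left i) • r.right i := (sum_counit_smul r).symm
  have h3 : counit (R := ℂ) (star h)
      = ∑ i ∈ r.index, counit (R := ℂ) (star (r.right i)) * conj (counit (R := ℂ) (r.left i)) := by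
    conv_lhs => rw [h1]
    simp [star_sum, mul_comm]
  have key : ∑ i ∈ r.index, counit (R := ℂ) (star (r.right i)) • star (r.left i) = star h := by
    have := congrArg (TensorProduct.rid ℂ H) (sum_tmul_counit_eq (R := ℂ) (starRepr r))
    simpa [starRepr, map_sum] using this
  have h5 := congrArg (fun x => conj (counit (R := ℂ) (star x))) key
  simp only [star_sum, star_smul, star_star, map_sum, map_smul, map_mul, smul_eq_mul,
    RCLike.star_def, Complex.conj_conj] at h5
  exact h3.trans h5

/-- The linear map `h ↦ S(h⋆)⋆`, which is the inverse of the antipode. -/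
noncomputable def antipodeInv : H →ₗ[ℂ] H where
  toFun h := star (antipode ℂ (star h))
  map_add' := by simp
  map_smul' := by simp

theorem antipodeInv_apply (h : H) : antipodeInv h = star (antipode ℂ (star h)) := rfl

theorem sum_antipodeInv_mul {ι : Type*} {h : H} (r : Repr ℂ h ι) :
    ∑ i ∈ r.index, antipodeInv (r.right i) * r.left i = algebraMap ℂ H (counit h) := by
  have := congrArg star (sum_mul_antipode_eq_algebraMap_counit (starRepr r))
  simpa [starRepr, star_sum, counit_star, Algebra.algebraMap_eq_smul_one, antipodeInv_apply]
    using this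

theorem antipode_antipodeInv (h : H) : antipode ℂ (antipodeInv h) = h := by
  have : WithConv.toConv (LinearMap.id : H →ₗ[ℂ] H)
      = WithConv.toConv (antipode ℂ ∘ₗ antipodeInv) := by
    apply left_inv_eq_right_inv (a := WithConv.toConv (antipode ℂ (A := H)))
    · exact LinearMap.id_mul_antipode
    · ext x
      rw [(Repr.arbitrary ℂ x).convMul_apply]
      have := congrArg (antipode ℂ) (sum_antipodeInv_mul (Repr.arbitrary ℂ x))
      simpa [antipode_mul_antidistrib, Algebra.algebraMap_eq_smul_one] using this
  exact (LinearMap.congr_fun (WithConv.toConv_injective this) h).symm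

theorem antipodeInv_antipode (h : H) : antipodeInv (antipode ℂ h) = h := by
  have := antipode_antipodeInv (star h)
  rw [antipodeInv_apply, star_star] at this
  rw [antipodeInv_apply, this, star_star]

end CStarHopfAlgebra

/-- The dual `H⁰` of a finite dimensional C⋆-Hopf algebra `H`: the space of linear functionals on
`H`, with the convolution product `(φψ)(h) = φ(h₁)ψ(h₂)`. -/
def HopfDual (H : Type*) [Ring H] [HopfAlgebra ℂ H] : Type _ := WithConv (H →ₗ[ℂ] ℂ)

namespace HopfDual

section Hopf

variable {H : Type*} [Ring H] [HopfAlgebra ℂ H]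

noncomputable instance : Ring (HopfDual H) := inferInstanceAs (Ring (WithConv (H →ₗ[ℂ] ℂ)))

noncomputable instance : Algebra ℂ (HopfDual H) :=
  inferInstanceAs (Algebra ℂ (WithConv (H →ₗ[ℂ] ℂ)))

/-- Elements of the dual are linear functionals. -/
noncomputable def toDual : HopfDual H ≃ₗ[ℂ] Module.Dual ℂ H := WithConv.linearEquiv ℂ (H →ₗ[ℂ] ℂ)

noncomputable instance : CoeFun (HopfDual H) (fun _ => H → ℂ) where coe φ := toDual φ

@[ext] theorem ext {φ ψ : HopfDual H} (h : ∀ x, φ x = ψ x) : φ = ψ :=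
  toDual.injective (LinearMap.ext h)

theorem mul_apply {ι : Type*} (φ ψ : HopfDual H) {h : H} (r : Repr ℂ h ι) :
    (φ * ψ) h = ∑ i ∈ r.index, φ (r.left i) * ψ (r.right i) :=
  r.convMul_apply (f := (φ : WithConv (H →ₗ[ℂ] ℂ))) (g := (ψ : WithConv (H →ₗ[ℂ] ℂ)))

theorem mul_apply' (φ ψ : HopfDual H) (h : H) :
    (φ * ψ) h = TensorProduct.dualDistrib ℂ H H (toDual φ ⊗ₜ toDual ψ) (comul h) := by
  rw [mul_apply φ ψ (Repr.arbitrary ℂ h), ← (Repr.arbitrary ℂ h).eq, map_sum]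
  simp

theorem one_apply (h : H) : (1 : HopfDual H) h = counit (R := ℂ) h := rfl

variable [Module.Finite ℂ H]

instance : Module.Finite ℂ (HopfDual H) := Module.Finite.equiv (toDual (H := H)).symm

/-- The identification of `H⁰ ⊗ H⁰` with the functionals on `H ⊗ H`. -/
noncomputable def toDual₂ : HopfDual H ⊗[ℂ] HopfDual H ≃ₗ[ℂ] Module.Dual ℂ (H ⊗[ℂ] H) :=
  (TensorProduct.congr toDual toDual).trans (TensorProduct.dualDistribEquiv ℂ H H)

@[simp] theorem toDual₂_tmul (φ ψ : HopfDual H) (h k : H) :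
    toDual₂ (φ ⊗ₜ ψ) (h ⊗ₜ k) = φ h * ψ k := by
  simp [toDual₂, TensorProduct.dualDistribEquiv, TensorProduct.dualDistribEquivOfBasis]

theorem toDual₂_mul (x y : HopfDual H ⊗[ℂ] HopfDual H) {ι κ : Type*} {h k : H}
    (r : Repr ℂ h ι) (s : Repr ℂ k κ) :
    toDual₂ (x * y) (h ⊗ₜ k) = ∑ i ∈ r.index, ∑ j ∈ s.index,
      toDual₂ x (r.left i ⊗ₜ s.left j) * toDual₂ y (r.right i ⊗ₜ s.right j) := by
  induction x with
  | zero => simp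
  | add x x' hx hx' => simp [add_mul, hx, hx', Finset.sum_add_distrib]
  | tmul φ ψ =>
    induction y with
    | zero => simp
    | add y y' hy hy' => simp [mul_add, hy, hy', Finset.sum_add_distrib]
    | tmul φ' ψ' =>
      simp only [Algebra.TensorProduct.tmul_mul_tmul, toDual₂_tmul, mul_apply _ _ r,
        mul_apply _ _ s, Finset.sum_mul_sum]
      refine Finset.sum_congr rfl fun i _ => Finset.sum_congr rfl fun j _ => by ring

theorem ext₂ {x y : HopfDual H ⊗[ℂ] HopfDual H}
    (h : ∀ a b, toDual₂ x (a ⊗ₜ b) = toDual₂ y (a ⊗ₜ b)) : x = y :=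
  toDual₂.injective (TensorProduct.ext' h)

/-- The comultiplication `Δ⁰`, determined by `Δ⁰(φ)(h ⊗ k) = φ(hk)`. -/
noncomputable def comul : HopfDual H →ₗ[ℂ] HopfDual H ⊗[ℂ] HopfDual H :=
  toDual₂.symm.toLinearMap ∘ₗ (LinearMap.mul' ℂ H).dualMap ∘ₗ toDual.toLinearMap

@[simp] theorem toDual₂_comul (φ : HopfDual H) (h k : H) :
    toDual₂ (comul φ) (h ⊗ₜ k) = φ (h * k) := by
  simp [comul]

/-- The counit `ε⁰(φ) = φ(1)`. -/
noncomputable def counit : HopfDual H →ₗ[ℂ] ℂ :=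
  LinearMap.applyₗ 1 ∘ₗ toDual.toLinearMap

@[simp] theorem counit_apply (φ : HopfDual H) : counit φ = φ 1 := rfl

/-- The functional on `H ⊗ (H ⊗ H)` given by a threefold tensor. -/
noncomputable def toDual₃ :
    HopfDual H ⊗[ℂ] (HopfDual H ⊗[ℂ] HopfDual H) ≃ₗ[ℂ] Module.Dual ℂ (H ⊗[ℂ] (H ⊗[ℂ] H)) :=
  (TensorProduct.congr toDual toDual₂).trans (TensorProduct.dualDistribEquiv ℂ H (H ⊗[ℂ] H))

theorem toDual₃_tmul (φ : HopfDual H) (x : HopfDual H ⊗[ℂ] HopfDual H) (h : H) (k : H ⊗[ℂ] H) :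
    toDual₃ (φ ⊗ₜ x) (h ⊗ₜ k) = φ h * toDual₂ x k := by
  simp [toDual₃, TensorProduct.dualDistribEquiv, TensorProduct.dualDistribEquivOfBasis]

theorem toDual₃_lTensor_comul (x : HopfDual H ⊗[ℂ] HopfDual H) (h k l : H) :
    toDual₃ (comul.lTensor _ x) (h ⊗ₜ (k ⊗ₜ l)) = toDual₂ x (h ⊗ₜ (k * l)) := by
  induction x with
  | zero => simp
  | add x y hx hy => simp [hx, hy]
  | tmul φ ψ => simp [toDual₃_tmul]

theorem toDual₃_assoc_tmul (x : HopfDual H ⊗[ℂ] HopfDual H) (ψ : HopfDual H) (h k l : H) :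
    toDual₃ (TensorProduct.assoc ℂ _ _ _ (x ⊗ₜ ψ)) (h ⊗ₜ (k ⊗ₜ l))
      = toDual₂ x (h ⊗ₜ k) * ψ l := by
  induction x with
  | zero => simp
  | add x y hx hy => simp [hx, hy, TensorProduct.add_tmul, add_mul]
  | tmul φ ψ => simp [toDual₃_tmul, mul_assoc]

theorem toDual₃_rTensor_comul (x : HopfDual H ⊗[ℂ] HopfDual H) (h k l : H) :
    toDual₃ (TensorProduct.assoc ℂ _ _ _ (comul.rTensor _ x)) (h ⊗ₜ (k ⊗ₜ l))
      = toDual₂ x ((h * k) ⊗ₜ l) := by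
  induction x with
  | zero => simp
  | add x y hx hy => simp [hx, hy]
  | tmul φ ψ => simp [toDual₃_assoc_tmul]

theorem lid_rTensor_counit (x : HopfDual H ⊗[ℂ] HopfDual H) (h : H) :
    (TensorProduct.lid ℂ _ (counit.rTensor _ x) : HopfDual H) h = toDual₂ x (1 ⊗ₜ h) := by
  induction x with
  | zero => simp
  | add x y hx hy => simp [hx, hy]
  | tmul φ ψ => simp

theorem rid_lTensor_counit (x : HopfDual H ⊗[ℂ] HopfDual H) (h : H) :
    (TensorProduct.rid ℂ _ (counit.lTensor _ x) : HopfDual H) h = toDual₂ x (h ⊗ₜ 1) := by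
  induction x with
  | zero => simp
  | add x y hx hy => simp [hx, hy]
  | tmul φ ψ => simp [mul_comm]

noncomputable instance : Coalgebra ℂ (HopfDual H) where
  comul := comul
  counit := counit
  coassoc := by
    ext φ : 1
    apply toDual₃.injective
    refine TensorProduct.ext' fun h y => ?_
    induction y with
    | zero => simp
    | add y z hy hz => simp only [TensorProduct.tmul_add, map_add, hy, hz]
    | tmul k l =>
      simp only [LinearMap.comp_apply, LinearEquiv.coe_coe, toDual₃_rTensor_comul,
        toDual₃_lTensor_comul, toDual₂_comul, mul_assoc]
  rTensor_counit_comp_comul := by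
    ext φ : 1
    apply (TensorProduct.lid ℂ (HopfDual H)).injective
    ext h
    simp only [LinearMap.comp_apply, lid_rTensor_counit]
    simp
  lTensor_counit_comp_comul := by
    ext φ : 1
    apply (TensorProduct.rid ℂ (HopfDual H)).injective
    ext h
    simp only [LinearMap.comp_apply, rid_lTensor_counit]
    simp

@[simp] theorem toDual₂_comul' (φ : HopfDual H) (h k : H) :
    toDual₂ (Coalgebra.comul (R := ℂ) φ) (h ⊗ₜ k) = φ (h * k) := toDual₂_comul φ h k

@[simp] theorem counit_apply' (φ : HopfDual H) : Coalgebra.counit (R := ℂ) φ = φ 1 := rfl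

noncomputable instance : Bialgebra ℂ (HopfDual H) :=
  Bialgebra.mk' ℂ (HopfDual H)
    (by simp [one_apply])
    (by intro φ ψ
        simp only [counit_apply', mul_apply']
        simp [Algebra.TensorProduct.one_def])
    (by apply ext₂
        intro h k
        rw [toDual₂_comul', Algebra.TensorProduct.one_def, toDual₂_tmul]
        simp [one_apply])
    (by intro φ ψ
        apply ext₂
        intro h k
        have e : Coalgebra.comul (R := ℂ) (h * k) = ∑ i ∈ (Repr.arbitrary ℂ h).index,
            ∑ j ∈ (Repr.arbitrary ℂ k).index,
            ((Repr.arbitrary ℂ h).left i * (Repr.arbitrary ℂ k).left j) ⊗ₜ[ℂ]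
            ((Repr.arbitrary ℂ h).right i * (Repr.arbitrary ℂ k).right j) := by
          rw [Bialgebra.comul_mul, ← (Repr.arbitrary ℂ h).eq, ← (Repr.arbitrary ℂ k).eq,
            Finset.sum_mul_sum]
          simp
        rw [toDual₂_mul _ _ (Repr.arbitrary ℂ h) (Repr.arbitrary ℂ k), toDual₂_comul',
          mul_apply', e]
        simp)

/-- The antipode `S⁰(φ) = φ ∘ S`. -/
noncomputable def antipodeMap : HopfDual H →ₗ[ℂ] HopfDual H :=
  toDual.symm.toLinearMap ∘ₗ (antipode ℂ (A := H)).dualMap ∘ₗ toDual.toLinearMap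

@[simp] theorem antipodeMap_apply (φ : HopfDual H) (h : H) :
    antipodeMap φ h = φ (antipode ℂ h) := by
  simp [antipodeMap]

theorem mul'_map_apply (f g : H →ₗ[ℂ] H) (F G : HopfDual H →ₗ[ℂ] HopfDual H)
    (hF : ∀ φ h, F φ h = φ (f h)) (hG : ∀ φ h, G φ h = φ (g h))
    (x : HopfDual H ⊗[ℂ] HopfDual H) (h : H) :
    (LinearMap.mul' ℂ (HopfDual H) (TensorProduct.map F G x)) h
      = toDual₂ x (TensorProduct.map f g (Coalgebra.comul h)) := by
  induction x with
  | zero => simp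
  | add x y hx hy => simp [hx, hy]
  | tmul φ ψ =>
    rw [TensorProduct.map_tmul, LinearMap.mul'_apply, mul_apply _ _ (Repr.arbitrary ℂ h),
      ← (Repr.arbitrary ℂ h).eq, map_sum, map_sum]
    simp [hF, hG]

theorem toDual₂_comul_apply (φ : HopfDual H) (t : H ⊗[ℂ] H) :
    toDual₂ (Coalgebra.comul (R := ℂ) φ) t = φ (LinearMap.mul' ℂ H t) := by
  induction t with
  | zero => simp
  | add x y hx hy => simp [hx, hy]
  | tmul h k => simp

noncomputable instance : HopfAlgebra ℂ (HopfDual H) where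
  antipode := antipodeMap
  mul_antipode_rTensor_comul := by
    ext φ h
    simp only [LinearMap.comp_apply, LinearMap.rTensor]
    rw [mul'_map_apply (antipode ℂ) LinearMap.id antipodeMap LinearMap.id (by simp) (by simp),
      toDual₂_comul_apply]
    have := HopfAlgebra.mul_antipode_rTensor_comul_apply (R := ℂ) h
    rw [LinearMap.rTensor] at this
    rw [this]
    simp [Algebra.algebraMap_eq_smul_one, one_apply, mul_comm]
  mul_antipode_lTensor_comul := by
    ext φ h
    simp only [LinearMap.comp_apply, LinearMap.lTensor]
    rw [mul'_map_apply LinearMap.id (antipode ℂ) LinearMap.id antipodeMap (by simp) (by simp),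
      toDual₂_comul_apply]
    have := HopfAlgebra.mul_antipode_lTensor_comul_apply (R := ℂ) h
    rw [LinearMap.lTensor] at this
    rw [this]
    simp [Algebra.algebraMap_eq_smul_one, one_apply, mul_comm]

@[simp] theorem antipode_apply (φ : HopfDual H) (h : H) :
    antipode ℂ φ h = φ (antipode ℂ h) := antipodeMap_apply φ h

end Hopf

section Star

open CStarHopfAlgebra

variable {H : Type*} [Ring H] [HopfAlgebra ℂ H] [StarRing H] [CStarHopfAlgebra H]

/-- The functional `h ↦ conj φ(h⋆)`. -/
noncomputable def conjDual (φ : HopfDual H) : HopfDual H :=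
  toDual.symm
    { toFun := fun h => conj (φ (star h))
      map_add' := by simp
      map_smul' := by simp }

@[simp] theorem conjDual_apply (φ : HopfDual H) (h : H) : conjDual φ h = conj (φ (star h)) := by
  simp [conjDual]

theorem conjDual_mul (φ ψ : HopfDual H) : conjDual (φ * ψ) = conjDual φ * conjDual ψ := by
  ext h
  rw [conjDual_apply, mul_apply _ _ (Repr.arbitrary ℂ h),
    mul_apply _ _ (starRepr (Repr.arbitrary ℂ h))]
  simp [starRepr]

/-- The involution of the dual: `φ⋆(h) = conj φ(S(h)⋆)`. -/
noncomputable instance : Star (HopfDual H) where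
  star φ := toDual.symm
    { toFun := fun h => conj (φ (star (antipode ℂ h)))
      map_add' := by simp
      map_smul' := by simp }

@[simp] theorem star_apply (φ : HopfDual H) (h : H) :
    (star φ) h = conj (φ (star (antipode ℂ h))) := by
  simp [star]

theorem star_eq (φ : HopfDual H) : star φ = antipode ℂ (conjDual φ) := by
  ext h; simp

noncomputable instance : StarRing (HopfDual H) where
  star_involutive φ := by
    ext h
    have := antipodeInv_antipode h
    rw [antipodeInv_apply] at this
    simp [this]
  star_mul φ ψ := by
    simp only [star_eq, conjDual_mul, antipode_mul_antidistrib]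
  star_add φ ψ := by
    ext h; simp

instance : StarModule ℂ (HopfDual H) where
  star_smul c φ := by
    ext h; simp

theorem toDual₂_star (x : HopfDual H ⊗[ℂ] HopfDual H) {h k : H} :
    toDual₂ (star x) (h ⊗ₜ k)
      = conj (toDual₂ x (star (antipode ℂ h) ⊗ₜ star (antipode ℂ k))) := by
  induction x with
  | zero => simp
  | add x y hx hy => simp [hx, hy]
  | tmul φ ψ => simp

theorem comul_star (φ : HopfDual H) :
    Coalgebra.comul (R := ℂ) (star φ) = star (Coalgebra.comul (R := ℂ) φ) := by
  apply ext₂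
  intro h k
  rw [toDual₂_star, toDual₂_comul', toDual₂_comul', star_apply, antipode_mul_antidistrib, star_mul]

end Star

end HopfDual
/-- A coaction of a bialgebra `K` with involution on a unital ⋆-algebra `B`: a unital
⋆-homomorphism `ρ : B → B ⊗ K` such that `(ρ ⊗ id) ∘ ρ = (id ⊗ Δ) ∘ ρ` and
`(id ⊗ ε) ∘ ρ = id`. -/
structure Coaction (B K : Type*) [Ring B] [Algebra ℂ B] [StarRing B] [StarModule ℂ B]
    [Ring K] [Bialgebra ℂ K] [StarRing K] [StarModule ℂ K] extends B →⋆ₐ[ℂ] B ⊗[ℂ] K where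
  coassoc' : ∀ b : B, TensorProduct.assoc ℂ B K K
    (toStarAlgHom.toAlgHom.toLinearMap.rTensor K (toFun b)) = comul.lTensor B (toFun b)
  counit' : ∀ b : B, TensorProduct.rid ℂ B (counit.lTensor B (toFun b)) = b

namespace Coaction

section Basic

variable {B K : Type*} [Ring B] [Algebra ℂ B] [StarRing B] [StarModule ℂ B]
  [Ring K] [Bialgebra ℂ K] [StarRing K] [StarModule ℂ K]

instance : CoeFun (Coaction B K) (fun _ => B → B ⊗[ℂ] K) where
  coe ρ := ρ.toStarAlgHom

/-- The linear map underlying a coaction. -/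
def lin (ρ : Coaction B K) : B →ₗ[ℂ] B ⊗[ℂ] K := ρ.toStarAlgHom.toAlgHom.toLinearMap

@[simp] theorem lin_apply (ρ : Coaction B K) (b : B) : ρ.lin b = ρ b := rfl

theorem coassoc (ρ : Coaction B K) (b : B) :
    TensorProduct.assoc ℂ B K K (ρ.lin.rTensor K (ρ b)) = comul.lTensor B (ρ b) := ρ.coassoc' b

theorem counit_apply (ρ : Coaction B K) (b : B) :
    TensorProduct.rid ℂ B (counit.lTensor B (ρ b)) = b := ρ.counit' b

end Basic

section Slice

variable {B M : Type*} [Ring B] [Algebra ℂ B] [AddCommGroup M] [Module ℂ M]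

/-- The slice map `id ⊗ f : B ⊗ M → B` of a functional `f` on `M`. -/
noncomputable def slice (f : Module.Dual ℂ M) : B ⊗[ℂ] M →ₗ[ℂ] B :=
  (TensorProduct.rid ℂ B).toLinearMap ∘ₗ LinearMap.lTensor B f

@[simp] theorem slice_tmul (f : Module.Dual ℂ M) (b : B) (m : M) :
    slice f (b ⊗ₜ m) = f m • b := by
  simp [slice]

end Slice

section Action

open CStarHopfAlgebra HopfDual

variable {B H : Type*} [Ring B] [Algebra ℂ B] [StarRing B] [StarModule ℂ B]
  [Ring H] [HopfAlgebra ℂ H] [StarRing H] [CStarHopfAlgebra H]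

/-- The action `φ · b = (id ⊗ φ)(ρ(b))` of the dual `H⁰` induced by a coaction of `H`. -/
noncomputable def act (ρ : Coaction B H) : HopfDual H →ₗ[ℂ] B →ₗ[ℂ] B :=
  LinearMap.mk₂ ℂ (fun φ b => slice (toDual φ) (ρ b))
    (by intro φ ψ b; simp [slice, LinearMap.lTensor_add])
    (by intro c φ b; simp [slice, LinearMap.lTensor_smul])
    (by intro φ a b; simp)
    (by intro c φ b; simp)

theorem act_apply (ρ : Coaction B H) (φ : HopfDual H) (b : B) :
    ρ.act φ b = slice (toDual φ) (ρ b) := rfl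

/-- `φ ⊗ ψ ↦ (φ · a)(ψ · b)`. -/
noncomputable def actPair (ρ : Coaction B H) (a b : B) : HopfDual H ⊗[ℂ] HopfDual H →ₗ[ℂ] B :=
  TensorProduct.lift ((LinearMap.mul ℂ B).compl₁₂ (ρ.act.flip a) (ρ.act.flip b))

@[simp] theorem actPair_tmul (ρ : Coaction B H) (a b : B) (φ ψ : HopfDual H) :
    ρ.actPair a b (φ ⊗ₜ ψ) = ρ.act φ a * ρ.act ψ b := by
  simp [actPair]

/-- The slice maps, as a bilinear map. -/
noncomputable def sliceHom : HopfDual H →ₗ[ℂ] B ⊗[ℂ] H →ₗ[ℂ] B :=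
  LinearMap.mk₂ ℂ (fun φ z => slice (toDual φ) z)
    (by intro φ ψ z; simp [slice, LinearMap.lTensor_add])
    (by intro c φ z; simp [slice, LinearMap.lTensor_smul])
    (by intro φ a b; simp)
    (by intro c φ b; simp)

@[simp] theorem sliceHom_apply (φ : HopfDual H) (z : B ⊗[ℂ] H) :
    sliceHom φ z = slice (toDual φ) z := rfl

/-- `φ ⊗ ψ ↦ (id ⊗ φ)(x) (id ⊗ ψ)(y)`. -/
noncomputable def slicePair (x y : B ⊗[ℂ] H) : HopfDual H ⊗[ℂ] HopfDual H →ₗ[ℂ] B :=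
  TensorProduct.lift ((LinearMap.mul ℂ B).compl₁₂ (sliceHom.flip x) (sliceHom.flip y))

@[simp] theorem slicePair_tmul (x y : B ⊗[ℂ] H) (φ ψ : HopfDual H) :
    slicePair x y (φ ⊗ₜ ψ) = slice (toDual φ) x * slice (toDual ψ) y := by
  simp [slicePair]

theorem slice_mul (x y : B ⊗[ℂ] H) (φ : HopfDual H) :
    slice (toDual φ) (x * y) = slicePair x y (Coalgebra.comul (R := ℂ) φ) := by
  induction x with
  | zero =>
    have : slicePair (0 : B ⊗[ℂ] H) y = 0 := TensorProduct.ext' fun α β => by simp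
    simp [this]
  | add x x' hx hx' =>
    have : slicePair (x + x') y = slicePair x y + slicePair x' y :=
      TensorProduct.ext' fun α β => by simp [add_mul]
    rw [this, add_mul, map_add, hx, hx', LinearMap.add_apply]
  | tmul a h =>
    induction y with
    | zero =>
      have : slicePair (a ⊗ₜ[ℂ] h) 0 = 0 := TensorProduct.ext' fun α β => by simp
      simp [this]
    | add y y' hy hy' =>
      have : slicePair (a ⊗ₜ[ℂ] h) (y + y')
          = slicePair (a ⊗ₜ[ℂ] h) y + slicePair (a ⊗ₜ[ℂ] h) y' :=
        TensorProduct.ext' fun α β => by simp [mul_add]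
      rw [this, mul_add, map_add, hy, hy', LinearMap.add_apply]
    | tmul b k =>
      rw [Algebra.TensorProduct.tmul_mul_tmul, slice_tmul, ← toDual₂_comul']
      generalize Coalgebra.comul (R := ℂ) φ = t
      induction t with
      | zero => simp
      | add t t' ht ht' => simp [add_smul, ht, ht']
      | tmul α β =>
        simp only [toDual₂_tmul, slicePair_tmul, slice_tmul, smul_mul_smul_comm]

theorem act_mul (ρ : Coaction B H) (φ : HopfDual H) (a b : B) :
    ρ.act φ (a * b) = ρ.actPair a b (Coalgebra.comul (R := ℂ) φ) := by
  rw [act_apply, map_mul, slice_mul]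
  rfl

theorem act_one (ρ : Coaction B H) (φ : HopfDual H) : ρ.act φ 1 = φ 1 • (1 : B) := by
  rw [act_apply, map_one, Algebra.TensorProduct.one_def, slice_tmul]

theorem one_act (ρ : Coaction B H) (b : B) : ρ.act 1 b = b := ρ.counit_apply b

theorem mul_act (ρ : Coaction B H) (φ ψ : HopfDual H) (b : B) :
    ρ.act (φ * ψ) b = ρ.act φ (ρ.act ψ b) := by
  have h1 : ∀ z : B ⊗[ℂ] H, slice (toDual φ) (ρ (slice (toDual ψ) z))
      = slice (toDual₂ (φ ⊗ₜ ψ)) (TensorProduct.assoc ℂ B H H (ρ.lin.rTensor H z)) := by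
    intro z
    induction z with
    | zero => simp
    | add x y hx hy => simp only [map_add, hx, hy]
    | tmul c k =>
      simp only [slice_tmul, map_smul, LinearMap.rTensor_tmul, lin_apply]
      generalize ρ c = w
      induction w with
      | zero => simp
      | add x y hx hy => simp only [map_add, hx, hy, smul_add, TensorProduct.add_tmul]
      | tmul d l =>
        simp only [slice_tmul, TensorProduct.assoc_tmul, toDual₂_tmul]
        rw [smul_smul, mul_comm]
  have h2 : ∀ z : B ⊗[ℂ] H, slice (toDual (φ * ψ)) z
      = slice (toDual₂ (φ ⊗ₜ ψ)) (Coalgebra.comul.lTensor B z) := by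
    intro z
    induction z with
    | zero => simp
    | add x y hx hy => simp only [map_add, hx, hy]
    | tmul c k =>
      rw [slice_tmul, LinearMap.lTensor_tmul, slice_tmul, mul_apply']
      congr 1
  rw [act_apply, act_apply, act_apply, h1, coassoc, h2]

theorem star_act (ρ : Coaction B H) (φ : HopfDual H) (b : B) :
    star (ρ.act φ b) = ρ.act (conjDual φ) (star b) := by
  have h : ∀ z : B ⊗[ℂ] H, star (slice (toDual φ) z) = slice (toDual (conjDual φ)) (star z) := by
    intro z
    induction z with
    | zero => simp
    | add x y hx hy => simp only [map_add, star_add, hx, hy]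
    | tmul c k => simp
  rw [act_apply, act_apply, h, ← map_star]

/-- `φ ⊗ ψ` acts on `B ⊗ H⁰` by `b ⊗ χ ↦ (φ · b) ⊗ ψχ`. -/
noncomputable def diag (ρ : Coaction B H) :
    HopfDual H ⊗[ℂ] HopfDual H →ₗ[ℂ] B ⊗[ℂ] HopfDual H →ₗ[ℂ] B ⊗[ℂ] HopfDual H :=
  TensorProduct.lift
    ((TensorProduct.mapBilinear (RingHom.id ℂ) B (HopfDual H) B (HopfDual H)).compl₁₂ ρ.act
      (LinearMap.mul ℂ (HopfDual H)))

@[simp] theorem diag_tmul (ρ : Coaction B H) (φ ψ χ : HopfDual H) (b : B) :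
    ρ.diag (φ ⊗ₜ ψ) (b ⊗ₜ χ) = ρ.act φ b ⊗ₜ (ψ * χ) := by
  simp [diag]

theorem diag_mul (ρ : Coaction B H) (s t : HopfDual H ⊗[ℂ] HopfDual H) (z : B ⊗[ℂ] HopfDual H) :
    ρ.diag (s * t) z = ρ.diag s (ρ.diag t z) := by
  induction s with
  | zero => simp
  | add x y hx hy => simp only [add_mul, map_add, LinearMap.add_apply, hx, hy]
  | tmul φ ψ =>
    induction t with
    | zero => simp
    | add x y hx hy => simp only [mul_add, map_add, LinearMap.add_apply, hx, hy]
    | tmul φ' ψ' =>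
      induction z with
      | zero => simp
      | add x y hx hy => simp only [map_add, hx, hy]
      | tmul b χ => simp [mul_act, mul_assoc]

theorem diag_one (ρ : Coaction B H) (z : B ⊗[ℂ] HopfDual H) : ρ.diag 1 z = z := by
  induction z with
  | zero => simp
  | add x y hx hy => simp only [map_add, hx, hy]
  | tmul b χ => simp [Algebra.TensorProduct.one_def, one_act]

/-- Left multiplication by `b` on the first leg of `B ⊗ H⁰`. -/
noncomputable def lmulB : B →ₗ[ℂ] B ⊗[ℂ] HopfDual H →ₗ[ℂ] B ⊗[ℂ] HopfDual H :=
  (LinearMap.rTensorHom (HopfDual H)) ∘ₗ LinearMap.mul ℂ B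

@[simp] theorem lmulB_tmul (a b : B) (χ : HopfDual H) :
    lmulB a (b ⊗ₜ[ℂ] χ) = (a * b) ⊗ₜ χ := by
  simp [lmulB]

theorem lmulB_mul (a b : B) (z : B ⊗[ℂ] HopfDual H) :
    lmulB (a * b) z = lmulB a (lmulB b z) := by
  induction z with
  | zero => simp
  | add x y hx hy => simp only [map_add, hx, hy]
  | tmul b χ => simp [mul_assoc]

theorem lmulB_one (z : B ⊗[ℂ] HopfDual H) : lmulB (1 : B) z = z := by
  induction z with
  | zero => simp
  | add x y hx hy => simp only [map_add, hx, hy]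
  | tmul b χ => simp

/-- The product of the crossed product: `(a ⋊ φ)(b ⋊ ψ) = a(φ₁ · b) ⋊ φ₂ψ`. -/
noncomputable def smashMul (ρ : Coaction B H) :
    B ⊗[ℂ] HopfDual H →ₗ[ℂ] B ⊗[ℂ] HopfDual H →ₗ[ℂ] B ⊗[ℂ] HopfDual H :=
  TensorProduct.lift (LinearMap.compl₁₂ (LinearMap.mul ℂ (Module.End ℂ (B ⊗[ℂ] HopfDual H)))
    lmulB (ρ.diag ∘ₗ Coalgebra.comul))

theorem smashMul_tmul (ρ : Coaction B H) (a : B) (φ : HopfDual H) (z : B ⊗[ℂ] HopfDual H) :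
    ρ.smashMul (a ⊗ₜ φ) z = lmulB a (ρ.diag (Coalgebra.comul φ) z) := by
  simp [smashMul]

theorem smashMul_tmul_tmul (ρ : Coaction B H) (a b : B) (φ ψ : HopfDual H) {ι : Type*}
    (r : Repr ℂ φ ι) : ρ.smashMul (a ⊗ₜ φ) (b ⊗ₜ ψ)
      = ∑ i ∈ r.index, (a * ρ.act (r.left i) b) ⊗ₜ (r.right i * ψ) := by
  rw [smashMul_tmul, ← r.eq]
  simp [map_sum]

theorem diag_lmulB (ρ : Coaction B H) (φ : HopfDual H) (b : B) (z : B ⊗[ℂ] HopfDual H) :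
    ρ.diag (Coalgebra.comul φ) (lmulB b z)
      = TensorProduct.lift (((LinearMap.mul ℂ (Module.End ℂ (B ⊗[ℂ] HopfDual H))).compl₁₂
          (lmulB ∘ₗ ρ.act.flip b) (ρ.diag ∘ₗ Coalgebra.comul))) (Coalgebra.comul φ) z := by
  induction z with
  | zero => simp
  | add x y hx hy => simp only [map_add, hx, hy]
  | tmul c χ =>
    let F : HopfDual H ⊗[ℂ] (HopfDual H ⊗[ℂ] HopfDual H) →ₗ[ℂ] B ⊗[ℂ] HopfDual H :=
      TensorProduct.map (ρ.actPair b c) (LinearMap.mulRight ℂ χ) ∘ₗ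
        (TensorProduct.assoc ℂ _ _ _).symm.toLinearMap
    have h1 : ∀ t : HopfDual H ⊗[ℂ] HopfDual H,
        F (TensorProduct.assoc ℂ _ _ _ (Coalgebra.comul.rTensor _ t))
          = ρ.diag t ((b * c) ⊗ₜ χ) := by
      intro t
      induction t with
      | zero => simp
      | add x y hx hy => simp only [map_add, hx, hy, LinearMap.add_apply]
      | tmul α β => simp [F, act_mul]
    have h2 : ∀ t : HopfDual H ⊗[ℂ] HopfDual H,
        F (Coalgebra.comul.lTensor _ t) = TensorProduct.lift
          (((LinearMap.mul ℂ (Module.End ℂ (B ⊗[ℂ] HopfDual H))).compl₁₂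
          (lmulB ∘ₗ ρ.act.flip b) (ρ.diag ∘ₗ Coalgebra.comul))) t (c ⊗ₜ χ) := by
      intro t
      induction t with
      | zero => simp
      | add x y hx hy => simp only [map_add, hx, hy, LinearMap.add_apply]
      | tmul α β =>
        simp only [LinearMap.lTensor_tmul, TensorProduct.lift.tmul, LinearMap.compl₁₂_apply,
          LinearMap.comp_apply, LinearMap.mul_apply', Module.End.mul_apply]
        generalize Coalgebra.comul (R := ℂ) β = s
        induction s with
        | zero => simp
        | add x y hx hy =>
          simp only [map_add, hx, hy, LinearMap.add_apply, TensorProduct.tmul_add]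
        | tmul γ δ => simp [F]
    rw [lmulB_tmul, ← h1, Coalgebra.coassoc_apply, h2]

theorem smashMul_assoc (ρ : Coaction B H) (x y z : B ⊗[ℂ] HopfDual H) :
    ρ.smashMul (ρ.smashMul x y) z = ρ.smashMul x (ρ.smashMul y z) := by
  induction x with
  | zero => simp
  | add x x' hx hx' => simp only [map_add, LinearMap.add_apply, hx, hx']
  | tmul a φ =>
    induction y with
    | zero => simp
    | add y y' hy hy' => simp only [map_add, LinearMap.add_apply, hy, hy']
    | tmul b ψ =>
      rw [smashMul_tmul _ b ψ z, smashMul_tmul, smashMul_tmul, diag_lmulB]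
      generalize Coalgebra.comul (R := ℂ) φ = t
      induction t with
      | zero => simp
      | add x y hx hy => simp only [map_add, LinearMap.add_apply, hx, hy]
      | tmul α β =>
        simp [smashMul_tmul, diag_mul, lmulB_mul]

theorem one_smashMul (ρ : Coaction B H) (z : B ⊗[ℂ] HopfDual H) :
    ρ.smashMul (1 ⊗ₜ 1) z = z := by
  rw [smashMul_tmul, Bialgebra.comul_one, diag_one, lmulB_one]

theorem diag_comul_one (ρ : Coaction B H) (φ : HopfDual H) (b : B) (χ : HopfDual H)
    (hb : ∀ α : HopfDual H, ρ.act α b = α 1 • b) :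
    ρ.diag (Coalgebra.comul φ) (b ⊗ₜ χ) = b ⊗ₜ (φ * χ) := by
  have h : ∀ t : HopfDual H ⊗[ℂ] HopfDual H, ρ.diag t (b ⊗ₜ χ)
      = b ⊗ₜ ((TensorProduct.lid ℂ _ (Coalgebra.counit.rTensor _ t) : HopfDual H) * χ) := by
    intro t
    induction t with
    | zero => simp
    | add x y hx hy =>
      simp only [map_add, LinearMap.add_apply, hx, hy, TensorProduct.tmul_add, add_mul]
    | tmul α β => simp [hb, TensorProduct.smul_tmul]
  rw [h, Coalgebra.rTensor_counit_comul, TensorProduct.lid_tmul, one_smul]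

theorem smashMul_one (ρ : Coaction B H) (z : B ⊗[ℂ] HopfDual H) :
    ρ.smashMul z (1 ⊗ₜ 1) = z := by
  induction z with
  | zero => simp
  | add x y hx hy => simp only [map_add, LinearMap.add_apply, hx, hy]
  | tmul a φ =>
    rw [smashMul_tmul, diag_comul_one ρ φ 1 1 (ρ.act_one)]
    simp

end Action

end Coaction

open Coaction HopfDual CStarHopfAlgebra in
/-- The crossed product `B ⋊ H⁰` by the action of `H⁰` induced by a coaction of `H` on `B`.
Its underlying vector space is `B ⊗ H⁰`. -/
def CrossedProduct {B H : Type*} [Ring B] [Algebra ℂ B] [StarRing B] [StarModule ℂ B]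
    [Ring H] [HopfAlgebra ℂ H] [StarRing H] [CStarHopfAlgebra H] (_ρ : Coaction B H) : Type _ :=
  B ⊗[ℂ] HopfDual H

namespace CrossedProduct

open Coaction HopfDual CStarHopfAlgebra

variable {B H : Type*} [Ring B] [Algebra ℂ B] [StarRing B] [StarModule ℂ B]
  [Ring H] [HopfAlgebra ℂ H] [StarRing H] [CStarHopfAlgebra H] (ρ : Coaction B H)

noncomputable instance instAddCommGroup : AddCommGroup (CrossedProduct ρ) :=
  inferInstanceAs (AddCommGroup (B ⊗[ℂ] HopfDual H))

noncomputable instance instModule : Module ℂ (CrossedProduct ρ) :=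
  inferInstanceAs (Module ℂ (B ⊗[ℂ] HopfDual H))

/-- The identification of vector spaces `B ⊗ H⁰ = B ⋊ H⁰`. -/
noncomputable def ofTensor : B ⊗[ℂ] HopfDual H ≃ₗ[ℂ] CrossedProduct ρ :=
  LinearEquiv.refl ℂ (B ⊗[ℂ] HopfDual H)

/-- The element `b ⋊ φ`. -/
noncomputable def mk (b : B) (φ : HopfDual H) : CrossedProduct ρ := ofTensor ρ (b ⊗ₜ φ)

noncomputable instance : Ring (CrossedProduct ρ) :=
  { instAddCommGroup ρ with
    mul := fun x y => ρ.smashMul x y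
    one := mk ρ 1 1
    left_distrib := fun x y z => map_add (ρ.smashMul x) y z
    right_distrib := fun x y z => LinearMap.map_add₂ ρ.smashMul x y z
    zero_mul := fun x => LinearMap.map_zero₂ ρ.smashMul x
    mul_zero := fun x => map_zero (ρ.smashMul x)
    mul_assoc := ρ.smashMul_assoc
    one_mul := ρ.one_smashMul
    mul_one := ρ.smashMul_one }

noncomputable instance : Algebra ℂ (CrossedProduct ρ) :=
  Algebra.ofModule (fun c x y => LinearMap.map_smul₂ ρ.smashMul c x y)
    (fun c x y => map_smul (ρ.smashMul x) c y)

theorem mul_def (x y : B ⊗[ℂ] HopfDual H) :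
    ofTensor ρ x * ofTensor ρ y = ofTensor ρ (ρ.smashMul x y) := rfl

theorem one_def : (1 : CrossedProduct ρ) = mk ρ 1 1 := rfl

/-- The product formula `(a ⋊ φ)(b ⋊ ψ) = a(φ₁ · b) ⋊ φ₂ψ`. -/
theorem mk_mul_mk (a b : B) (φ ψ : HopfDual H) {ι : Type*} (r : Repr ℂ φ ι) :
    mk ρ a φ * mk ρ b ψ = ∑ i ∈ r.index, mk ρ (a * ρ.act (r.left i) b) (r.right i * ψ) := by
  rw [mk, mk, mul_def, smashMul_tmul_tmul ρ a b φ ψ r, map_sum]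
  rfl

theorem mk_one_mul (a : B) (z : B ⊗[ℂ] HopfDual H) :
    mk ρ a 1 * ofTensor ρ z = ofTensor ρ (lmulB a z) := by
  rw [mk, mul_def, smashMul_tmul, Bialgebra.comul_one, diag_one]

theorem one_mk_mul (φ : HopfDual H) (z : B ⊗[ℂ] HopfDual H) :
    mk ρ 1 φ * ofTensor ρ z = ofTensor ρ (ρ.diag (Coalgebra.comul φ) z) := by
  rw [mk, mul_def, smashMul_tmul, lmulB_one]

theorem mk_eq (a : B) (φ : HopfDual H) : mk ρ a φ = mk ρ a 1 * mk ρ 1 φ := by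
  rw [show mk ρ 1 φ = ofTensor ρ (1 ⊗ₜ φ) from rfl, mk_one_mul]; simp [mk]

theorem mk_one_mul_mk_one (a b : B) : mk ρ a 1 * mk ρ b 1 = mk ρ (a * b) 1 := by
  rw [show mk ρ b 1 = ofTensor ρ (b ⊗ₜ 1) from rfl, mk_one_mul]; simp [mk]

theorem one_mk_mul_one_mk (φ ψ : HopfDual H) : mk ρ 1 φ * mk ρ 1 ψ = mk ρ 1 (φ * ψ) := by
  rw [show mk ρ 1 ψ = ofTensor ρ (1 ⊗ₜ ψ) from rfl, one_mk_mul,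
    diag_comul_one ρ φ 1 ψ ρ.act_one, mk]

theorem induction {P : CrossedProduct ρ → Prop} (h0 : P 0) (h1 : ∀ b φ, P (mk ρ b φ))
    (h2 : ∀ x y, P x → P y → P (x + y)) (x : CrossedProduct ρ) : P x :=
  TensorProduct.induction_on (motive := fun z => P (ofTensor ρ z)) x h0 h1 h2

/-- `b ⊗ ψ ↦ (1 ⋊ ψ)(b ⋊ 1)`. -/
noncomputable def flipMul : B ⊗[ℂ] HopfDual H →ₗ[ℂ] CrossedProduct ρ :=
  (ofTensor ρ).toLinearMap ∘ₗ TensorProduct.lift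
    ((ρ.diag ∘ₗ Coalgebra.comul).flip ∘ₗ (TensorProduct.mk ℂ B (HopfDual H)).flip 1)

theorem flipMul_tmul (b : B) (ψ : HopfDual H) :
    flipMul ρ (b ⊗ₜ ψ) = mk ρ 1 ψ * mk ρ b 1 := by
  rw [show mk ρ b 1 = ofTensor ρ (b ⊗ₜ 1) from rfl, one_mk_mul]
  simp [flipMul]

/-- The involution `(a ⋊ φ)⋆ = (1 ⋊ φ⋆)(a⋆ ⋊ 1) = (φ₁⋆ · a⋆) ⋊ φ₂⋆`. -/
noncomputable instance : Star (CrossedProduct ρ) where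
  star x := flipMul ρ (star ((ofTensor ρ).symm x))

theorem star_mk (a : B) (φ : HopfDual H) :
    star (mk ρ a φ) = mk ρ 1 (star φ) * mk ρ (star a) 1 := by
  rw [← flipMul_tmul]
  rfl

theorem star_add' (x y : CrossedProduct ρ) : star (x + y) = star x + star y := by
  change flipMul ρ (star ((ofTensor ρ).symm (x + y)))
    = flipMul ρ (star ((ofTensor ρ).symm x)) + flipMul ρ (star ((ofTensor ρ).symm y))
  rw [map_add, star_add, map_add]

theorem star_zero' : star (0 : CrossedProduct ρ) = 0 := by
  change flipMul ρ (star ((ofTensor ρ).symm 0)) = 0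
  rw [map_zero, star_zero, map_zero]

/-- `α ↦ α ∘ S⁻¹`. -/
noncomputable def antipodeInvDual : HopfDual H →ₗ[ℂ] HopfDual H :=
  toDual.symm.toLinearMap ∘ₗ (antipodeInv (H := H)).dualMap ∘ₗ toDual.toLinearMap

@[simp] theorem antipodeInvDual_apply (α : HopfDual H) (h : H) :
    antipodeInvDual α h = α (antipodeInv h) := by
  simp [antipodeInvDual]

theorem conjDual_star (α : HopfDual H) : conjDual (star α) = antipodeInvDual α := by
  ext h
  simp [antipodeInv_apply]

/-- `α ⊗ β ↦ β (α ∘ S⁻¹)`. -/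
noncomputable def mulAntipodeInv : HopfDual H ⊗[ℂ] HopfDual H →ₗ[ℂ] HopfDual H :=
  TensorProduct.lift ((LinearMap.mul ℂ (HopfDual H)).flip ∘ₗ antipodeInvDual)

theorem mulAntipodeInv_apply (t : HopfDual H ⊗[ℂ] HopfDual H) {ι : Type*} {h : H}
    (r : Repr ℂ h ι) : mulAntipodeInv t h
      = ∑ i ∈ r.index, toDual₂ t (antipodeInv (r.right i) ⊗ₜ r.left i) := by
  induction t with
  | zero => simp
  | add x y hx hy => simp [hx, hy, Finset.sum_add_distrib]
  | tmul α β => simp [mulAntipodeInv, mul_apply _ _ r, mul_comm]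

theorem mulAntipodeInv_comul (χ : HopfDual H) :
    mulAntipodeInv (Coalgebra.comul χ) = χ 1 • (1 : HopfDual H) := by
  ext h
  rw [mulAntipodeInv_apply _ (Repr.arbitrary ℂ h)]
  simp only [toDual₂_comul']
  rw [← map_sum, sum_antipodeInv_mul]
  simp [Algebra.algebraMap_eq_smul_one, one_apply, mul_comm]

theorem star_one_mk_mul (φ : HopfDual H) (b : B) :
    star (mk ρ 1 φ * mk ρ b 1) = mk ρ (star b) (star φ) := by
  obtain ⟨χ, rfl⟩ : ∃ χ, φ = star χ := ⟨star φ, (star_star φ).symm⟩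
  rw [star_star, show mk ρ b 1 = ofTensor ρ (b ⊗ₜ 1) from rfl, one_mk_mul, HopfDual.comul_star]
  let G : HopfDual H ⊗[ℂ] (HopfDual H ⊗[ℂ] HopfDual H) →ₗ[ℂ] B ⊗[ℂ] HopfDual H :=
    TensorProduct.map (ρ.act.flip (star b) ∘ₗ mulAntipodeInv) LinearMap.id ∘ₗ
      (TensorProduct.assoc ℂ _ _ _).symm.toLinearMap
  have h1 : ∀ t : HopfDual H ⊗[ℂ] HopfDual H,
      star (ofTensor ρ (ρ.diag (star t) (b ⊗ₜ 1)))
        = ofTensor ρ (G (Coalgebra.comul.lTensor _ t)) := by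
    intro t
    induction t with
    | zero => simp [star_zero']
    | add x y hx hy => simp only [star_add, map_add, LinearMap.add_apply, star_add', hx, hy]
    | tmul α β =>
      rw [TensorProduct.star_tmul, diag_tmul, mul_one, ← mk, star_mk, star_star, star_act,
        conjDual_star, LinearMap.lTensor_tmul,
        show ∀ c, mk ρ c 1 = ofTensor ρ (c ⊗ₜ 1) from fun _ => rfl, one_mk_mul]
      congr 1
      generalize Coalgebra.comul (R := ℂ) β = s
      induction s with
      | zero => simp
      | add x y hx hy => simp only [map_add, LinearMap.add_apply, TensorProduct.tmul_add, hx, hy]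
      | tmul γ δ => simp [G, mulAntipodeInv, mul_act]
  have h2 : ∀ t : HopfDual H ⊗[ℂ] HopfDual H,
      G (TensorProduct.assoc ℂ _ _ _ (Coalgebra.comul.rTensor _ t))
        = star b ⊗ₜ (TensorProduct.lid ℂ _ (Coalgebra.counit.rTensor _ t)) := by
    intro t
    induction t with
    | zero => simp
    | add x y hx hy => simp only [map_add, TensorProduct.tmul_add, hx, hy]
    | tmul α β => simp [G, mulAntipodeInv_comul, one_act, TensorProduct.smul_tmul]
  rw [h1, ← Coalgebra.coassoc_apply, h2, Coalgebra.rTensor_counit_comul, TensorProduct.lid_tmul,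
    one_smul, mk]

theorem star_mul_mul (a : B) (ψ : HopfDual H) (z : CrossedProduct ρ) :
    star (mk ρ a 1 * z * mk ρ 1 ψ) = mk ρ 1 (star ψ) * star z * mk ρ (star a) 1 := by
  induction z using CrossedProduct.induction with
  | h0 => simp [star_zero']
  | h2 x y hx hy => simp only [mul_add, add_mul, star_add', hx, hy]
  | h1 b φ =>
    rw [mk_eq ρ b φ, ← mul_assoc, mk_one_mul_mk_one, mul_assoc, one_mk_mul_one_mk, ← mk_eq,
      star_mk, star_mul, star_mul, ← mk_one_mul_mk_one, ← one_mk_mul_one_mk, ← mk_eq, star_mk]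
    simp only [mul_assoc]

theorem star_mul' (x y : CrossedProduct ρ) : star (x * y) = star y * star x := by
  induction x using CrossedProduct.induction with
  | h0 => simp [star_zero']
  | h2 x x' hx hx' => simp only [mul_add, add_mul, star_add', hx, hx']
  | h1 a φ =>
    induction y using CrossedProduct.induction with
    | h0 => simp [star_zero']
    | h2 y y' hy hy' => simp only [mul_add, add_mul, star_add', hy, hy']
    | h1 b ψ =>
      have : mk ρ a φ * mk ρ b ψ = mk ρ a 1 * (mk ρ 1 φ * mk ρ b 1) * mk ρ 1 ψ := by
        rw [mk_eq ρ a φ, mk_eq ρ b ψ]; simp only [mul_assoc]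
      rw [this, star_mul_mul, star_one_mk_mul, mk_eq ρ (star b), star_mk, star_mk]
      simp only [mul_assoc]

noncomputable instance : StarRing (CrossedProduct ρ) where
  star_involutive x := by
    induction x using CrossedProduct.induction with
    | h0 => simp [star_zero']
    | h2 x x' hx hx' => rw [star_add', star_add', hx, hx']
    | h1 a φ => rw [star_mk, star_one_mk_mul, star_star, star_star]
  star_mul := star_mul' ρ
  star_add := star_add' ρ

instance : StarModule ℂ (CrossedProduct ρ) where
  star_smul c x := by
    change flipMul ρ (star ((ofTensor ρ).symm (c • x)))
      = star c • flipMul ρ (star ((ofTensor ρ).symm x))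
    rw [map_smul, star_smul, map_smul]

theorem star_mk_one (a : B) : star (mk ρ a 1) = mk ρ (star a) 1 := by
  rw [star_mk, star_one, ← one_def, one_mul]

theorem star_one_mk (φ : HopfDual H) : star (mk ρ 1 φ) = mk ρ 1 (star φ) := by
  rw [star_mk, star_one, ← one_def, mul_one]

end CrossedProduct
namespace CrossedProduct

open Coaction HopfDual CStarHopfAlgebra

variable {B H : Type*} [Ring B] [Algebra ℂ B] [StarRing B] [StarModule ℂ B]
  [Ring H] [HopfAlgebra ℂ H] [StarRing H] [CStarHopfAlgebra H] (ρ : Coaction B H)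

/-- `b ⊗ (φ ⊗ ψ) ↦ (b ⋊ φ) ⊗ ψ`. -/
noncomputable def reassoc :
    B ⊗[ℂ] (HopfDual H ⊗[ℂ] HopfDual H) →ₗ[ℂ] CrossedProduct ρ ⊗[ℂ] HopfDual H :=
  (ofTensor ρ).toLinearMap.rTensor (HopfDual H) ∘ₗ
    (TensorProduct.assoc ℂ B (HopfDual H) (HopfDual H)).symm.toLinearMap

@[simp] theorem reassoc_tmul (b : B) (φ ψ : HopfDual H) :
    reassoc ρ (b ⊗ₜ (φ ⊗ₜ ψ)) = mk ρ b φ ⊗ₜ ψ := by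
  simp [reassoc, mk]

/-- The map `b ⋊ φ ↦ (b ⋊ φ₁) ⊗ φ₂`. -/
noncomputable def dualLin : CrossedProduct ρ →ₗ[ℂ] CrossedProduct ρ ⊗[ℂ] HopfDual H :=
  reassoc ρ ∘ₗ Coalgebra.comul.lTensor B ∘ₗ (ofTensor ρ).symm.toLinearMap

theorem dualLin_ofTensor (z : B ⊗[ℂ] HopfDual H) :
    dualLin ρ (ofTensor ρ z) = reassoc ρ (Coalgebra.comul.lTensor B z) := by
  simp [dualLin]

theorem dualLin_mk (b : B) (φ : HopfDual H) :
    dualLin ρ (mk ρ b φ) = reassoc ρ (b ⊗ₜ Coalgebra.comul φ) := by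
  rw [mk, dualLin_ofTensor, LinearMap.lTensor_tmul]

theorem dualLin_mk_one (b : B) : dualLin ρ (mk ρ b 1) = mk ρ b 1 ⊗ₜ 1 := by
  rw [dualLin_mk, Bialgebra.comul_one, Algebra.TensorProduct.one_def, reassoc_tmul]

theorem mk_one_tmul_mul_reassoc (a b : B) (s : HopfDual H ⊗[ℂ] HopfDual H) :
    (mk ρ a 1 ⊗ₜ[ℂ] (1 : HopfDual H)) * reassoc ρ (b ⊗ₜ s) = reassoc ρ ((a * b) ⊗ₜ s) := by
  induction s with
  | zero => simp
  | add x y hx hy => simp only [TensorProduct.tmul_add, map_add, mul_add, hx, hy]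
  | tmul φ ψ =>
    rw [reassoc_tmul, reassoc_tmul, Algebra.TensorProduct.tmul_mul_tmul, one_mul]
    congr 1
    exact mk_one_mul ρ a (b ⊗ₜ φ)

theorem dualLin_mk_one_mul (a : B) (x : CrossedProduct ρ) :
    dualLin ρ (mk ρ a 1 * x) = dualLin ρ (mk ρ a 1) * dualLin ρ x := by
  induction x using CrossedProduct.induction with
  | h0 => simp
  | h2 x y hx hy => simp only [mul_add, map_add, hx, hy]
  | h1 b φ =>
    have : mk ρ a 1 * mk ρ b φ = mk ρ (a * b) φ := by
      rw [show mk ρ b φ = ofTensor ρ (b ⊗ₜ φ) from rfl, mk_one_mul, lmulB_tmul, mk]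
    rw [this, dualLin_mk_one, dualLin_mk, dualLin_mk, mk_one_tmul_mul_reassoc]

theorem dualLin_one_mk_mul (φ : HopfDual H) (x : CrossedProduct ρ) :
    dualLin ρ (mk ρ 1 φ * x) = dualLin ρ (mk ρ 1 φ) * dualLin ρ x := by
  induction x using CrossedProduct.induction with
  | h0 => simp
  | h2 x y hx hy => simp only [mul_add, map_add, hx, hy]
  | h1 b ψ =>
    rw [show mk ρ b ψ = ofTensor ρ (b ⊗ₜ ψ) from rfl, one_mk_mul, dualLin_mk, dualLin_ofTensor,
      dualLin_ofTensor, LinearMap.lTensor_tmul]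
    let K : HopfDual H ⊗[ℂ] (HopfDual H ⊗[ℂ] HopfDual H) →ₗ[ℂ]
        CrossedProduct ρ ⊗[ℂ] HopfDual H :=
      reassoc ρ ∘ₗ TensorProduct.map (ρ.act.flip b)
        (LinearMap.mulRight ℂ (Coalgebra.comul (R := ℂ) ψ))
    have h1 : ∀ t : HopfDual H ⊗[ℂ] HopfDual H,
        reassoc ρ (Coalgebra.comul.lTensor B (ρ.diag t (b ⊗ₜ ψ)))
          = K (Coalgebra.comul.lTensor _ t) := by
      intro t
      induction t with
      | zero => simp
      | add x y hx hy => simp only [map_add, LinearMap.add_apply, hx, hy]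
      | tmul α β => simp [K, Bialgebra.comul_mul]
    have h2 : ∀ (s : HopfDual H ⊗[ℂ] HopfDual H) (γ : HopfDual H),
        K (TensorProduct.assoc ℂ _ _ _ (s ⊗ₜ γ))
          = TensorProduct.map ((ofTensor ρ).toLinearMap ∘ₗ ρ.diag s) (LinearMap.mulLeft ℂ γ)
            ((TensorProduct.assoc ℂ _ _ _).symm (b ⊗ₜ Coalgebra.comul (R := ℂ) ψ)) := by
      intro s γ
      induction s with
      | zero => simp
      | add x y hx hy =>
        simp only [map_add, TensorProduct.add_tmul, hx, hy, LinearMap.comp_add,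
          TensorProduct.map_add_left, LinearMap.add_apply]
      | tmul α β =>
        simp only [K, LinearMap.comp_apply, TensorProduct.assoc_tmul, TensorProduct.map_tmul,
          LinearMap.mulRight_apply, LinearMap.flip_apply]
        generalize Coalgebra.comul (R := ℂ) ψ = u
        induction u with
        | zero => simp
        | add x y hx hy => simp only [mul_add, map_add, TensorProduct.tmul_add, hx, hy]
        | tmul δ ε => simp [mk]
    have h3 : ∀ t : HopfDual H ⊗[ℂ] HopfDual H,
        K (TensorProduct.assoc ℂ _ _ _ (Coalgebra.comul.rTensor _ t))
          = reassoc ρ (1 ⊗ₜ t) * reassoc ρ (b ⊗ₜ Coalgebra.comul (R := ℂ) ψ) := by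
      intro t
      induction t with
      | zero => simp
      | add x y hx hy => simp only [map_add, TensorProduct.tmul_add, add_mul, hx, hy]
      | tmul α β =>
        rw [LinearMap.rTensor_tmul, h2]
        generalize Coalgebra.comul (R := ℂ) ψ = u
        induction u with
        | zero => simp
        | add x y hx hy => simp only [mul_add, map_add, TensorProduct.tmul_add, hx, hy]
        | tmul δ ε =>
          rw [reassoc_tmul, reassoc_tmul, Algebra.TensorProduct.tmul_mul_tmul,
            show mk ρ b δ = ofTensor ρ (b ⊗ₜ δ) from rfl, one_mk_mul]
          simp
    rw [h1, ← Coalgebra.coassoc_apply, h3]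

theorem dualLin_mul (x y : CrossedProduct ρ) :
    dualLin ρ (x * y) = dualLin ρ x * dualLin ρ y := by
  induction x using CrossedProduct.induction with
  | h0 => simp
  | h2 x x' hx hx' => simp only [add_mul, map_add, hx, hx']
  | h1 b φ =>
    rw [mk_eq, mul_assoc, dualLin_mk_one_mul, dualLin_one_mk_mul, dualLin_mk_one_mul, mul_assoc]

theorem dualLin_star (x : CrossedProduct ρ) : dualLin ρ (star x) = star (dualLin ρ x) := by
  induction x using CrossedProduct.induction with
  | h0 => simp
  | h2 x x' hx hx' => simp only [map_add, star_add, hx, hx']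
  | h1 b φ =>
    have h : ∀ t : HopfDual H ⊗[ℂ] HopfDual H,
        reassoc ρ (1 ⊗ₜ star t) = star (reassoc ρ (1 ⊗ₜ t)) := by
      intro t
      induction t with
      | zero => simp
      | add x y hx hy => simp only [star_add, map_add, TensorProduct.tmul_add, hx, hy]
      | tmul α β => simp [star_one_mk]
    rw [mk_eq, star_mul, dualLin_mul, dualLin_mul, star_mul, star_one_mk, star_mk_one,
      dualLin_mk_one, dualLin_mk_one, dualLin_mk, dualLin_mk, HopfDual.comul_star, h,
      TensorProduct.star_tmul, star_mk_one, star_one]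

/-- The dual coaction `b ⋊ φ ↦ (b ⋊ φ₁) ⊗ φ₂` of `H⁰` on `B ⋊ H⁰`. -/
noncomputable def dualCoaction : Coaction (CrossedProduct ρ) (HopfDual H) where
  toFun := dualLin ρ
  map_one' := by
    rw [one_def, dualLin_mk_one, ← one_def, Algebra.TensorProduct.one_def]
  map_mul' := dualLin_mul ρ
  map_zero' := map_zero _
  map_add' := map_add _
  commutes' c := by
    rw [Algebra.algebraMap_eq_smul_one, map_smul, one_def, dualLin_mk_one, ← one_def,
      Algebra.algebraMap_eq_smul_one, Algebra.TensorProduct.one_def]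
  map_star' := dualLin_star ρ
  coassoc' x := by
    induction x using CrossedProduct.induction with
    | h0 => simp
    | h2 x y hx hy =>
      simp only [map_add] at hx hy ⊢
      rw [hx, hy]
    | h1 b φ =>
      change TensorProduct.assoc ℂ _ _ _ ((dualLin ρ).rTensor _ (dualLin ρ (mk ρ b φ)))
        = Coalgebra.comul.lTensor _ (dualLin ρ (mk ρ b φ))
      rw [dualLin_mk]
      let P : HopfDual H ⊗[ℂ] (HopfDual H ⊗[ℂ] HopfDual H) →ₗ[ℂ]
          CrossedProduct ρ ⊗[ℂ] (HopfDual H ⊗[ℂ] HopfDual H) :=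
        LinearMap.rTensor _ ((ofTensor ρ).toLinearMap ∘ₗ TensorProduct.mk ℂ B (HopfDual H) b)
      have h1 : ∀ t : HopfDual H ⊗[ℂ] HopfDual H,
          TensorProduct.assoc ℂ _ _ _ ((dualLin ρ).rTensor _ (reassoc ρ (b ⊗ₜ t)))
            = P (TensorProduct.assoc ℂ _ _ _ (Coalgebra.comul.rTensor _ t)) := by
        intro t
        induction t with
        | zero => simp
        | add x y hx hy => simp only [map_add, TensorProduct.tmul_add, hx, hy]
        | tmul α β =>
          rw [reassoc_tmul, LinearMap.rTensor_tmul, dualLin_mk, LinearMap.rTensor_tmul]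
          generalize Coalgebra.comul (R := ℂ) α = u
          induction u with
          | zero => simp
          | add x y hx hy =>
            simp only [map_add, TensorProduct.tmul_add, TensorProduct.add_tmul, hx, hy]
          | tmul γ δ => simp [P, mk]
      have h2 : ∀ t : HopfDual H ⊗[ℂ] HopfDual H,
          Coalgebra.comul.lTensor _ (reassoc ρ (b ⊗ₜ t)) = P (Coalgebra.comul.lTensor _ t) := by
        intro t
        induction t with
        | zero => simp
        | add x y hx hy => simp only [map_add, TensorProduct.tmul_add, hx, hy]
        | tmul α β => simp [P, mk]
      rw [h1, h2, Coalgebra.coassoc_apply]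
  counit' x := by
    induction x using CrossedProduct.induction with
    | h0 => simp
    | h2 x y hx hy =>
      simp only [map_add] at hx hy ⊢
      rw [hx, hy]
    | h1 b φ =>
      change TensorProduct.rid ℂ _ (Coalgebra.counit.lTensor _ (dualLin ρ (mk ρ b φ))) = mk ρ b φ
      rw [dualLin_mk]
      have h : ∀ t : HopfDual H ⊗[ℂ] HopfDual H,
          TensorProduct.rid ℂ _ (Coalgebra.counit.lTensor _ (reassoc ρ (b ⊗ₜ t)))
            = mk ρ b (TensorProduct.rid ℂ _ (Coalgebra.counit.lTensor _ t)) := by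
        intro t
        induction t with
        | zero => simp [mk]
        | add x y hx hy =>
          simp only [map_add, TensorProduct.tmul_add, hx, hy]
          simp [mk, TensorProduct.tmul_add]
        | tmul α β => simp [mk]
      rw [h, Coalgebra.lTensor_counit_comul, TensorProduct.rid_tmul, one_smul]

theorem dualCoaction_mk (b : B) (φ : HopfDual H) {ι : Type*} (r : Repr ℂ φ ι) :
    dualCoaction ρ (mk ρ b φ) = ∑ i ∈ r.index, mk ρ b (r.left i) ⊗ₜ[ℂ] r.right i := by
  change dualLin ρ (mk ρ b φ) = _
  rw [dualLin_mk, ← r.eq]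
  simp [TensorProduct.tmul_sum]

variable {ρ} {B' : Type*} [Ring B'] [Algebra ℂ B'] [StarRing B'] [StarModule ℂ B']
  {ρ' : Coaction B' H}

/-- The map `b ⋊ φ ↦ f(b) ⋊ φ` between crossed products induced by an equivariant
⋆-homomorphism `f`. -/
noncomputable def mapLin (ρ : Coaction B H) (ρ' : Coaction B' H) (f : B →⋆ₐ[ℂ] B') :
    CrossedProduct ρ →ₗ[ℂ] CrossedProduct ρ' :=
  (ofTensor ρ').toLinearMap ∘ₗ f.toAlgHom.toLinearMap.rTensor (HopfDual H) ∘ₗ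
    (ofTensor ρ).symm.toLinearMap

@[simp] theorem mapLin_mk (f : B →⋆ₐ[ℂ] B') (b : B) (φ : HopfDual H) :
    mapLin ρ ρ' f (mk ρ b φ) = mk ρ' (f b) φ := by
  simp [mapLin, mk]

theorem map_act (f : B →⋆ₐ[ℂ] B')
    (hf : ∀ b, ρ' (f b) = f.toAlgHom.toLinearMap.rTensor H (ρ b)) (φ : HopfDual H) (b : B) :
    f (ρ.act φ b) = ρ'.act φ (f b) := by
  rw [act_apply, act_apply, hf]
  generalize ρ b = z
  induction z with
  | zero => simp
  | add x y hx hy => simp only [map_add, hx, hy]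
  | tmul c h => simp

/-- The ⋆-homomorphism `b ⋊ φ ↦ f(b) ⋊ φ` between crossed products induced by an equivariant
⋆-homomorphism `f`. -/
noncomputable def map (f : B →⋆ₐ[ℂ] B')
    (hf : ∀ b, ρ' (f b) = f.toAlgHom.toLinearMap.rTensor H (ρ b)) :
    CrossedProduct ρ →⋆ₐ[ℂ] CrossedProduct ρ' where
  toFun := mapLin ρ ρ' f
  map_one' := by rw [one_def, mapLin_mk, map_one, one_def]
  map_mul' x y := by
    induction x using CrossedProduct.induction with
    | h0 => simp
    | h2 x x' hx hx' => simp only [add_mul, map_add, hx, hx']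
    | h1 a φ =>
      induction y using CrossedProduct.induction with
      | h0 => simp
      | h2 y y' hy hy' => simp only [mul_add, map_add, hy, hy']
      | h1 b ψ =>
        rw [mk_mul_mk ρ a b φ ψ (Repr.arbitrary ℂ φ), mapLin_mk, mapLin_mk,
          mk_mul_mk ρ' _ _ φ ψ (Repr.arbitrary ℂ φ), map_sum]
        simp [map_act f hf]
  map_zero' := map_zero _
  map_add' := map_add _
  commutes' c := by
    rw [Algebra.algebraMap_eq_smul_one, map_smul, one_def, mapLin_mk, map_one, ← one_def,
      Algebra.algebraMap_eq_smul_one]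
  map_star' x := by
    induction x using CrossedProduct.induction with
    | h0 => simp
    | h2 x x' hx hx' => simp only [map_add, star_add, hx, hx']
    | h1 a φ =>
      rw [star_mk, mk_mul_mk ρ _ _ (star φ) 1 (Repr.arbitrary ℂ (star φ)), mapLin_mk, star_mk,
        mk_mul_mk ρ' _ _ (star φ) 1 (Repr.arbitrary ℂ (star φ)), map_sum]
      simp [map_act f hf, map_star]

end CrossedProduct
namespace CStarHopfAlgebra

section Trace

theorem trace_mulLeft_nonneg {K : Type*} [CStarAlgebra K] [FiniteDimensional ℂ K] (h : K) :
    (∃ r : ℝ, 0 ≤ r ∧ LinearMap.trace ℂ K (LinearMap.mulLeft ℂ (star h * h)) = r) ∧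
    (LinearMap.trace ℂ K (LinearMap.mulLeft ℂ (star h * h)) = 0 → h = 0) := by
  let := CStarAlgebra.spectralOrder K
  let := CStarAlgebra.spectralOrderedRing K
  set f : Module.End ℂ K := LinearMap.mulLeft ℂ (star h * h) with hf
  have htr := Module.End.trace_eq_sum_roots_charpoly_of_splits (f := f) (IsAlgClosed.splits _)
  have hroot : ∀ z ∈ f.charpoly.roots, z ∈ spectrum ℂ (star h * h) := by
    intro z hz hu
    rw [Polynomial.mem_roots (LinearMap.charpoly_monic f).ne_zero,
      ← Module.End.mem_spectrum_iff_isRoot_charpoly] at hz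
    apply hz
    have := hu.map (Algebra.lmul ℂ K)
    rw [map_sub, AlgHom.commutes] at this
    exact this
  have hreal : ∀ z ∈ f.charpoly.roots, z = ((z.re : ℝ) : ℂ) ∧ 0 ≤ z.re := by
    intro z hz
    have hz' := hroot z hz
    have hre := (IsSelfAdjoint.star_mul_self h).mem_spectrum_eq_re hz'
    refine ⟨hre, ?_⟩
    refine spectrum_nonneg_of_nonneg (star_mul_self_nonneg h) (𝕜 := ℝ) ?_
    rw [hre] at hz'
    exact spectrum.of_algebraMap_mem ℂ hz'
  have hmap : f.charpoly.roots = (f.charpoly.roots.map Complex.re).map ((↑) : ℝ → ℂ) := by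
    rw [Multiset.map_map]
    conv_lhs => rw [← Multiset.map_id f.charpoly.roots]
    exact Multiset.map_congr rfl fun z hz => (hreal z hz).1
  have hsum : f.charpoly.roots.sum = (((f.charpoly.roots.map Complex.re).sum : ℝ) : ℂ) := by
    conv_lhs => rw [hmap]
    exact (map_multiset_sum Complex.ofRealHom _).symm
  have hnn : ∀ x ∈ f.charpoly.roots.map Complex.re, 0 ≤ x := by
    intro x hx
    obtain ⟨z, hz, rfl⟩ := Multiset.mem_map.1 hx
    exact (hreal z hz).2
  refine ⟨⟨_, Multiset.sum_nonneg hnn, htr.trans hsum⟩, fun h0 => ?_⟩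
  rw [htr, hsum] at h0
  have h0' := Multiset.all_zero_of_le_zero_le_of_sum_eq_zero hnn (by exact_mod_cast h0)
  have hspec : ∀ z ∈ spectrum ℂ (star h * h), z = 0 := by
    intro z hz
    have hz' : z ∈ f.charpoly.roots := by
      rw [Polynomial.mem_roots (LinearMap.charpoly_monic f).ne_zero,
        ← Module.End.mem_spectrum_iff_isRoot_charpoly]
      intro hu
      apply hz
      rw [spectrum.mem_resolventSet_iff, Module.End.isUnit_iff] at hu
      obtain ⟨k, hk⟩ := hu.2 1
      have hk' : (algebraMap ℂ K z - star h * h) * k = 1 := by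
        simpa [hf, Algebra.algebraMap_eq_smul_one, sub_mul, mul_assoc] using hk
      have hk2 : k * (algebraMap ℂ K z - star h * h) = 1 := by
        apply hu.1
        have : ∀ x : K, (algebraMap ℂ (Module.End ℂ K) z - f) x
            = (algebraMap ℂ K z - star h * h) * x := by
          intro x; simp [hf, Algebra.algebraMap_eq_smul_one, sub_mul, mul_assoc]
        rw [this, this, ← mul_assoc, hk', one_mul, mul_one]
      exact ⟨⟨_, _, hk', hk2⟩, rfl⟩
    have := h0' _ (Multiset.mem_map_of_mem Complex.re hz')
    rw [(hreal z hz').1, this, Complex.ofReal_zero]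
  have hr : spectralRadius ℂ (star h * h) = 0 := by
    simp only [spectralRadius]
    simp only [ENNReal.iSup_eq_zero]
    intro z hz
    simp [hspec z hz]
  rw [(IsSelfAdjoint.star_mul_self h).spectralRadius_eq_nnnorm] at hr
  simpa [CStarRing.star_mul_self_eq_zero_iff] using hr

end Trace

variable {H : Type*} [Ring H] [HopfAlgebra ℂ H] [StarRing H] [CStarHopfAlgebra H]

/-- The functional `h ↦ Tr(x ↦ hx)` on a finite dimensional C⋆-Hopf algebra. -/
noncomputable def regTrace : H →ₗ[ℂ] ℂ := LinearMap.trace ℂ H ∘ₗ LinearMap.mul ℂ H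

theorem regTrace_star_mul_self (h : H) :
    (∃ r : ℝ, 0 ≤ r ∧ regTrace (star h * h) = r) ∧ (regTrace (star h * h) = 0 → h = 0) := by
  obtain ⟨N, hN⟩ := exists_cstarNorm (H := H)
  let i1 : NormedRing H := N.toRingNorm.toNormedRing
  let i2 : NormedAlgebra ℂ H :=
    { (inferInstance : Algebra ℂ H) with norm_smul_le := fun c x => (N.smul' c x).le }
  have i3 : CStarRing H := ⟨fun {x} => (hN x).ge⟩
  have i4 : CompleteSpace H := FiniteDimensional.complete ℂ H
  let : CStarAlgebra H := { i1, i2, i3, i4, ‹StarRing H›, (inferInstance : StarModule ℂ H) with }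
  exact trace_mulLeft_nonneg h

theorem regTrace_conj (x y : H) :
    conj (regTrace (star y * x)) = regTrace (star x * y) := by
  obtain ⟨r, -, hr⟩ := (regTrace_star_mul_self x).1
  obtain ⟨s, -, hs⟩ := (regTrace_star_mul_self y).1
  obtain ⟨t, -, ht⟩ := (regTrace_star_mul_self (x + y)).1
  obtain ⟨u, -, hu⟩ := (regTrace_star_mul_self (x + Complex.I • y)).1
  simp only [star_add, star_smul, add_mul, mul_add, map_add, smul_mul_assoc, mul_smul_comm,
    map_smul, hr, hs, smul_eq_mul, RCLike.star_def, Complex.conj_I] at ht hu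
  apply Complex.ext
  · have h2 := congrArg Complex.im hu
    simp at h2 ⊢
    linarith
  · have h1 := congrArg Complex.im ht
    simp at h1 ⊢
    linarith

theorem exists_orthonormal : ∃ (n : ℕ) (b : Module.Basis (Fin n) ℂ H),
    ∀ i j, regTrace (star (b i) * b j) = if i = j then 1 else 0 := by
  let core : InnerProductSpace.Core ℂ H :=
    { inner := fun x y => regTrace (star x * y)
      conj_inner_symm := fun x y => regTrace_conj x y
      re_inner_nonneg := fun x => by
        obtain ⟨r, hr, h⟩ := (regTrace_star_mul_self x).1
        change 0 ≤ (regTrace (star x * x)).re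
        rw [h]
        exact hr
      add_left := fun x y z => by simp [add_mul]
      smul_left := fun x y r => by simp
      definite := fun x => (regTrace_star_mul_self x).2 }
  let : NormedAddCommGroup H := core.toNormedAddCommGroup
  let : InnerProductSpace ℂ H := InnerProductSpace.ofCore core.toCore
  let b := stdOrthonormalBasis ℂ H
  refine ⟨_, b.toBasis, fun i j => ?_⟩
  have := orthonormal_iff_ite.1 b.orthonormal i j
  simp only [OrthonormalBasis.coe_toBasis]
  exact this

end CStarHopfAlgebra
namespace Coaction

open CStarHopfAlgebra HopfDual

section Expansion

variable {B M : Type*} [Ring B] [Algebra ℂ B] [AddCommGroup M] [Module ℂ M]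

theorem sum_slice_coord {n : ℕ} (b : Module.Basis (Fin n) ℂ M) (x : B ⊗[ℂ] M) :
    x = ∑ i, slice (b.coord i) x ⊗ₜ[ℂ] b i := by
  induction x with
  | zero => simp
  | add x y hx hy =>
    conv_lhs => rw [hx, hy]
    simp only [map_add, TensorProduct.add_tmul, Finset.sum_add_distrib]
  | tmul c m =>
    conv_lhs => rw [← b.sum_repr m, TensorProduct.tmul_sum]
    simp [TensorProduct.smul_tmul]

theorem slice_ext {n : ℕ} (b : Module.Basis (Fin n) ℂ M) {x y : B ⊗[ℂ] M}
    (h : ∀ i, slice (b.coord i) x = slice (b.coord i) y) : x = y := by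
  rw [sum_slice_coord b x, sum_slice_coord b y]
  simp only [h]

theorem slice_rTensor {B' : Type*} [Ring B'] [Algebra ℂ B'] (f : B →ₗ[ℂ] B')
    (φ : Module.Dual ℂ M) (x : B ⊗[ℂ] M) :
    slice φ (f.rTensor M x) = f (slice φ x) := by
  induction x with
  | zero => simp
  | add x y hx hy => simp only [map_add, hx, hy]
  | tmul c m => simp

end Expansion

variable {A H : Type*} [CStarAlgebra A]
  [Ring H] [HopfAlgebra ℂ H] [StarRing H] [CStarHopfAlgebra H]

theorem slice_regTrace {n : ℕ} (b : Module.Basis (Fin n) ℂ H)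
    (hb : ∀ i j, regTrace (star (b i) * b j) = if i = j then 1 else 0) (x : A ⊗[ℂ] H) :
    slice regTrace (star x * x) = ∑ i, star (slice (b.coord i) x) * slice (b.coord i) x := by
  conv_lhs => rw [sum_slice_coord b x]
  simp only [star_sum, TensorProduct.star_tmul, Finset.sum_mul_sum,
    Algebra.TensorProduct.tmul_mul_tmul, map_sum, slice_tmul, hb]
  simp

theorem exists_norm_slice_le (ρ : Coaction A H) (φ : Module.Dual ℂ H) :
    ∃ C : ℝ, ∀ a : A, ‖slice φ (ρ a)‖ ≤ C * ‖a‖ := by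
  let := CStarAlgebra.spectralOrder A
  have := CStarAlgebra.spectralOrderedRing A
  obtain ⟨n, b, hb⟩ := exists_orthonormal (H := H)
  have hpos : ∀ a : A, 0 ≤ a → 0 ≤ (slice regTrace ∘ₗ ρ.lin) a := by
    intro a ha
    obtain ⟨c, rfl⟩ := CStarAlgebra.nonneg_iff_eq_star_mul_self.1 ha
    change 0 ≤ slice regTrace (ρ (star c * c))
    rw [map_mul, map_star, slice_regTrace b hb]
    exact Finset.sum_nonneg fun i _ => star_mul_self_nonneg _
  obtain ⟨C, hC⟩ := PositiveLinearMap.exists_norm_apply_le (PositiveLinearMap.mk₀ _ hpos)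
  have hcoord : ∀ i, ∃ D : ℝ, ∀ a : A, ‖slice (b.coord i) (ρ a)‖ ≤ D * ‖a‖ := by
    intro i
    refine ⟨Real.sqrt C, fun a => ?_⟩
    have h1 : star (slice (b.coord i) (ρ a)) * slice (b.coord i) (ρ a)
        ≤ slice regTrace (ρ (star a * a)) := by
      rw [map_mul, map_star, slice_regTrace b hb]
      exact Finset.single_le_sum
        (f := fun i => star (slice (b.coord i) (ρ a)) * slice (b.coord i) (ρ a))
        (fun i _ => star_mul_self_nonneg _) (Finset.mem_univ i)
    have h2 := CStarAlgebra.norm_le_norm_of_nonneg_of_le (star_mul_self_nonneg _) h1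
    have h3 : ‖slice regTrace (ρ (star a * a))‖ ≤ C * ‖star a * a‖ := hC (star a * a)
    rw [CStarRing.norm_star_mul_self] at h2 h3
    refine abs_le_of_sq_le_sq' ?_ (by positivity) |>.2
    rw [mul_pow, Real.sq_sqrt (NNReal.coe_nonneg C), sq, sq]
    exact h2.trans h3
  choose D hD using hcoord
  refine ⟨∑ i, ‖φ (b i)‖ * D i, fun a => ?_⟩
  have h : slice φ (ρ a) = ∑ i, φ (b i) • slice (b.coord i) (ρ a) := by
    conv_lhs => rw [sum_slice_coord b (ρ a)]
    simp
  rw [h, Finset.sum_mul]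
  refine (norm_sum_le _ _).trans (Finset.sum_le_sum fun i _ => ?_)
  rw [norm_smul, mul_assoc]
  exact mul_le_mul_of_nonneg_left (hD i a) (norm_nonneg _)

end Coaction
/-- The algebra `ℓ^∞(ℕ, A)` of bounded sequences in `A`. -/
def bddSeq (A : Type*) [CStarAlgebra A] : StarSubalgebra ℂ (ℕ → A) where
  carrier := {a | ∃ C : ℝ, ∀ n, ‖a n‖ ≤ C}
  mul_mem' := by
    rintro a b ⟨C, hC⟩ ⟨D, hD⟩
    exact ⟨C * D, fun n => (norm_mul_le _ _).trans
      (mul_le_mul (hC n) (hD n) (norm_nonneg _) ((norm_nonneg _).trans (hC n)))⟩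
  add_mem' := by
    rintro a b ⟨C, hC⟩ ⟨D, hD⟩
    exact ⟨C + D, fun n => (norm_add_le _ _).trans (add_le_add (hC n) (hD n))⟩
  algebraMap_mem' c := ⟨‖algebraMap ℂ A c‖, fun _ => le_rfl⟩
  star_mem' := by
    rintro a ⟨C, hC⟩
    exact ⟨C, fun n => (norm_star (a n)).trans_le (hC n)⟩

/-- The ideal `c₀(A)` of the sequences in `ℓ^∞(ℕ, A)` that converge to `0` in norm. -/
def nullSeq (A : Type*) [CStarAlgebra A] : Ideal (bddSeq A) where
  carrier := {a | Filter.Tendsto (fun n => ‖(a : ℕ → A) n‖) Filter.atTop (nhds 0)}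
  zero_mem' := by simp
  add_mem' := by
    intro a b ha hb
    refine squeeze_zero (fun _ => norm_nonneg _) (fun n => norm_add_le _ _) ?_
    simpa using Filter.Tendsto.add ha hb
  smul_mem' := by
    rintro ⟨c, C, hC⟩ a ha
    refine squeeze_zero (g := fun n => C * ‖(a : ℕ → A) n‖) (fun _ => norm_nonneg _)
      (fun n => (norm_mul_le _ _).trans (mul_le_mul_of_nonneg_right (hC n) (norm_nonneg _))) ?_
    simpa using Filter.Tendsto.const_mul C ha

namespace nullSeq

variable {A : Type*} [CStarAlgebra A]

theorem mem_iff {a : bddSeq A} :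
    a ∈ nullSeq A ↔ Filter.Tendsto (fun n => ‖(a : ℕ → A) n‖) Filter.atTop (nhds 0) := Iff.rfl

instance : (nullSeq A).IsTwoSided where
  mul_mem_of_left := by
    rintro a ⟨c, C, hC⟩ ha
    refine squeeze_zero (g := fun n => ‖(a : ℕ → A) n‖ * C) (fun _ => norm_nonneg _)
      (fun n => (norm_mul_le _ _).trans (mul_le_mul_of_nonneg_left (hC n) (norm_nonneg _))) ?_
    simpa using Filter.Tendsto.mul_const C ha

theorem star_mem {a : bddSeq A} (ha : a ∈ nullSeq A) : star a ∈ nullSeq A := by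
  rw [mem_iff] at ha ⊢
  simpa using ha

end nullSeq

/-- The algebra `A^∞ = ℓ^∞(ℕ, A) / c₀(A)`. -/
def SeqAlgebra (A : Type*) [CStarAlgebra A] : Type _ := bddSeq A ⧸ nullSeq A

namespace SeqAlgebra

variable {A : Type*} [CStarAlgebra A]

noncomputable instance : Ring (SeqAlgebra A) := inferInstanceAs (Ring (bddSeq A ⧸ nullSeq A))

noncomputable instance : Algebra ℂ (SeqAlgebra A) :=
  inferInstanceAs (Algebra ℂ (bddSeq A ⧸ nullSeq A))

/-- The class of a bounded sequence. -/
noncomputable def mkₐ (A : Type*) [CStarAlgebra A] :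
    bddSeq A →ₐ[ℂ] SeqAlgebra A := Ideal.Quotient.mkₐ ℂ (nullSeq A)

theorem mkₐ_surjective : Function.Surjective (mkₐ A) :=
  Ideal.Quotient.mkₐ_surjective ℂ (nullSeq A)

theorem mkₐ_eq_zero {a : bddSeq A} : mkₐ A a = 0 ↔ a ∈ nullSeq A := Ideal.Quotient.eq_zero_iff_mem

theorem mkₐ_eq_iff {a b : bddSeq A} : mkₐ A a = mkₐ A b ↔ a - b ∈ nullSeq A := by
  rw [← mkₐ_eq_zero, map_sub, sub_eq_zero]

/-- The involution `[(aₙ)]⋆ = [(aₙ⋆)]`. -/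
noncomputable instance : Star (SeqAlgebra A) where
  star := Quotient.map' star (by
    intro a b h
    rw [Submodule.quotientRel_def] at h ⊢
    have e : star a - star b = star (a - b) := by
      apply Subtype.ext
      funext n
      simp
    rw [e]
    exact nullSeq.star_mem h)

theorem star_mkₐ (a : bddSeq A) : star (mkₐ A a) = mkₐ A (star a) := rfl

noncomputable instance : StarRing (SeqAlgebra A) where
  star_involutive x := by
    obtain ⟨a, rfl⟩ := mkₐ_surjective x
    simp [star_mkₐ]
  star_mul x y := by
    obtain ⟨a, rfl⟩ := mkₐ_surjective x
    obtain ⟨b, rfl⟩ := mkₐ_surjective y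
    rw [← map_mul, star_mkₐ, star_mul, map_mul, star_mkₐ, star_mkₐ]
  star_add x y := by
    obtain ⟨a, rfl⟩ := mkₐ_surjective x
    obtain ⟨b, rfl⟩ := mkₐ_surjective y
    rw [← map_add, star_mkₐ, star_add, map_add, star_mkₐ, star_mkₐ]

instance : StarModule ℂ (SeqAlgebra A) where
  star_smul c x := by
    obtain ⟨a, rfl⟩ := mkₐ_surjective x
    rw [← map_smul, star_mkₐ, star_smul, map_smul, star_mkₐ]

/-- The quotient map `ℓ^∞(ℕ, A) → A^∞`. -/
noncomputable def proj (A : Type*) [CStarAlgebra A] : bddSeq A →⋆ₐ[ℂ] SeqAlgebra A :=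
  { mkₐ A with map_star' := fun _ => rfl }

theorem proj_surjective : Function.Surjective (proj A) := mkₐ_surjective

theorem proj_eq_zero {a : bddSeq A} : proj A a = 0 ↔ a ∈ nullSeq A := mkₐ_eq_zero

/-- The constant sequences. -/
def constSeq (A : Type*) [CStarAlgebra A] : A →⋆ₐ[ℂ] bddSeq A where
  toFun a := ⟨fun _ => a, ‖a‖, fun _ => le_rfl⟩
  map_one' := rfl
  map_mul' _ _ := rfl
  map_zero' := rfl
  map_add' _ _ := rfl
  commutes' _ := rfl
  map_star' _ := rfl

/-- The embedding of `A` in `A^∞` by the classes of the constant sequences. -/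
noncomputable def const (A : Type*) [CStarAlgebra A] : A →⋆ₐ[ℂ] SeqAlgebra A :=
  (proj A).comp (constSeq A)

/-- Evaluation of a bounded sequence at `n`. -/
def ev (A : Type*) [CStarAlgebra A] (n : ℕ) : bddSeq A →⋆ₐ[ℂ] A where
  toFun a := (a : ℕ → A) n
  map_one' := rfl
  map_mul' _ _ := rfl
  map_zero' := rfl
  map_add' _ _ := rfl
  commutes' _ := rfl
  map_star' _ := rfl

@[simp] theorem ev_apply (n : ℕ) (a : bddSeq A) : ev A n a = (a : ℕ → A) n := rfl

theorem rTensor_ev_ext {M : Type*} [AddCommGroup M] [Module ℂ M] [Module.Finite ℂ M]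
    {x y : bddSeq A ⊗[ℂ] M}
    (h : ∀ n, (ev A n).toAlgHom.toLinearMap.rTensor M x = (ev A n).toAlgHom.toLinearMap.rTensor M y) :
    x = y := by
  refine Coaction.slice_ext (Module.finBasis ℂ M) fun i => ?_
  apply Subtype.ext
  funext n
  have := congrArg (Coaction.slice ((Module.finBasis ℂ M).coord i)) (h n)
  rw [Coaction.slice_rTensor, Coaction.slice_rTensor] at this
  exact this

end SeqAlgebra

namespace Coaction

open CStarHopfAlgebra HopfDual SeqAlgebra

section Natural

variable {B B' K : Type*} [Ring B] [Algebra ℂ B] [StarRing B] [StarModule ℂ B]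
  [Ring B'] [Algebra ℂ B'] [StarRing B'] [StarModule ℂ B']
  [Ring K] [Bialgebra ℂ K] [StarRing K] [StarModule ℂ K]

theorem rTensor_mul (f : B →⋆ₐ[ℂ] B') (x y : B ⊗[ℂ] K) :
    f.toAlgHom.toLinearMap.rTensor K (x * y)
      = f.toAlgHom.toLinearMap.rTensor K x * f.toAlgHom.toLinearMap.rTensor K y :=
  map_mul (Algebra.TensorProduct.map f.toAlgHom (AlgHom.id ℂ K)) x y

theorem rTensor_star (f : B →⋆ₐ[ℂ] B') (x : B ⊗[ℂ] K) :
    f.toAlgHom.toLinearMap.rTensor K (star x) = star (f.toAlgHom.toLinearMap.rTensor K x) := by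
  induction x with
  | zero => simp
  | add x y hx hy => simp only [star_add, map_add, hx, hy]
  | tmul b k => simp [map_star]

theorem rTensor_one (f : B →⋆ₐ[ℂ] B') :
    f.toAlgHom.toLinearMap.rTensor K (1 : B ⊗[ℂ] K) = 1 :=
  map_one (Algebra.TensorProduct.map f.toAlgHom (AlgHom.id ℂ K))

theorem rTensor_assoc (f : B →ₗ[ℂ] B') (L : B →ₗ[ℂ] B ⊗[ℂ] K) (L' : B' →ₗ[ℂ] B' ⊗[ℂ] K)
    (h : ∀ b, L' (f b) = f.rTensor K (L b)) (x : B ⊗[ℂ] K) :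
    f.rTensor (K ⊗[ℂ] K) (TensorProduct.assoc ℂ B K K (L.rTensor K x))
      = TensorProduct.assoc ℂ B' K K (L'.rTensor K (f.rTensor K x)) := by
  induction x with
  | zero => simp
  | add x y hx hy => simp only [map_add, hx, hy]
  | tmul b k =>
    simp only [LinearMap.rTensor_tmul, h]
    generalize L b = z
    induction z with
    | zero => simp
    | add x y hx hy => simp only [map_add, TensorProduct.add_tmul, hx, hy]
    | tmul c l => simp

theorem rTensor_comul (f : B →ₗ[ℂ] B') (x : B ⊗[ℂ] K) :
    f.rTensor (K ⊗[ℂ] K) (Coalgebra.comul.lTensor B x)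
      = Coalgebra.comul.lTensor B' (f.rTensor K x) := by
  induction x with
  | zero => simp
  | add x y hx hy => simp only [map_add, hx, hy]
  | tmul b k => simp

end Natural

variable {A H : Type*} [CStarAlgebra A]
  [Ring H] [HopfAlgebra ℂ H] [StarRing H] [CStarHopfAlgebra H] (ρ : Coaction A H)

/-- The map `(aₙ) ↦ ((id ⊗ φ)(ρ(aₙ)))` on bounded sequences. -/
noncomputable def sliceSeq (φ : Module.Dual ℂ H) : bddSeq A →ₗ[ℂ] bddSeq A where
  toFun a := ⟨fun n => slice φ (ρ ((a : ℕ → A) n)), by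
    obtain ⟨C, hC⟩ := exists_norm_slice_le ρ φ
    obtain ⟨D, hD⟩ := a.2
    exact ⟨max C 0 * D, fun n => (hC _).trans
      ((mul_le_mul_of_nonneg_right (le_max_left C 0) (norm_nonneg _)).trans
        (mul_le_mul_of_nonneg_left (hD n) (le_max_right C 0)))⟩⟩
  map_add' a b := by
    apply Subtype.ext
    funext n
    simp
  map_smul' c a := by
    apply Subtype.ext
    funext n
    simp

theorem sliceSeq_mem (φ : Module.Dual ℂ H) {a : bddSeq A} (ha : a ∈ nullSeq A) :
    ρ.sliceSeq φ a ∈ nullSeq A := by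
  obtain ⟨C, hC⟩ := exists_norm_slice_le ρ φ
  rw [nullSeq.mem_iff] at ha ⊢
  refine squeeze_zero (fun _ => norm_nonneg _) (fun n => hC _) ?_
  simpa using ha.const_mul C

/-- The map `(aₙ) ↦ (ρ(aₙ))` from `ℓ^∞(ℕ, A)` to `ℓ^∞(ℕ, A) ⊗ H = ℓ^∞(ℕ, A ⊗ H)`. -/
noncomputable def seqLin : bddSeq A →ₗ[ℂ] bddSeq A ⊗[ℂ] H :=
  ∑ i, (TensorProduct.mk ℂ (bddSeq A) H).flip (Module.finBasis ℂ H i) ∘ₗ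
    ρ.sliceSeq ((Module.finBasis ℂ H).coord i)

theorem seqLin_apply (a : bddSeq A) : ρ.seqLin a
    = ∑ i, ρ.sliceSeq ((Module.finBasis ℂ H).coord i) a ⊗ₜ[ℂ] Module.finBasis ℂ H i := by
  simp [seqLin]

/-- `seqLin` applies `ρ` termwise. -/
theorem rTensor_ev_seqLin (n : ℕ) (a : bddSeq A) :
    (ev A n).toAlgHom.toLinearMap.rTensor H (ρ.seqLin a) = ρ ((a : ℕ → A) n) := by
  rw [sum_slice_coord (Module.finBasis ℂ H) (ρ ((a : ℕ → A) n)), seqLin_apply, map_sum]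
  rfl

/-- The coaction `(aₙ) ↦ (ρ(aₙ))` on bounded sequences. -/
noncomputable def seq : Coaction (bddSeq A) H where
  toFun := ρ.seqLin
  map_one' := rTensor_ev_ext fun n => by
    rw [rTensor_ev_seqLin, rTensor_one]
    exact map_one ρ.toStarAlgHom
  map_mul' a b := rTensor_ev_ext fun n => by
    rw [rTensor_ev_seqLin, rTensor_mul, rTensor_ev_seqLin, rTensor_ev_seqLin]
    exact map_mul ρ.toStarAlgHom _ _
  map_zero' := map_zero _
  map_add' := map_add _
  commutes' c := rTensor_ev_ext fun n => by
    rw [rTensor_ev_seqLin, Algebra.algebraMap_eq_smul_one (A := bddSeq A ⊗[ℂ] H), map_smul,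
      rTensor_one]
    exact (AlgHomClass.commutes ρ.toStarAlgHom c).trans (Algebra.algebraMap_eq_smul_one c)
  map_star' a := rTensor_ev_ext fun n => by
    rw [rTensor_ev_seqLin, rTensor_star, rTensor_ev_seqLin]
    exact map_star ρ.toStarAlgHom _
  coassoc' a := rTensor_ev_ext fun n => by
    have h := rTensor_assoc (ev A n).toAlgHom.toLinearMap ρ.seqLin ρ.lin
      (fun b => (ρ.rTensor_ev_seqLin n b).symm) (ρ.seqLin a)
    rw [rTensor_comul]
    refine h.trans ?_
    rw [rTensor_ev_seqLin]
    exact ρ.coassoc _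
  counit' a := by
    apply Subtype.ext
    funext n
    have h := slice_rTensor (ev A n).toAlgHom.toLinearMap (Coalgebra.counit (R := ℂ)) (ρ.seqLin a)
    rw [rTensor_ev_seqLin] at h
    exact h.symm.trans (ρ.counit_apply _)

/-- The map `[(aₙ)] ↦ [(ρ(aₙ))]` from `A^∞` to `A^∞ ⊗ H`. -/
noncomputable def inftyHom : SeqAlgebra A →ₐ[ℂ] SeqAlgebra A ⊗[ℂ] H :=
  Ideal.Quotient.liftₐ (nullSeq A)
    ((Algebra.TensorProduct.map (mkₐ A) (AlgHom.id ℂ H)).comp ρ.seq.toStarAlgHom.toAlgHom)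
    (by
      intro a ha
      change (mkₐ A).toLinearMap.rTensor H (ρ.seqLin a) = 0
      rw [seqLin_apply, map_sum]
      refine Finset.sum_eq_zero fun i _ => ?_
      rw [LinearMap.rTensor_tmul]
      have : mkₐ A (ρ.sliceSeq ((Module.finBasis ℂ H).coord i) a) = 0 :=
        mkₐ_eq_zero.2 (ρ.sliceSeq_mem _ ha)
      rw [AlgHom.toLinearMap_apply, this, TensorProduct.zero_tmul])

theorem inftyHom_proj (a : bddSeq A) :
    ρ.inftyHom (proj A a) = (proj A).toAlgHom.toLinearMap.rTensor H (ρ.seq a) := rfl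

/-- The coaction `ρ^∞` on `A^∞` induced by `ρ`: `ρ^∞([(aₙ)]) = [(ρ(aₙ))]`. -/
noncomputable def infty : Coaction (SeqAlgebra A) H where
  __ := ρ.inftyHom
  map_star' x := by
    obtain ⟨a, rfl⟩ := proj_surjective x
    change ρ.inftyHom (star (proj A a)) = star (ρ.inftyHom (proj A a))
    rw [← map_star, inftyHom_proj, inftyHom_proj, map_star, rTensor_star]
  coassoc' x := by
    obtain ⟨a, rfl⟩ := proj_surjective x
    change TensorProduct.assoc ℂ _ _ _ (ρ.inftyHom.toLinearMap.rTensor H (ρ.inftyHom (proj A a)))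
      = Coalgebra.comul.lTensor _ (ρ.inftyHom (proj A a))
    rw [inftyHom_proj, ← rTensor_comul, ← coassoc]
    exact (rTensor_assoc (proj A).toAlgHom.toLinearMap ρ.seq.lin ρ.inftyHom.toLinearMap
      (fun b => rfl) (ρ.seq a)).symm
  counit' x := by
    obtain ⟨a, rfl⟩ := proj_surjective x
    change TensorProduct.rid ℂ _ (Coalgebra.counit.lTensor _ (ρ.inftyHom (proj A a))) = proj A a
    rw [inftyHom_proj]
    have h := slice_rTensor (proj A).toAlgHom.toLinearMap (Coalgebra.counit (R := ℂ)) (ρ.seq a)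
    refine h.trans ?_
    exact congrArg (proj A) (ρ.seq.counit_apply a)

theorem infty_proj (a : bddSeq A) :
    ρ.infty (proj A a) = (proj A).toAlgHom.toLinearMap.rTensor H (ρ.seq a) := rfl

theorem infty_const (a : A) :
    ρ.infty (const A a) = (const A).toAlgHom.toLinearMap.rTensor H (ρ a) := by
  have h : ρ.seq (constSeq A a) = (constSeq A).toAlgHom.toLinearMap.rTensor H (ρ a) := by
    refine rTensor_ev_ext fun n => (ρ.rTensor_ev_seqLin n _).trans ?_
    rw [← LinearMap.comp_apply, ← LinearMap.rTensor_comp]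
    exact (LinearMap.rTensor_id_apply _ _ _).symm
  change ρ.infty (proj A (constSeq A a)) = _
  rw [infty_proj, h, ← LinearMap.comp_apply, ← LinearMap.rTensor_comp]
  rfl

end Coaction
namespace Coaction

open CStarHopfAlgebra

section Legs

variable {B C K : Type*} [Ring B] [Algebra ℂ B] [StarRing B] [StarModule ℂ B]
  [Ring C] [Algebra ℂ C] [StarRing C] [StarModule ℂ C]
  [Ring K] [Bialgebra ℂ K] [StarRing K] [StarModule ℂ K]

/-- The element `w ⊗ 1` of `B ⊗ K ⊗ K`, for `w` in `B ⊗ K`. -/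
noncomputable def tmulOne (w : B ⊗[ℂ] K) : B ⊗[ℂ] (K ⊗[ℂ] K) :=
  TensorProduct.assoc ℂ B K K (w ⊗ₜ 1)

/-- The element `(β₀ ⊗ id)(w)` of `B ⊗ K ⊗ K`, where `β₀ : b ↦ b ⊗ 1` is the trivial coaction. -/
noncomputable def trivialTensorId (w : B ⊗[ℂ] K) : B ⊗[ℂ] (K ⊗[ℂ] K) :=
  TensorProduct.assoc ℂ B K K (((TensorProduct.mk ℂ B K).flip 1).rTensor K w)

/-- The element `(β ⊗ id)(w)` of `B ⊗ K ⊗ K`, for a coaction `β` of `K` on `B`. -/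
noncomputable def tensorId (β : Coaction B K) (w : B ⊗[ℂ] K) : B ⊗[ℂ] (K ⊗[ℂ] K) :=
  TensorProduct.assoc ℂ B K K (β.lin.rTensor K w)

/-- The element `(id ⊗ Δ)(w)` of `B ⊗ K ⊗ K`. -/
noncomputable def idTensorComul (w : B ⊗[ℂ] K) : B ⊗[ℂ] (K ⊗[ℂ] K) :=
  comul.lTensor B w

/-- Let `β` be a coaction of `K` on `B`, let `ι : B → C` be a ⋆-homomorphism and let `γ` be a
coaction of `K` on `C`. The element `w` of `C ⊗ K` represents `β` in `C` if it is a unitary with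
`β(b) = w(b ⊗ 1)w⋆` for `b` in `B`, with `(w ⊗ 1)(β₀ ⊗ id)(w) = (id ⊗ Δ)(w)`, where `β₀` is the
trivial coaction on `C`, and with `(γ ⊗ id)(w)(w ⊗ 1) = (id ⊗ Δ)(w)`.

For `C = B^∞`, with `ι` the inclusion and `γ = β^∞`, the existence of such a `w` is the approximate
representability of `β`. -/
structure IsRepresentedBy (β : Coaction B K) (ι : B →⋆ₐ[ℂ] C) (γ : Coaction C K) (w : C ⊗[ℂ] K) :
    Prop where
  mem_unitary : w ∈ unitary (C ⊗[ℂ] K)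
  apply_eq : ∀ b : B, ι.toAlgHom.toLinearMap.rTensor K (β b) = w * (ι b ⊗ₜ 1) * star w
  trivial_mul : tmulOne w * trivialTensorId w = idTensorComul w
  mul_tmulOne : γ.tensorId w * tmulOne w = idTensorComul w

/-- A unitary `1`-cocycle for `ρ`: a unitary `v` in `B ⊗ K` such that
`(v ⊗ 1)(ρ ⊗ id)(v) = (id ⊗ Δ)(v)`. -/
structure IsCocycle (ρ : Coaction B K) (v : B ⊗[ℂ] K) : Prop where
  mem_unitary : v ∈ unitary (B ⊗[ℂ] K)
  cocycle : tmulOne v * ρ.tensorId v = idTensorComul v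

end Legs

variable {A H : Type*} [CStarAlgebra A]
  [Ring H] [HopfAlgebra ℂ H] [StarRing H] [CStarHopfAlgebra H]

/-- The inclusion of `A ⋊ H⁰` in `(A ⋊ H⁰)^∞ = A^∞ ⋊ H⁰`, the crossed product of `A^∞` by the
coaction `ρ^∞`. -/
noncomputable def crossedConst (ρ : Coaction A H) :
    CrossedProduct ρ →⋆ₐ[ℂ] CrossedProduct ρ.infty :=
  CrossedProduct.map (SeqAlgebra.const A) ρ.infty_const

/-- A coaction `ρ` has the Rohlin property if its dual coaction on the crossed product is
approximately representable; here `(A ⋊ H⁰)^∞` is `A^∞ ⋊ H⁰`, and the coaction induced on it by the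
dual coaction of `ρ` is the dual coaction of `ρ^∞`. -/
def HasRohlinProperty (ρ : Coaction A H) : Prop :=
  ∃ w : CrossedProduct ρ.infty ⊗[ℂ] HopfDual H,
    (CrossedProduct.dualCoaction ρ).IsRepresentedBy ρ.crossedConst
      (CrossedProduct.dualCoaction ρ.infty) w

end Coaction

/-! Write H for the algebra that coacts and H⁰ for its dual `HopfDual H`, which acts. Let l be the
two-sided integral of H with ε(l) = 1 and e the Haar functional, the two-sided integral of H⁰ with
e(1) = 1; these satisfy e(l) ≠ 0. It is enough to find a unitary x in A with vρ(x) = x ⊗ 1, since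
then v = (x ⊗ 1)ρ(x⋆), and the formula for σ follows from σ = Ad(v) ∘ ρ.

By the cocycle identity, φ ↦ (id ⊗ φ)(vρ(·)) is an action of H⁰ on A. Averaging it with e gives
solutions for free: (id ⊗ e)(vρ(b)) solves vρ(x) = x ⊗ 1 for every b (`IsCocycle.mul_apply_slice`).
The difficulty is to choose b so that the average is invertible, and this is what the Rohlin
property is for.

A unitary w representing the dual coaction gives a representation h ↦ (id ⊗ h)(w) of H in A^∞ ⋊ H⁰.
The image of l is fixed by the dual coaction, so it is p ⋊ 1 for some p in A^∞
(`exists_rohlin_element`). This p commutes with A, satisfies (p ⊗ 1)ρ^∞(p) = p ⊗ l, and has (id ⊗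
e)(vρ^∞(p)v⋆) = e(l)1 for every cocycle v in A ⊗ H, in particular for v = 1. The last property comes
from testing the representation on the twisted Haar element q = (id ⊗ e₁)(v) ⋊ e₂, for which q(p ⋊
1)q = e(l)q.

Put x = (id ⊗ e)(vρ^∞(p)) and y = (id ⊗ e)(ρ^∞(p)v⋆). Then px = py = e(l)p, and the averages of p
for the cocycles 1 and v give yx = xy = e(l)²1 (`IsCocycle.slice_mul_slice_of_rohlin`). So x is
invertible in A^∞. Lift p to a bounded sequence (aₙ). The elements (id ⊗ e)(vρ(aₙ)) of A are exact
solutions, and they are invertible for large n. The polar decomposition of one of them gives the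
unitary (`IsCocycle.exists_unitary_of_isUnit`). -/

set_option linter.unusedSectionVars false

/-! ### The regular trace, the trace of S², and the integral of H. -/

namespace CStarHopfAlgebra

open HopfDual

variable {H : Type*} [Ring H] [HopfAlgebra ℂ H] [StarRing H] [CStarHopfAlgebra H]

theorem regTrace_mul_comm (a b : H) : regTrace (a * b) = regTrace (b * a) := by
  simp only [regTrace, LinearMap.comp_apply]
  have h : ∀ x y : H, LinearMap.mul ℂ H (x * y) = LinearMap.mul ℂ H x * LinearMap.mul ℂ H y := by
    intro x y; ext z; simp [mul_assoc]
  rw [h, h, LinearMap.trace_mul_comm]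

theorem regTrace_mul_star_self_eq_zero {h : H} (h0 : regTrace (h * star h) = 0) : h = 0 := by
  rw [regTrace_mul_comm] at h0
  exact (regTrace_star_mul_self h).2 h0

theorem regTrace_left_ext {x y : H} (h : ∀ z, regTrace (x * z) = regTrace (y * z)) : x = y := by
  refine sub_eq_zero.1 (regTrace_mul_star_self_eq_zero ?_)
  rw [sub_mul, map_sub, h, sub_self]

/-- The trace of an endomorphism in a basis orthonormal for the regular trace. -/
theorem trace_eq_sum_regTrace {n : ℕ} (b : Module.Basis (Fin n) ℂ H)
    (hb : ∀ i j, regTrace (star (b i) * b j) = if i = j then 1 else 0) (f : H →ₗ[ℂ] H) :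
    LinearMap.trace ℂ H f = ∑ i, regTrace (star (b i) * f (b i)) := by
  have hc : ∀ i x, b.repr x i = regTrace (star (b i) * x) := by
    intro i x
    have : b.coord i = regTrace ∘ₗ LinearMap.mulLeft ℂ (star (b i)) :=
      b.ext fun j => by simp [hb, Finsupp.single_apply, eq_comm]
    exact LinearMap.congr_fun this x
  rw [LinearMap.trace_eq_matrix_trace ℂ b, Matrix.trace]
  refine Finset.sum_congr rfl fun i _ => ?_
  rw [Matrix.diag_apply, LinearMap.toMatrix_apply, hc]

/-- Traciality makes the adjoints of an orthonormal basis orthonormal again. Computing the trace of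
right multiplication in the adjoint basis and that of left multiplication in the original one gives
the same sum. -/
theorem trace_mulRight (h : H) : LinearMap.trace ℂ H (LinearMap.mulRight ℂ h) = regTrace h := by
  obtain ⟨n, b, hb⟩ := exists_orthonormal (H := H)
  have hli : LinearIndependent ℂ fun i => star (b i) := by
    rw [Fintype.linearIndependent_iff]
    intro g hg i
    have := congrArg (fun x => regTrace (b i * x)) hg
    simpa [Finset.mul_sum, regTrace_mul_comm (b i), hb] using this
  let b' : Module.Basis (Fin n) ℂ H := basisOfLinearIndependentOfCardEqFinrank' _ hli
    (by rw [Module.finrank_eq_card_basis b])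
  have hb'i : ∀ i, b' i = star (b i) := fun i => by simp [b']
  have hb' : ∀ i j, regTrace (star (b' i) * b' j) = if i = j then 1 else 0 := by
    intro i j
    rw [hb'i, hb'i, star_star, regTrace_mul_comm, hb]
    simp [eq_comm]
  rw [trace_eq_sum_regTrace b' hb', show regTrace h = _ from
    trace_eq_sum_regTrace b hb (LinearMap.mul ℂ H h)]
  refine Finset.sum_congr rfl fun i _ => ?_
  rw [hb'i, star_star, LinearMap.mulRight_apply, LinearMap.mul_apply', ← mul_assoc,
    regTrace_mul_comm _ h, regTrace_mul_comm _ (h * b i), regTrace_mul_comm (h * b i)]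
  rw [regTrace_mul_comm (star (b i)), mul_assoc]

/-- The antipode as a linear equivalence. -/
noncomputable def antipodeEquiv : H ≃ₗ[ℂ] H :=
  LinearEquiv.ofLinearMap (antipode ℂ) antipodeInv
    (LinearMap.ext antipode_antipodeInv) (LinearMap.ext antipodeInv_antipode)

@[simp] theorem antipodeEquiv_apply (h : H) : antipodeEquiv h = antipode ℂ h := rfl

@[simp] theorem antipodeEquiv_symm_apply (h : H) : antipodeEquiv.symm h = antipodeInv h := rfl

/-- As S is antimultiplicative, it conjugates right multiplication by h into left multiplication by
S(h), and conjugation preserves the trace. -/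
theorem regTrace_antipode (h : H) : regTrace (antipode ℂ h) = regTrace h := by
  have : LinearMap.mul ℂ H (antipode ℂ h) = antipodeEquiv.conj (LinearMap.mulRight ℂ h) := by
    ext x
    simp [LinearEquiv.conj_apply, antipode_mul_antidistrib, antipode_antipodeInv]
  rw [regTrace, LinearMap.comp_apply, this, LinearMap.trace_conj', trace_mulRight]
  rfl

theorem one_ne_zero' : (1 : H) ≠ 0 := by
  intro h
  have := congrArg (counit (R := ℂ)) h
  simp at this

/-- With τ the regular trace and (bᵢ) an orthonormal basis, Tr(S²) = ∑ τ(bᵢ⋆S²(bᵢ)). Since bᵢ⋆ =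
S(S(bᵢ)⋆) and τ ∘ S = τ, each term is τ(S(bᵢ)S(bᵢ)⋆) ≥ 0. A zero sum would force every S(bᵢ), hence
every bᵢ, to vanish. The value is the normalizing constant of the Haar functional. -/
theorem trace_antipode_sq_ne_zero :
    LinearMap.trace ℂ H (antipode ℂ ∘ₗ antipode ℂ (A := H)) ≠ 0 := by
  obtain ⟨n, b, hb⟩ := exists_orthonormal (H := H)
  rw [trace_eq_sum_regTrace b hb]
  have h : ∀ i, regTrace (star (b i) * (antipode ℂ ∘ₗ antipode ℂ (A := H)) (b i))
      = regTrace (star (star (antipode ℂ (b i))) * star (antipode ℂ (b i))) := by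
    intro i
    have : star (b i) = antipode ℂ (star (antipode ℂ (b i))) := by
      have := antipode_antipodeInv (star (b i))
      rw [antipodeInv_apply, star_star] at this
      exact this.symm
    rw [this, LinearMap.comp_apply, ← antipode_mul_antidistrib, regTrace_antipode, star_star]
  simp only [h]
  choose r hr0 hr using fun i => (regTrace_star_mul_self (star (antipode ℂ (b i)))).1
  simp only [hr]
  intro h0
  rw [← Complex.ofReal_sum, Complex.ofReal_eq_zero,
    Finset.sum_eq_zero_iff_of_nonneg fun i _ => hr0 i] at h0
  apply one_ne_zero' (H := H)
  rw [← b.sum_repr 1]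
  refine Finset.sum_eq_zero fun i hi => ?_
  have h1 := (regTrace_star_mul_self (star (antipode ℂ (b i)))).2
    (by rw [hr, h0 i hi, Complex.ofReal_zero])
  have h2 : b i = 0 := antipodeEquiv.injective (by simpa using h1)
  rw [h2, smul_zero]

/-- A two-sided integral of a finite dimensional C⋆-Hopf algebra, normalized by the counit. -/
theorem exists_integral : ∃ l : H, (∀ h, h * l = counit (R := ℂ) h • l) ∧
    (∀ h, l * h = counit (R := ℂ) h • l) ∧ counit (R := ℂ) l = 1 := by
  obtain ⟨n, b, hb⟩ := exists_orthonormal (H := H)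
  -- The Riesz representative of the counit for the regular trace. Multiplicativity of the counit
  -- makes it an integral, and traciality makes the integral two-sided.
  let g : H := ∑ i, counit (R := ℂ) (b i) • star (b i)
  have hg : ∀ x, regTrace (g * x) = counit (R := ℂ) x := by
    intro x
    have : regTrace ∘ₗ LinearMap.mulLeft ℂ g = counit (R := ℂ) := by
      refine b.ext fun j => ?_
      simp [g, Finset.sum_mul, hb]
    exact LinearMap.congr_fun this x
  have h1 : ∀ h, g * h = counit (R := ℂ) h • g := fun h => regTrace_left_ext fun z => by
    rw [mul_assoc, hg, Bialgebra.counit_mul, smul_mul_assoc, map_smul, hg, smul_eq_mul]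
  have h2 : ∀ h, h * g = counit (R := ℂ) h • g := fun h => regTrace_left_ext fun z => by
    rw [mul_assoc, regTrace_mul_comm, mul_assoc, hg, Bialgebra.counit_mul, smul_mul_assoc,
      map_smul, hg, smul_eq_mul, mul_comm]
  -- If ε(g) = 0 then gg⋆ = ε(g⋆)g = 0, so g = 0 by faithfulness of the trace; but g pairs with 1 to
  -- ε(1) = 1.
  have h0 : counit (R := ℂ) g ≠ 0 := by
    intro h0
    have hz : g = 0 := by
      apply regTrace_mul_star_self_eq_zero
      rw [h1, counit_star, h0, map_zero, zero_smul, map_zero]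
    have := hg 1
    simp [hz] at this
  refine ⟨(counit (R := ℂ) g)⁻¹ • g, fun h => ?_, fun h => ?_, ?_⟩
  · rw [mul_smul_comm, h2, smul_comm]
  · rw [smul_mul_assoc, h1, smul_comm]
  · rw [map_smul, smul_eq_mul, inv_mul_cancel₀ h0]

/-! ### Translations of H by H⁰ and the Haar functional. -/

/-- The map `h ↦ α(h₁) h₂`. -/
noncomputable def contract : HopfDual H →ₗ[ℂ] H →ₗ[ℂ] H :=
  LinearMap.mk₂ ℂ (fun α h => TensorProduct.lid ℂ H ((toDual α).rTensor H (comul h)))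
    (by intro α β h; simp [LinearMap.rTensor_add])
    (by intro c α h; simp [LinearMap.rTensor_smul])
    (by intro α h k; simp)
    (by intro c α h; simp)

theorem apply_contract (α β : HopfDual H) (h : H) : β (contract α h) = (α * β) h := by
  rw [mul_apply']
  simp only [contract, LinearMap.mk₂_apply]
  generalize Coalgebra.comul (R := ℂ) h = t
  induction t with
  | zero => simp
  | add x y hx hy => simp only [map_add, hx, hy]
  | tmul x y => simp

theorem dual_ext {x y : H} (h : ∀ α : HopfDual H, α x = α y) : x = y := by
  refine sub_eq_zero.1 ((Module.forall_dual_apply_eq_zero_iff ℂ _).1 fun f => ?_)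
  have := h (toDual.symm f)
  rw [LinearEquiv.apply_symm_apply] at this
  rw [map_sub, this, sub_self]

theorem contract_one (h : H) : contract 1 h = h :=
  dual_ext fun α => by rw [apply_contract, one_mul]

theorem contract_contract (α β : HopfDual H) (h : H) :
    contract β (contract α h) = contract (α * β) h :=
  dual_ext fun γ => by rw [apply_contract, apply_contract, apply_contract, mul_assoc]

theorem contract_antipode_sq (α : HopfDual H) (h : H) :
    contract α (antipode ℂ (antipode ℂ h))
      = antipode ℂ (antipode ℂ (contract (antipode ℂ (antipode ℂ α)) h)) :=
  dual_ext fun γ => by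
    rw [apply_contract, ← antipode_apply, ← antipode_apply, antipode_mul_antidistrib,
      antipode_mul_antidistrib, ← apply_contract, antipode_apply, antipode_apply]

/-- `α ⊗ β ↦ (α(h₁) h₂) (β(k₁) k₂)`. -/
noncomputable def contractPair (h k : H) : HopfDual H ⊗[ℂ] HopfDual H →ₗ[ℂ] H :=
  TensorProduct.lift ((LinearMap.mul ℂ H).compl₁₂ (contract.flip h) (contract.flip k))

@[simp] theorem contractPair_tmul (h k : H) (α β : HopfDual H) :
    contractPair h k (α ⊗ₜ β) = contract α h * contract β k := by
  simp [contractPair]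

theorem contract_mul (α : HopfDual H) (h k : H) :
    contract α (h * k) = contractPair h k (Coalgebra.comul (R := ℂ) α) :=
  dual_ext fun γ => by
    rw [apply_contract, ← toDual₂_comul', Bialgebra.comul_mul]
    have : ∀ t : HopfDual H ⊗[ℂ] HopfDual H,
        toDual₂ (t * Coalgebra.comul (R := ℂ) γ) (h ⊗ₜ k) = γ (contractPair h k t) := by
      intro t
      induction t with
      | zero => simp
      | add x y hx hy => simp only [add_mul, map_add, LinearMap.add_apply, hx, hy]
      | tmul α β =>
        rw [contractPair_tmul, ← toDual₂_comul']
        generalize Coalgebra.comul (R := ℂ) γ = s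
        induction s with
        | zero => simp
        | add x y hx hy => simp only [mul_add, map_add, LinearMap.add_apply, hx, hy]
        | tmul γ δ => simp [apply_contract]
    exact this _

/-- The functional `h ↦ Tr(x ↦ h S²(x))`. -/
noncomputable def twistedTrace : HopfDual H :=
  toDual.symm (LinearMap.trace ℂ H ∘ₗ LinearMap.lcomp ℂ H (antipode ℂ ∘ₗ antipode ℂ)
    ∘ₗ LinearMap.mul ℂ H)

theorem twistedTrace_apply (h : H) : twistedTrace h
    = LinearMap.trace ℂ H (LinearMap.mul ℂ H h ∘ₗ antipode ℂ ∘ₗ antipode ℂ) := by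
  simp [twistedTrace]
  rfl

/-- Write C(α) for `contract α` and M for h·S². The operator C(ψ₁) ∘ M ∘ C(S(ψ₂)) is computed in two
ways. By cyclicity its trace is Tr(M ∘ C(ψ₁S(ψ₂))) = ψ(1)Tr(M). By the product rule for C, the
operator itself is left multiplication by C(ψ)(h) composed with S², whose trace is the value at h of
the product in H⁰. The factor S² is what lets the antipodes cancel in the second computation. -/
theorem mul_twistedTrace (ψ : HopfDual H) : ψ * twistedTrace = ψ 1 • (twistedTrace : HopfDual H) := by
  ext h
  let M : H →ₗ[ℂ] H := LinearMap.mul ℂ H h ∘ₗ antipode ℂ ∘ₗ antipode ℂ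
  let F : HopfDual H ⊗[ℂ] HopfDual H →ₗ[ℂ] Module.End ℂ H := TensorProduct.lift
    ((LinearMap.mul ℂ (Module.End ℂ H)).compl₁₂ ((LinearMap.mulRight ℂ M) ∘ₗ contract)
      (contract ∘ₗ antipode ℂ))
  have hF : ∀ t, LinearMap.trace ℂ H (F t) = LinearMap.trace ℂ H (M * contract
      (LinearMap.mul' ℂ (HopfDual H) ((antipode ℂ).lTensor _ t))) := by
    intro t
    induction t with
    | zero => simp
    | add x y hx hy => simp only [map_add, mul_add, hx, hy]
    | tmul α β =>
      have : F (α ⊗ₜ β) = contract α * (M * contract (antipode ℂ β)) := by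
        simp [F, mul_assoc]
      rw [this, LinearMap.trace_mul_comm, mul_assoc]
      congr 2
      ext x
      simp [contract_contract]
  -- Moving C past S² applies S² to its argument, so the factor on x becomes C(S(ψ₃)S²(ψ₂)) =
  -- C(S(S(ψ₂)ψ₃)), and the antipode axiom collapses it.
  have hG : F (Coalgebra.comul (R := ℂ) ψ)
      = LinearMap.mul ℂ H (contract ψ h) ∘ₗ antipode ℂ ∘ₗ antipode ℂ := by
    ext x
    let R : HopfDual H ⊗[ℂ] (HopfDual H ⊗[ℂ] HopfDual H) →ₗ[ℂ] H := TensorProduct.lift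
      ((LinearMap.mul ℂ H).compl₁₂ (contract.flip h)
        (antipode ℂ ∘ₗ antipode ℂ ∘ₗ contract.flip x ∘ₗ antipode ℂ ∘ₗ
          LinearMap.mul' ℂ (HopfDual H) ∘ₗ (antipode ℂ).rTensor _))
    have h1 : ∀ t, F t x = R (TensorProduct.assoc ℂ _ _ _ (Coalgebra.comul.rTensor _ t)) := by
      intro t
      induction t with
      | zero => simp
      | add x y hx hy => simp only [map_add, LinearMap.add_apply, hx, hy]
      | tmul α β =>
        have : F (α ⊗ₜ β) x = contract α
            (h * antipode ℂ (antipode ℂ (contract (antipode ℂ β) x))) := by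
          simp [F, M]
        rw [this, contract_mul, LinearMap.rTensor_tmul]
        generalize Coalgebra.comul (R := ℂ) α = s
        induction s with
        | zero => simp
        | add x y hx hy => simp only [map_add, TensorProduct.add_tmul, hx, hy]
        | tmul γ δ =>
          simp [R, contract_antipode_sq, contract_contract, antipode_mul_antidistrib]
    have h2 : ∀ t, R (Coalgebra.comul.lTensor _ t)
        = contract (TensorProduct.rid ℂ _ (Coalgebra.counit.lTensor _ t)) h
          * antipode ℂ (antipode ℂ x) := by
      intro t
      induction t with
      | zero => simp
      | add x y hx hy => simp only [map_add, LinearMap.add_apply, add_mul, hx, hy]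
      | tmul α β =>
        have : R (Coalgebra.comul.lTensor _ (α ⊗ₜ β)) = contract α h *
            antipode ℂ (antipode ℂ (contract (antipode ℂ (LinearMap.mul' ℂ (HopfDual H)
              ((antipode ℂ).rTensor _ (Coalgebra.comul (R := ℂ) β)))) x)) := by
          simp [R]
        rw [this, HopfAlgebra.mul_antipode_rTensor_comul_apply, Algebra.algebraMap_eq_smul_one]
        simp [antipode_one, contract_one]
    rw [h1, Coalgebra.coassoc_apply, h2, Coalgebra.lTensor_counit_comul, TensorProduct.rid_tmul,
      one_smul]
    rfl
  have := hF (Coalgebra.comul (R := ℂ) ψ)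
  rw [hG, ← twistedTrace_apply, apply_contract, HopfAlgebra.mul_antipode_lTensor_comul_apply,
    Algebra.algebraMap_eq_smul_one, map_smul] at this
  have h1 : contract (1 : HopfDual H) = 1 := LinearMap.ext contract_one
  rw [this, map_smul, h1, mul_smul_comm, mul_one, map_smul, LinearMap.smul_apply,
    twistedTrace_apply]
  rfl

/-- The operator x ↦ lS²(x) = ε(x)l has rank at most one. This is what makes the Haar functional
nonzero at the integral. -/
theorem twistedTrace_integral {l : H} (hl : ∀ h, l * h = counit (R := ℂ) h • l) :
    twistedTrace l = counit (R := ℂ) l := by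
  have : LinearMap.mul ℂ H l ∘ₗ antipode ℂ ∘ₗ antipode ℂ
      = (counit (R := ℂ) (A := H)).smulRight l := by
    ext x; simp [hl]
  rw [twistedTrace_apply, this]
  simp [LinearMap.trace_smulRight]

/-- The Haar functional: the two-sided normalized integral of the dual, which is invariant under
`φ ↦ conj φ(·⋆)`. -/
theorem exists_haar : ∃ e : HopfDual H, (∀ φ, φ * e = φ 1 • e) ∧ (∀ φ, e * φ = φ 1 • e) ∧
    e 1 = 1 ∧ conjDual e = e ∧
    ∀ l : H, (∀ h, l * h = counit (R := ℂ) h • l) → counit (R := ℂ) l = 1 → e l ≠ 0 := by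
  have h0 : (twistedTrace : HopfDual H) 1 ≠ 0 := by
    rw [twistedTrace_apply, show LinearMap.mul ℂ H 1 = LinearMap.id from
      LinearMap.ext fun x => one_mul x, LinearMap.id_comp]
    exact trace_antipode_sq_ne_zero
  set c : ℂ := (twistedTrace : HopfDual H) 1
  let e : HopfDual H := c⁻¹ • twistedTrace
  have h1 : ∀ φ, φ * e = φ 1 • e := fun φ => by
    simp only [e, mul_smul_comm, mul_twistedTrace]
    exact smul_comm _ _ _
  have he : e 1 = 1 := by
    simp only [e, map_smul, LinearMap.smul_apply, smul_eq_mul]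
    exact inv_mul_cancel₀ h0
  -- The antipode turns the left integral e into a right integral.
  have h2 : ∀ φ, antipode ℂ e * φ = φ 1 • antipode ℂ e := by
    intro φ
    have hφ : φ = antipode ℂ (CrossedProduct.antipodeInvDual φ) := by
      ext h
      simp [antipodeInv_antipode]
    conv_lhs => rw [hφ]
    rw [← antipode_mul_antidistrib, h1, map_smul]
    congr 1
    rw [CrossedProduct.antipodeInvDual_apply, antipodeInv_apply, star_one, antipode_one, star_one]
  -- A normalized left and a normalized right integral coincide: evaluate their product in both
  -- ways. The invariance under `conjDual` below follows in the same manner.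
  have h3 : antipode ℂ e = e := by
    have a := h1 (antipode ℂ e)
    have b := h2 e
    rw [antipode_apply, antipode_one] at a
    rw [a, he, one_smul, one_smul] at b
    exact b.symm
  rw [h3] at h2
  refine ⟨e, h1, h2, he, ?_, fun l hl hl1 => ?_⟩
  · have hc : ∀ φ : HopfDual H, conjDual (conjDual φ) = φ := fun φ => by ext h; simp
    have a : e * conjDual e = e := by rw [h2]; simp [he]
    have b := congrArg conjDual a
    rw [conjDual_mul, hc, h1, conjDual_apply, star_one, he, map_one, one_smul] at b
    exact b.symm
  · simp only [e, map_smul, LinearMap.smul_apply, twistedTrace_integral hl, hl1]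
    simpa using h0

end CStarHopfAlgebra

/-! ### Cocycles, the twisted action of H⁰, and its averages. -/

namespace Coaction

open CStarHopfAlgebra HopfDual

section Algebra

variable {B K : Type*} [Ring B] [Algebra ℂ B] [StarRing B] [StarModule ℂ B]
  [Ring K] [Bialgebra ℂ K] [StarRing K] [StarModule ℂ K]

theorem tensorId_mul (β : Coaction B K) (x y : B ⊗[ℂ] K) :
    β.tensorId (x * y) = β.tensorId x * β.tensorId y :=
  map_mul ((Algebra.TensorProduct.assoc ℂ ℂ ℂ B K K).toAlgHom.comp
    (Algebra.TensorProduct.map β.toStarAlgHom.toAlgHom (AlgHom.id ℂ K))) x y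

theorem tensorId_one (β : Coaction B K) : β.tensorId (1 : B ⊗[ℂ] K) = 1 :=
  map_one ((Algebra.TensorProduct.assoc ℂ ℂ ℂ B K K).toAlgHom.comp
    (Algebra.TensorProduct.map β.toStarAlgHom.toAlgHom (AlgHom.id ℂ K)))

theorem idTensorComul_mul (x y : B ⊗[ℂ] K) :
    idTensorComul (x * y) = idTensorComul x * idTensorComul y :=
  map_mul (Algebra.TensorProduct.map (AlgHom.id ℂ B) (Bialgebra.comulAlgHom ℂ K)) x y

theorem idTensorComul_one : idTensorComul (1 : B ⊗[ℂ] K) = 1 :=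
  map_one (Algebra.TensorProduct.map (AlgHom.id ℂ B) (Bialgebra.comulAlgHom ℂ K))

theorem tmulOne_one : tmulOne (1 : B ⊗[ℂ] K) = 1 := by
  simp [tmulOne, Algebra.TensorProduct.one_def]

theorem isCocycle_one (β : Coaction B K) : β.IsCocycle 1 where
  mem_unitary := one_mem _
  cocycle := by rw [tmulOne_one, tensorId_one, idTensorComul_one, one_mul]

theorem slice_tmul_one_mul {M : Type*} [Ring M] [Algebra ℂ M] (f : Module.Dual ℂ M) (a : B)
    (z : B ⊗[ℂ] M) : slice f ((a ⊗ₜ 1) * z) = a * slice f z := by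
  induction z with
  | zero => simp
  | add x y hx hy => simp only [mul_add, map_add, hx, hy]
  | tmul b m => simp

theorem slice_mul_tmul_one {M : Type*} [Ring M] [Algebra ℂ M] (f : Module.Dual ℂ M) (a : B)
    (z : B ⊗[ℂ] M) : slice f (z * (a ⊗ₜ 1)) = slice f z * a := by
  induction z with
  | zero => simp
  | add x y hx hy => simp only [add_mul, map_add, hx, hy]
  | tmul b m => simp

/-- An integral absorbs its leg through the counit; this is how cocycles disappear next to l, their
counit slice being 1. -/
theorem mul_one_tmul_integral {l : K} (hl : ∀ h, h * l = counit (R := ℂ) h • l) (z : B ⊗[ℂ] K) :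
    z * (1 ⊗ₜ l) = slice (counit (R := ℂ)) z ⊗ₜ l := by
  induction z with
  | zero => simp
  | add x y hx hy => simp only [add_mul, map_add, TensorProduct.add_tmul, hx, hy]
  | tmul b h => simp [hl, TensorProduct.smul_tmul]

theorem one_tmul_integral_mul {l : K} (hl : ∀ h, l * h = counit (R := ℂ) h • l) (z : B ⊗[ℂ] K) :
    (1 ⊗ₜ l) * z = slice (counit (R := ℂ)) z ⊗ₜ l := by
  induction z with
  | zero => simp
  | add x y hx hy => simp only [mul_add, map_add, TensorProduct.add_tmul, hx, hy]
  | tmul b h => simp [hl, TensorProduct.smul_tmul]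

theorem slice_counit_mul (x y : B ⊗[ℂ] K) : slice (counit (R := ℂ)) (x * y)
    = slice (counit (R := ℂ)) x * slice (counit (R := ℂ)) y := by
  induction x with
  | zero => simp
  | add x x' hx hx' => simp only [add_mul, map_add, hx, hx']
  | tmul a h =>
    induction y with
    | zero => simp
    | add y y' hy hy' => simp only [mul_add, map_add, hy, hy']
    | tmul b k => simp [smul_smul, mul_comm]

theorem slice_counit_apply (ρ : Coaction B K) (b : B) : slice (counit (R := ℂ)) (ρ b) = b :=
  ρ.counit_apply b

end Algebra

variable {B H : Type*} [Ring B] [Algebra ℂ B] [StarRing B] [StarModule ℂ B]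
  [Ring H] [HopfAlgebra ℂ H] [StarRing H] [CStarHopfAlgebra H]

theorem slice_dual_ext {x y : B ⊗[ℂ] H}
    (h : ∀ φ : HopfDual H, slice (toDual φ) x = slice (toDual φ) y) : x = y :=
  slice_ext (Module.finBasis ℂ H) fun i => by
    simpa using h (toDual.symm ((Module.finBasis ℂ H).coord i))

theorem star_slice (φ : HopfDual H) (z : B ⊗[ℂ] H) :
    star (slice (toDual φ) z) = slice (toDual (conjDual φ)) (star z) := by
  induction z with
  | zero => simp
  | add x y hx hy => simp only [map_add, star_add, hx, hy]
  | tmul c k => simp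

/-- Turns two nested slices into one slice of a threefold tensor, where the cocycle identity can be
applied. -/
theorem slice_mul_apply_slice (ρ : Coaction B H) (φ ψ : HopfDual H) (v z : B ⊗[ℂ] H) :
    slice (toDual φ) (v * ρ (slice (toDual ψ) z))
      = slice (toDual₂ (φ ⊗ₜ ψ)) (tmulOne v * ρ.tensorId z) := by
  induction z with
  | zero => simp [tensorId]
  | add x y hx hy =>
    have : ρ.tensorId (x + y) = ρ.tensorId x + ρ.tensorId y := by simp [tensorId]
    simp only [this, map_add, mul_add, hx, hy]
  | tmul b k =>
    rw [slice_tmul, map_smul, tensorId, LinearMap.rTensor_tmul, lin_apply]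
    generalize ρ b = r
    induction r with
    | zero => simp
    | add x y hx hy => simp only [smul_add, map_add, TensorProduct.add_tmul, mul_add, hx, hy]
    | tmul c h =>
      induction v with
      | zero => simp [tmulOne]
      | add x y hx hy =>
        have : tmulOne (x + y) = tmulOne x + tmulOne y := by
          simp [tmulOne, TensorProduct.add_tmul]
        simp only [this, add_mul, map_add, hx, hy]
      | tmul d l => simp [tmulOne, smul_smul, mul_comm]

theorem slice_idTensorComul (φ ψ : HopfDual H) (z : B ⊗[ℂ] H) :
    slice (toDual₂ (φ ⊗ₜ ψ)) (idTensorComul z) = slice (toDual (φ * ψ)) z := by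
  induction z with
  | zero => simp [idTensorComul]
  | add x y hx hy =>
    have : idTensorComul (x + y) = idTensorComul x + idTensorComul y := by simp [idTensorComul]
    simp only [this, map_add, hx, hy]
  | tmul c k =>
    rw [slice_tmul, idTensorComul, LinearMap.lTensor_tmul, slice_tmul, mul_apply']
    rfl

namespace IsCocycle

variable {ρ : Coaction B H} {v : B ⊗[ℂ] H}

/-- The cocycle identity and the coassociativity of ρ combine to (v ⊗ 1)(ρ ⊗ id)(vρ(b)) = (id ⊗
Δ)(vρ(b)). So φ ↦ (id ⊗ φ)(vρ(·)) is multiplicative: it is the action of the perturbed coaction,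
followed by right multiplication of vρ(b)v⋆ by v. -/
theorem slice_mul_slice_mul (hv : ρ.IsCocycle v) (φ ψ : HopfDual H) (b : B) :
    slice (toDual φ) (v * ρ (slice (toDual ψ) (v * ρ b))) = slice (toDual (φ * ψ)) (v * ρ b) := by
  have h : ρ.tensorId (ρ b) = idTensorComul (ρ b) := ρ.coassoc b
  rw [slice_mul_apply_slice, tensorId_mul, ← mul_assoc, hv.cocycle, h, ← idTensorComul_mul,
    slice_idTensorComul]

theorem slice_mul_slice (hv : ρ.IsCocycle v) (φ ψ : HopfDual H) :
    slice (toDual φ) (v * ρ (slice (toDual ψ) v)) = slice (toDual (φ * ψ)) v := by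
  have := hv.slice_mul_slice_mul φ ψ 1
  rwa [map_one, mul_one] at this

/-- Averaging over the Haar functional yields invariants of the twisted action, that is, solutions x
of vρ(x) = x ⊗ 1, with no condition on b. -/
theorem mul_apply_slice (hv : ρ.IsCocycle v) {e : HopfDual H} (he : ∀ φ, φ * e = φ 1 • e) (b : B) :
    v * ρ (slice (toDual e) (v * ρ b)) = slice (toDual e) (v * ρ b) ⊗ₜ 1 :=
  slice_dual_ext fun φ => by
    rw [hv.slice_mul_slice_mul, he, slice_tmul]
    simp [slice, LinearMap.lTensor_smul]

/-- The unit of H⁰ acts as an idempotent under the twisted action, so this slice is idempotent; it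
is also right invertible because v is unitary. -/
theorem slice_counit (hv : ρ.IsCocycle v) : slice (counit (R := ℂ)) v = 1 := by
  have h1 : slice (counit (R := ℂ)) v * slice (counit (R := ℂ)) v = slice (counit (R := ℂ)) v := by
    have := hv.slice_mul_slice 1 1
    rw [one_mul] at this
    have h1 : toDual (1 : HopfDual H) = counit (R := ℂ) := rfl
    rwa [h1, slice_counit_mul, slice_counit_apply] at this
  have h2 : slice (counit (R := ℂ)) v * slice (counit (R := ℂ)) (star v) = 1 := by
    rw [← slice_counit_mul, Unitary.mul_star_self_of_mem hv.mem_unitary,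
      Algebra.TensorProduct.one_def]
    simp
  have := congrArg (· * slice (counit (R := ℂ)) (star v)) h1
  simpa only [mul_assoc, h2, mul_one] using this

theorem slice_counit_star (hv : ρ.IsCocycle v) : slice (counit (R := ℂ)) (star v) = 1 := by
  have h2 : slice (counit (R := ℂ)) v * slice (counit (R := ℂ)) (star v) = 1 := by
    rw [← slice_counit_mul, Unitary.mul_star_self_of_mem hv.mem_unitary,
      Algebra.TensorProduct.one_def]
    simp
  rwa [hv.slice_counit, one_mul] at h2

end IsCocycle

/-- The elements `(id ⊗ e)(vρ(p))` and `(id ⊗ e)(ρ(p)v⋆)` are inverse to each other up to a scalar,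
for a Rohlin-type element `p` and the Haar functional `e`. -/
theorem IsCocycle.slice_mul_slice_of_rohlin {ρ : Coaction B H} {v : B ⊗[ℂ] H}
    (hv : ρ.IsCocycle v) {e : HopfDual H} (he : ∀ φ, φ * e = φ 1 • e) (hec : conjDual e = e)
    {l : H} (hl : ∀ h, h * l = counit (R := ℂ) h • l) (hl' : ∀ h, l * h = counit (R := ℂ) h • l)
    {p : B} (hp : (p ⊗ₜ 1) * ρ p = p ⊗ₜ l) (hpv : (p ⊗ₜ 1) * v = v * (p ⊗ₜ 1))
    (h1 : slice (toDual e) (ρ p) = e l • (1 : B))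
    (h2 : slice (toDual e) (v * ρ p * star v) = e l • (1 : B)) :
    slice (toDual e) (v * ρ p) * slice (toDual e) (ρ p * star v) = (e l * e l) • (1 : B) ∧
    slice (toDual e) (ρ p * star v) * slice (toDual e) (v * ρ p) = (e l * e l) • (1 : B) := by
  set x := slice (toDual e) (v * ρ p) with hx
  set y := slice (toDual e) (ρ p * star v) with hy
  have hvu := Unitary.star_mul_self_of_mem hv.mem_unitary
  have hρx : v * ρ x = x ⊗ₜ 1 := hv.mul_apply_slice he p
  -- As e is invariant under `conjDual`, the adjoint of y is itself a twisted average, of p⋆; so y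
  -- satisfies the adjoint invariance relation ρ(y)v⋆ = y ⊗ 1.
  have hsy : star y = slice (toDual e) (v * ρ (star p)) := by
    rw [hy, star_slice, hec, star_mul, star_star, ← map_star]
  have hρy : ρ y * star v = y ⊗ₜ 1 := by
    have := congrArg star (hv.mul_apply_slice he (star p))
    rw [← hsy] at this
    rwa [star_mul, ← map_star, star_star, TensorProduct.star_tmul, star_star, star_one] at this
  have hlp : (p ⊗ₜ[ℂ] l : B ⊗[ℂ] H) = (1 ⊗ₜ l) * (p ⊗ₜ 1) := by simp
  have hlp' : (p ⊗ₜ[ℂ] l : B ⊗[ℂ] H) = (p ⊗ₜ 1) * (1 ⊗ₜ l) := by simp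
  -- (p ⊗ 1)vρ(p) = v(p ⊗ 1)ρ(p) = v(p ⊗ l), and l absorbs v.
  have hpx : p * x = e l • p := by
    rw [hx, ← slice_tmul_one_mul, ← mul_assoc, hpv, mul_assoc, hp, hlp, ← mul_assoc,
      mul_one_tmul_integral hl, hv.slice_counit]
    simp
  have hpy : p * y = e l • p := by
    rw [hy, ← slice_tmul_one_mul, ← mul_assoc, hp, hlp', mul_assoc,
      one_tmul_integral_mul hl', hv.slice_counit_star]
    simp
  constructor
  -- xy = (id ⊗ e)(vρ(p)(y ⊗ 1)) = (id ⊗ e)(vρ(py)v⋆), which reduces to the average of p perturbed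
  -- by v. For yx below, v⋆v cancels and the unperturbed average remains.
  · conv_lhs => rw [hx]
    rw [← slice_mul_tmul_one, ← hρy, mul_assoc, ← mul_assoc (ρ p), ← map_mul, hpy, map_smul,
      smul_mul_assoc, mul_smul_comm, map_smul, ← mul_assoc, h2, smul_smul]
  · conv_lhs => rw [hy]
    rw [← slice_mul_tmul_one, ← hρx, mul_assoc, ← mul_assoc (star v), hvu, one_mul, ← map_mul, hpx,
      map_smul, map_smul, h1, smul_smul]

end Coaction

/-! ### Twisted copies of H⁰ in the crossed product. -/

namespace CrossedProduct

open Coaction HopfDual CStarHopfAlgebra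

variable {B H : Type*} [Ring B] [Algebra ℂ B] [StarRing B] [StarModule ℂ B]
  [Ring H] [HopfAlgebra ℂ H] [StarRing H] [CStarHopfAlgebra H] (ρ : Coaction B H)

/-- The map `φ ↦ (id ⊗ φ₁)(z) ⋊ φ₂` from `H⁰` to the crossed product. -/
noncomputable def twist (z : B ⊗[ℂ] H) : HopfDual H →ₗ[ℂ] CrossedProduct ρ :=
  (ofTensor ρ).toLinearMap ∘ₗ (sliceHom.flip z).rTensor (HopfDual H) ∘ₗ Coalgebra.comul

theorem twist_apply (z : B ⊗[ℂ] H) (φ : HopfDual H) : twist ρ z φ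
    = ofTensor ρ ((sliceHom.flip z).rTensor (HopfDual H) (Coalgebra.comul (R := ℂ) φ)) := rfl

theorem twist_add (x y : B ⊗[ℂ] H) : twist ρ (x + y) = twist ρ x + twist ρ y := by
  simp only [twist, map_add, LinearMap.rTensor_add, LinearMap.add_comp, LinearMap.comp_add]

theorem twist_zero : twist ρ (0 : B ⊗[ℂ] H) = 0 := by
  simp only [twist, map_zero, LinearMap.rTensor_zero, LinearMap.zero_comp, LinearMap.comp_zero]

theorem slice_counit_twist (z : B ⊗[ℂ] H) (φ : HopfDual H) :
    slice (Coalgebra.counit (R := ℂ)) ((ofTensor ρ).symm (twist ρ z φ)) = slice (toDual φ) z := by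
  have h : ∀ t : HopfDual H ⊗[ℂ] HopfDual H,
      slice (Coalgebra.counit (R := ℂ)) ((sliceHom.flip z).rTensor (HopfDual H) t)
        = slice (toDual (TensorProduct.rid ℂ _ (Coalgebra.counit.lTensor _ t) : HopfDual H)) z := by
    intro t
    induction t with
    | zero => simp [slice]
    | add x y hx hy =>
      simp only [map_add, hx, hy]
      simp [slice, LinearMap.lTensor_add]
    | tmul α β => simp [slice, LinearMap.lTensor_smul]
  rw [twist_apply, LinearEquiv.symm_apply_apply, h, Coalgebra.lTensor_counit_comul,
    TensorProduct.rid_tmul, one_smul]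

/-- The covariance relation of the crossed product: an element of B passes through `twist` as ρ(b)
on the right of z. For z = 1 it reads (1 ⋊ φ)(b ⋊ 1) = (φ₁ · b) ⋊ φ₂. -/
theorem twist_mul_mk_one (z : B ⊗[ℂ] H) (φ : HopfDual H) (b : B) :
    twist ρ z φ * mk ρ b 1 = twist ρ (z * ρ b) φ := by
  let T : HopfDual H ⊗[ℂ] (HopfDual H ⊗[ℂ] HopfDual H) →ₗ[ℂ] B ⊗[ℂ] HopfDual H :=
    (slicePair z (ρ b)).rTensor _ ∘ₗ (TensorProduct.assoc ℂ _ _ _).symm.toLinearMap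
  have h1 : ∀ t : HopfDual H ⊗[ℂ] HopfDual H,
      ofTensor ρ ((sliceHom.flip z).rTensor (HopfDual H) t) * mk ρ b 1
        = ofTensor ρ (T (Coalgebra.comul.lTensor _ t)) := by
    intro t
    induction t with
    | zero => simp
    | add x y hx hy => simp only [map_add, add_mul, hx, hy]
    | tmul α β =>
      rw [LinearMap.rTensor_tmul, ← mk, mk_eq, mul_assoc,
        show mk ρ b 1 = ofTensor ρ (b ⊗ₜ 1) from rfl, one_mk_mul, mk_one_mul,
        LinearMap.lTensor_tmul]
      congr 1
      generalize Coalgebra.comul (R := ℂ) β = s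
      induction s with
      | zero => simp
      | add x y hx hy => simp only [map_add, LinearMap.add_apply, TensorProduct.tmul_add, hx, hy]
      | tmul γ δ => simp [T, act_apply]
  have h2 : ∀ t : HopfDual H ⊗[ℂ] HopfDual H,
      T (TensorProduct.assoc ℂ _ _ _ (Coalgebra.comul.rTensor _ t))
        = (sliceHom.flip (z * ρ b)).rTensor (HopfDual H) t := by
    intro t
    induction t with
    | zero => simp
    | add x y hx hy => simp only [map_add, hx, hy]
    | tmul α β => simp [T, slice_mul]
  rw [twist_apply, h1, ← Coalgebra.coassoc_apply, h2, ← twist_apply]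

theorem mk_one_mul_twist (a : B) (z : B ⊗[ℂ] H) (φ : HopfDual H) :
    mk ρ a 1 * twist ρ z φ = twist ρ ((a ⊗ₜ 1) * z) φ := by
  rw [twist_apply, mk_one_mul, twist_apply]
  generalize Coalgebra.comul (R := ℂ) φ = t
  congr 1
  induction t with
  | zero => simp
  | add x y hx hy => simp only [map_add, hx, hy]
  | tmul α β => simp [slice_tmul_one_mul]

theorem twist_one (φ : HopfDual H) : twist ρ 1 φ = mk ρ 1 φ := by
  have h : ∀ t : HopfDual H ⊗[ℂ] HopfDual H,
      (sliceHom.flip (1 : B ⊗[ℂ] H)).rTensor (HopfDual H) t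
        = 1 ⊗ₜ (TensorProduct.lid ℂ _ (Coalgebra.counit.rTensor _ t)) := by
    intro t
    induction t with
    | zero => simp
    | add x y hx hy => simp only [map_add, TensorProduct.tmul_add, hx, hy]
    | tmul α β => simp [Algebra.TensorProduct.one_def, TensorProduct.smul_tmul]
  rw [twist_apply, h, Coalgebra.rTensor_counit_comul, TensorProduct.lid_tmul, one_smul, mk]

/-- The functional `k ↦ φ(hk)`, linearly in `φ`. -/
noncomputable def translateLin (h : H) : HopfDual H →ₗ[ℂ] HopfDual H :=
  toDual.symm.toLinearMap ∘ₗ (LinearMap.mulLeft ℂ h).dualMap ∘ₗ toDual.toLinearMap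

@[simp] theorem translateLin_apply (h : H) (φ : HopfDual H) (k : H) :
    translateLin h φ k = φ (h * k) := by
  simp [translateLin]

theorem comul_translateLin (h : H) (φ : HopfDual H) :
    Coalgebra.comul (R := ℂ) (translateLin h φ)
      = (translateLin h).rTensor _ (Coalgebra.comul (R := ℂ) φ) := by
  apply ext₂
  intro a b
  have : ∀ t : HopfDual H ⊗[ℂ] HopfDual H, toDual₂ ((translateLin h).rTensor _ t) (a ⊗ₜ b)
      = toDual₂ t ((h * a) ⊗ₜ b) := by
    intro t
    induction t with
    | zero => simp
    | add x y hx hy => simp only [map_add, LinearMap.add_apply, hx, hy]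
    | tmul α β => simp
  rw [this, toDual₂_comul', toDual₂_comul', translateLin_apply, mul_assoc]

theorem slice_one_tmul_mul (φ : HopfDual H) (h : H) (z : B ⊗[ℂ] H) :
    slice (toDual φ) ((1 ⊗ₜ h) * z) = slice (toDual (translateLin h φ)) z := by
  induction z with
  | zero => simp
  | add x y hx hy => simp only [mul_add, map_add, hx, hy]
  | tmul b k => simp

theorem twist_one_tmul_mul (h : H) (z : B ⊗[ℂ] H) (φ : HopfDual H) :
    twist ρ ((1 ⊗ₜ h) * z) φ = twist ρ z (translateLin h φ) := by
  rw [twist_apply, twist_apply, comul_translateLin]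
  generalize Coalgebra.comul (R := ℂ) φ = t
  congr 1
  induction t with
  | zero => simp
  | add x y hx hy => simp only [map_add, hx, hy]
  | tmul α β => simp [slice_one_tmul_mul]

/-- A cocycle gives a second multiplicative copy of H⁰ in the same crossed product, the one
belonging to the perturbed coaction. -/
theorem twist_mul_twist {v : B ⊗[ℂ] H} (hv : ρ.IsCocycle v) (φ ψ : HopfDual H) :
    twist ρ v φ * twist ρ v ψ = twist ρ v (φ * ψ) := by
  have h : ∀ t : HopfDual H ⊗[ℂ] HopfDual H,
      twist ρ v φ * ofTensor ρ ((sliceHom.flip v).rTensor (HopfDual H) t)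
        = ofTensor ρ ((sliceHom.flip v).rTensor (HopfDual H)
          (Coalgebra.comul (R := ℂ) φ * t)) := by
    intro t
    induction t with
    | zero => simp
    | add x y hx hy => simp only [map_add, mul_add, hx, hy]
    | tmul α β =>
      rw [LinearMap.rTensor_tmul, ← mk, mk_eq, ← mul_assoc, twist_mul_mk_one, twist_apply]
      generalize Coalgebra.comul (R := ℂ) φ = s
      induction s with
      | zero => simp
      | add x y hx hy => simp only [map_add, add_mul, hx, hy]
      | tmul γ δ =>
        rw [LinearMap.rTensor_tmul, ← mk, mk_eq, mul_assoc, one_mk_mul_one_mk, ← mk_eq,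
          LinearMap.flip_apply, LinearMap.flip_apply, sliceHom_apply, sliceHom_apply,
          hv.slice_mul_slice, Algebra.TensorProduct.tmul_mul_tmul, LinearMap.rTensor_tmul, mk]
        rfl
  rw [twist_apply ρ v ψ, h, ← Bialgebra.comul_mul, ← twist_apply]

/-- The twisted Haar element absorbs the twisted copy of H⁰ standing to its left through the counit
of H⁰, so that only a coefficient in B survives. -/
theorem twist_mul_twist_haar {v : B ⊗[ℂ] H} (hv : ρ.IsCocycle v) {e : HopfDual H}
    (he : ∀ φ, φ * e = φ 1 • e) (z : B ⊗[ℂ] H) (φ : HopfDual H) :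
    twist ρ z φ * twist ρ v e = mk ρ (slice (toDual φ) (z * star v)) 1 * twist ρ v e := by
  -- Factoring out v makes the claim linear in y. For y = b ⊗ h, the factor h only translates φ, and
  -- the translated functional takes the value φ(h) at 1.
  obtain ⟨y, rfl⟩ : ∃ y, z = y * v :=
    ⟨z * star v, by rw [mul_assoc, Unitary.star_mul_self_of_mem hv.mem_unitary, mul_one]⟩
  rw [mul_assoc y, Unitary.mul_star_self_of_mem hv.mem_unitary, mul_one]
  induction y with
  | zero => simp [twist_zero, mk]
  | add x y hx hy =>
    rw [add_mul, twist_add, LinearMap.add_apply, add_mul, hx, hy, map_add, ← add_mul]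
    simp [mk, TensorProduct.add_tmul]
  | tmul b h =>
    have : (b ⊗ₜ[ℂ] h) * v = (b ⊗ₜ 1) * ((1 ⊗ₜ h) * v) := by
      rw [← mul_assoc]; simp
    rw [this, ← mk_one_mul_twist, twist_one_tmul_mul, mul_assoc, twist_mul_twist ρ hv, he,
      translateLin_apply, mul_one, map_smul, mul_smul_comm, slice_tmul,
      show mk ρ (φ h • b) 1 = φ h • mk ρ b 1 by simp [mk, ← TensorProduct.smul_tmul'],
      smul_mul_assoc]

/-- By coassociativity in H⁰, the dual coaction treats twisted copies of H⁰ as it does the standard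
one. -/
theorem dualLin_twist (z : B ⊗[ℂ] H) (φ : HopfDual H) :
    dualLin ρ (twist ρ z φ)
      = (twist ρ z).rTensor (HopfDual H) (Coalgebra.comul (R := ℂ) φ) := by
  let G : HopfDual H ⊗[ℂ] (HopfDual H ⊗[ℂ] HopfDual H) →ₗ[ℂ] CrossedProduct ρ ⊗[ℂ] HopfDual H :=
    reassoc ρ ∘ₗ (sliceHom.flip z).rTensor _
  have h1 : ∀ t : HopfDual H ⊗[ℂ] HopfDual H,
      dualLin ρ (ofTensor ρ ((sliceHom.flip z).rTensor (HopfDual H) t))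
        = G (Coalgebra.comul.lTensor _ t) := by
    intro t
    induction t with
    | zero => simp
    | add x y hx hy => simp only [map_add, hx, hy]
    | tmul α β => simp [G, dualLin_ofTensor]
  have h2 : ∀ t : HopfDual H ⊗[ℂ] HopfDual H,
      G (TensorProduct.assoc ℂ _ _ _ (Coalgebra.comul.rTensor _ t))
        = (twist ρ z).rTensor (HopfDual H) t := by
    intro t
    induction t with
    | zero => simp
    | add x y hx hy => simp only [map_add, hx, hy]
    | tmul α β =>
      rw [LinearMap.rTensor_tmul, LinearMap.rTensor_tmul, twist_apply]
      generalize Coalgebra.comul (R := ℂ) α = s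
      induction s with
      | zero => simp
      | add x y hx hy => simp only [map_add, TensorProduct.add_tmul, hx, hy]
      | tmul γ δ => simp [G, mk]
  rw [twist_apply, h1, ← Coalgebra.coassoc_apply, h2]

/-- The product is qq₁ ⊗ q₂ for the twisted Haar element q, and q absorbs its first leg. This is the
hypothesis of `IsRepresentedBy.apply_mul_slice_mul_apply`. -/
theorem twist_haar_mul_dualLin {v : B ⊗[ℂ] H} (hv : ρ.IsCocycle v) {e : HopfDual H}
    (he : ∀ φ, e * φ = φ 1 • e) :
    (twist ρ v e ⊗ₜ[ℂ] (1 : HopfDual H)) * dualLin ρ (twist ρ v e) = twist ρ v e ⊗ₜ e := by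
  have h : ∀ t : HopfDual H ⊗[ℂ] HopfDual H,
      (twist ρ v e ⊗ₜ[ℂ] (1 : HopfDual H)) * (twist ρ v).rTensor (HopfDual H) t
        = twist ρ v e ⊗ₜ (TensorProduct.lid ℂ _ (Coalgebra.counit.rTensor _ t)) := by
    intro t
    induction t with
    | zero => simp
    | add x y hx hy => simp only [map_add, mul_add, TensorProduct.tmul_add, hx, hy]
    | tmul α β => simp [twist_mul_twist ρ hv, he, TensorProduct.smul_tmul]
  rw [dualLin_twist, h, Coalgebra.rTensor_counit_comul, TensorProduct.lid_tmul, one_smul]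

/-- Evaluating the H⁰ leg of (id ⊗ φ₁)(z) ⊗ φ₂ at h gives (id ⊗ φ)(z(1 ⊗ h)), and elements of B come
out on the right. -/
theorem slice_mul_eq_zero_of_twist {z : B ⊗[ℂ] H} {φ : HopfDual H} (h0 : twist ρ z φ = 0)
    (y : B ⊗[ℂ] H) : slice (toDual φ) (z * y) = 0 := by
  have h1 : ∀ h : H, slice (toDual φ) (z * (1 ⊗ₜ h)) = 0 := by
    intro h
    have h2 : ∀ t : HopfDual H ⊗[ℂ] HopfDual H,
        slice (LinearMap.applyₗ h ∘ₗ (toDual (H := H)).toLinearMap)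
          ((sliceHom.flip z).rTensor (HopfDual H) t)
        = slice (toDual₂ t) (((TensorProduct.mk ℂ H H).flip h).lTensor B z) := by
      intro t
      induction t with
      | zero => simp [slice]
      | add x y hx hy =>
        simp only [map_add, hx, hy]
        simp [slice, LinearMap.lTensor_add]
      | tmul α β =>
        clear h0
        induction z with
        | zero => simp
        | add x y hx hy =>
          simp only [LinearMap.rTensor_tmul, LinearMap.flip_apply, map_add, LinearMap.add_apply,
            TensorProduct.add_tmul] at hx hy ⊢
          rw [hx, hy]
        | tmul b k => simp [smul_smul, mul_comm]
    have h3 := h2 (Coalgebra.comul (R := ℂ) φ)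
    have h4 : (sliceHom.flip z).rTensor (HopfDual H) (Coalgebra.comul (R := ℂ) φ) = 0 :=
      (ofTensor ρ).map_eq_zero_iff.1 h0
    rw [h4, map_zero] at h3
    refine Eq.trans ?_ h3.symm
    clear h4 h3 h2 h0
    induction z with
    | zero => simp
    | add x y hx hy => simp only [add_mul, map_add, hx, hy]
    | tmul b k => simp
  induction y with
  | zero => simp
  | add x y hx hy => rw [mul_add, map_add, hx, hy, add_zero]
  | tmul b h =>
    have : b ⊗ₜ[ℂ] h = (1 ⊗ₜ h) * (b ⊗ₜ 1) := by simp
    rw [this, ← mul_assoc, slice_mul_tmul_one, h1, zero_mul]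

/-- Multiplying by v⋆ inside the slice undoes the twist and leaves e(1)(a - b). This lets identities
in B be read off after multiplication by the twisted Haar element. -/
theorem mk_one_mul_twist_injective {v : B ⊗[ℂ] H} (hv : v ∈ unitary (B ⊗[ℂ] H)) {e : HopfDual H}
    (he : e 1 = 1) {a b : B} (h : mk ρ a 1 * twist ρ v e = mk ρ b 1 * twist ρ v e) : a = b := by
  have h0 : twist ρ (((a - b) ⊗ₜ 1) * v) e = 0 := by
    rw [← mk_one_mul_twist]
    have : mk ρ (a - b) 1 = mk ρ a 1 - mk ρ b 1 := by simp [mk, TensorProduct.sub_tmul]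
    rw [this, sub_mul, h, sub_self]
  have := slice_mul_eq_zero_of_twist ρ h0 (star v)
  rw [mul_assoc, Unitary.mul_star_self_of_mem hv, mul_one, slice_tmul, he, one_smul] at this
  exact sub_eq_zero.1 this

/-- The fixed points of the dual coaction are the coefficient algebra: the map (b ⋊ φ) ⊗ ψ ↦ φ(1) b
⋊ ψ is a left inverse of the dual coaction and sends x ⊗ 1 to an element of B ⋊ 1. -/
theorem exists_mk_one_of_dualLin {x : CrossedProduct ρ} (hx : dualLin ρ x = x ⊗ₜ 1) :
    ∃ b, x = mk ρ b 1 := by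
  obtain ⟨z, rfl⟩ := (ofTensor ρ).surjective x
  let N : CrossedProduct ρ ⊗[ℂ] HopfDual H →ₗ[ℂ] CrossedProduct ρ :=
    (ofTensor ρ).toLinearMap ∘ₗ
      (slice (Coalgebra.counit (R := ℂ)) ∘ₗ (ofTensor ρ).symm.toLinearMap).rTensor (HopfDual H)
  have h1 : ∀ (b : B) (t : HopfDual H ⊗[ℂ] HopfDual H), N (reassoc ρ (b ⊗ₜ t))
      = mk ρ b (TensorProduct.lid ℂ _ (Coalgebra.counit.rTensor _ t)) := by
    intro b t
    induction t with
    | zero => simp [mk]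
    | add x y hx hy =>
      simp only [map_add, TensorProduct.tmul_add, hx, hy]
      simp [mk, TensorProduct.tmul_add]
    | tmul α β => simp [N, mk, TensorProduct.smul_tmul]
  have h2 : N (dualLin ρ (ofTensor ρ z)) = ofTensor ρ z := by
    clear hx
    rw [dualLin_ofTensor]
    induction z with
    | zero => simp
    | add x y hx hy => simp only [map_add, hx, hy]
    | tmul b φ =>
      rw [LinearMap.lTensor_tmul, h1, Coalgebra.rTensor_counit_comul, TensorProduct.lid_tmul,
        one_smul, mk]
  refine ⟨slice (Coalgebra.counit (R := ℂ)) z, ?_⟩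
  rw [← h2, hx]
  simp [N, mk]

theorem mk_one_injective {a b : B} (h : mk ρ a 1 = mk ρ b 1) : a = b := by
  have := congrArg (fun x => slice (Coalgebra.counit (R := ℂ)) ((ofTensor ρ).symm x)) h
  simpa [mk] using this

variable {ρ} {B' : Type*} [Ring B'] [Algebra ℂ B'] [StarRing B'] [StarModule ℂ B']
  {ρ' : Coaction B' H}

theorem map_mk (f : B →⋆ₐ[ℂ] B') (hf : ∀ b, ρ' (f b) = f.toAlgHom.toLinearMap.rTensor H (ρ b))
    (b : B) (φ : HopfDual H) : map f hf (mk ρ b φ) = mk ρ' (f b) φ :=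
  mapLin_mk (ρ := ρ) f b φ

theorem map_twist (f : B →⋆ₐ[ℂ] B')
    (hf : ∀ b, ρ' (f b) = f.toAlgHom.toLinearMap.rTensor H (ρ b)) (z : B ⊗[ℂ] H)
    (φ : HopfDual H) :
    map f hf (twist ρ z φ) = twist ρ' (f.toAlgHom.toLinearMap.rTensor H z) φ := by
  rw [twist_apply, twist_apply]
  generalize Coalgebra.comul (R := ℂ) φ = t
  induction t with
  | zero => simp
  | add x y hx hy => simp only [map_add, hx, hy]
  | tmul α β =>
    rw [LinearMap.rTensor_tmul, LinearMap.rTensor_tmul]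
    refine (map_mk f hf _ _).trans ?_
    simp [mk, slice_rTensor]

end CrossedProduct

/-! ### Evaluation at an integral as an integral on H⁰. -/

namespace HopfDual

open CStarHopfAlgebra

variable {H : Type*} [Ring H] [HopfAlgebra ℂ H] [StarRing H] [CStarHopfAlgebra H]

/-- Evaluation of the functionals on `H` at an element. -/
noncomputable def evalAt (l : H) : Module.Dual ℂ (HopfDual H) :=
  LinearMap.applyₗ l ∘ₗ (toDual (H := H)).toLinearMap

@[simp] theorem evalAt_apply (l : H) (φ : HopfDual H) : evalAt l φ = φ l := rfl

theorem lid_rTensor_evalAt_comul {l : H} (hl : ∀ h, l * h = Coalgebra.counit (R := ℂ) h • l)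
    (φ : HopfDual H) :
    TensorProduct.lid ℂ _ ((evalAt l).rTensor _ (Coalgebra.comul (R := ℂ) φ)) = φ l • 1 := by
  ext h
  have : ∀ t : HopfDual H ⊗[ℂ] HopfDual H,
      (TensorProduct.lid ℂ _ ((evalAt l).rTensor _ t) : HopfDual H) h = toDual₂ t (l ⊗ₜ h) := by
    intro t
    induction t with
    | zero => simp
    | add x y hx hy => simp only [map_add, LinearMap.add_apply, hx, hy]
    | tmul α β => simp
  rw [this, toDual₂_comul', hl]
  simp [one_apply, mul_comm]

theorem rid_lTensor_evalAt_comul_apply (l : H) (φ : HopfDual H) (h : H) :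
    (TensorProduct.rid ℂ _ ((evalAt l).lTensor _ (Coalgebra.comul (R := ℂ) φ)) : HopfDual H) h
      = φ (h * l) := by
  have : ∀ t : HopfDual H ⊗[ℂ] HopfDual H,
      (TensorProduct.rid ℂ _ ((evalAt l).lTensor _ t) : HopfDual H) h = toDual₂ t (h ⊗ₜ l) := by
    intro t
    induction t with
    | zero => simp
    | add x y hx hy => simp only [map_add, LinearMap.add_apply, hx, hy]
    | tmul α β => simp [mul_comm]
  rw [this, toDual₂_comul']

theorem rid_lTensor_evalAt_comul {l : H} (hl : ∀ h, h * l = Coalgebra.counit (R := ℂ) h • l)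
    (φ : HopfDual H) :
    TensorProduct.rid ℂ _ ((evalAt l).lTensor _ (Coalgebra.comul (R := ℂ) φ)) = φ l • 1 := by
  ext h
  rw [rid_lTensor_evalAt_comul_apply, hl]
  simp [one_apply, mul_comm]

end HopfDual

/-! ### Representing unitaries and the Rohlin element. -/

namespace Coaction

open HopfDual CStarHopfAlgebra

variable {B C H : Type*} [Ring B] [Algebra ℂ B] [StarRing B] [StarModule ℂ B]
  [Ring C] [Algebra ℂ C] [StarRing C] [StarModule ℂ C]
  [Ring H] [HopfAlgebra ℂ H] [StarRing H] [CStarHopfAlgebra H]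

/-- `c ⊗ α ⊗ β ↦ α(l) c ⊗ β`. -/
noncomputable def midSlice (l : H) : C ⊗[ℂ] (HopfDual H ⊗[ℂ] HopfDual H) →ₗ[ℂ] C ⊗[ℂ] HopfDual H :=
  LinearMap.lTensor C ((TensorProduct.lid ℂ (HopfDual H)).toLinearMap ∘ₗ
    (evalAt l).rTensor (HopfDual H))

/-- `c ⊗ α ⊗ β ↦ β(l) c ⊗ α`. -/
noncomputable def lastSlice (l : H) :
    C ⊗[ℂ] (HopfDual H ⊗[ℂ] HopfDual H) →ₗ[ℂ] C ⊗[ℂ] HopfDual H :=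
  LinearMap.lTensor C ((TensorProduct.rid ℂ (HopfDual H)).toLinearMap ∘ₗ
    (evalAt l).lTensor (HopfDual H))

@[simp] theorem midSlice_tmul (l : H) (c : C) (α β : HopfDual H) :
    midSlice l (c ⊗ₜ (α ⊗ₜ β)) = c ⊗ₜ (α l • β) := by
  simp [midSlice]

@[simp] theorem lastSlice_tmul (l : H) (c : C) (α β : HopfDual H) :
    lastSlice l (c ⊗ₜ (α ⊗ₜ β)) = c ⊗ₜ (β l • α) := by
  simp [lastSlice]

/-- Slicing one leg of w₁₂w₁₃ = (id ⊗ Δ)(w) at an element of H expresses that h ↦ (id ⊗ h)(w) is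
multiplicative; the other leg is kept so that w itself stays in the formula. -/
theorem midSlice_tmulOne_mul (l : H) (x y : C ⊗[ℂ] HopfDual H) :
    midSlice l (tmulOne x * trivialTensorId y) = (slice (evalAt l) x ⊗ₜ 1) * y := by
  induction x with
  | zero => simp [tmulOne]
  | add x x' hx hx' =>
    have : tmulOne (x + x') = tmulOne x + tmulOne x' := by simp [tmulOne, TensorProduct.add_tmul]
    simp only [this, add_mul, map_add, TensorProduct.add_tmul, hx, hx']
  | tmul c α =>
    induction y with
    | zero => simp [trivialTensorId]
    | add y y' hy hy' =>
      have : trivialTensorId (y + y') = trivialTensorId y + trivialTensorId y' := by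
        simp [trivialTensorId]
      simp only [this, mul_add, map_add, hy, hy']
    | tmul d β => simp [tmulOne, trivialTensorId, TensorProduct.smul_tmul]

theorem lastSlice_tmulOne_mul (l : H) (x y : C ⊗[ℂ] HopfDual H) :
    lastSlice l (tmulOne x * trivialTensorId y) = x * (slice (evalAt l) y ⊗ₜ 1) := by
  induction x with
  | zero => simp [tmulOne]
  | add x x' hx hx' =>
    have : tmulOne (x + x') = tmulOne x + tmulOne x' := by simp [tmulOne, TensorProduct.add_tmul]
    simp only [this, add_mul, map_add, hx, hx']
  | tmul c α =>
    induction y with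
    | zero => simp [trivialTensorId]
    | add y y' hy hy' =>
      have : trivialTensorId (y + y') = trivialTensorId y + trivialTensorId y' := by
        simp [trivialTensorId]
      simp only [this, mul_add, map_add, TensorProduct.add_tmul, hy, hy']
    | tmul d β => simp [tmulOne, trivialTensorId, TensorProduct.smul_tmul]

theorem lastSlice_tensorId_mul (γ : Coaction C (HopfDual H)) (l : H) (x y : C ⊗[ℂ] HopfDual H) :
    lastSlice l (γ.tensorId x * tmulOne y) = γ (slice (evalAt l) x) * y := by
  induction y with
  | zero => simp [tmulOne]
  | add y y' hy hy' =>
    have : tmulOne (y + y') = tmulOne y + tmulOne y' := by simp [tmulOne, TensorProduct.add_tmul]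
    simp only [this, mul_add, map_add, hy, hy']
  | tmul d β =>
    induction x with
    | zero => simp [tensorId]
    | add x x' hx hx' =>
      have : γ.tensorId (x + x') = γ.tensorId x + γ.tensorId x' := by simp [tensorId]
      simp only [this, add_mul, map_add, hx, hx']
    | tmul c α =>
      rw [slice_tmul, map_smul, tensorId, LinearMap.rTensor_tmul, lin_apply]
      generalize γ c = z
      induction z with
      | zero => simp
      | add x y hx hy => simp only [map_add, smul_add, TensorProduct.add_tmul, add_mul, hx, hy]
      | tmul a δ => simp [tmulOne]

theorem midSlice_idTensorComul {l : H} (hl : ∀ h, l * h = Coalgebra.counit (R := ℂ) h • l)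
    (x : C ⊗[ℂ] HopfDual H) : midSlice l (idTensorComul x) = slice (evalAt l) x ⊗ₜ 1 := by
  induction x with
  | zero => simp [idTensorComul]
  | add x y hx hy =>
    have : idTensorComul (x + y) = idTensorComul x + idTensorComul y := by simp [idTensorComul]
    simp only [this, map_add, TensorProduct.add_tmul, hx, hy]
  | tmul c α =>
    rw [idTensorComul, LinearMap.lTensor_tmul, midSlice, LinearMap.lTensor_tmul,
      LinearMap.comp_apply, LinearEquiv.coe_coe, lid_rTensor_evalAt_comul hl]
    simp [TensorProduct.smul_tmul]

theorem lastSlice_idTensorComul {l : H} (hl : ∀ h, h * l = Coalgebra.counit (R := ℂ) h • l)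
    (x : C ⊗[ℂ] HopfDual H) : lastSlice l (idTensorComul x) = slice (evalAt l) x ⊗ₜ 1 := by
  induction x with
  | zero => simp [idTensorComul]
  | add x y hx hy =>
    have : idTensorComul (x + y) = idTensorComul x + idTensorComul y := by simp [idTensorComul]
    simp only [this, map_add, TensorProduct.add_tmul, hx, hy]
  | tmul c α =>
    rw [idTensorComul, LinearMap.lTensor_tmul, lastSlice, LinearMap.lTensor_tmul,
      LinearMap.comp_apply, LinearEquiv.coe_coe, rid_lTensor_evalAt_comul hl]
    simp [TensorProduct.smul_tmul]

theorem midSlice_one_idTensorComul (x : C ⊗[ℂ] HopfDual H) :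
    midSlice (1 : H) (idTensorComul x) = x := by
  induction x with
  | zero => simp [idTensorComul]
  | add x y hx hy =>
    have : idTensorComul (x + y) = idTensorComul x + idTensorComul y := by simp [idTensorComul]
    simp only [this, map_add, hx, hy]
  | tmul c α =>
    rw [idTensorComul, LinearMap.lTensor_tmul, midSlice, LinearMap.lTensor_tmul,
      LinearMap.comp_apply, LinearEquiv.coe_coe,
      show evalAt (1 : H) = Coalgebra.counit (R := ℂ) (A := HopfDual H) from rfl,
      Coalgebra.rTensor_counit_comul, TensorProduct.lid_tmul, one_smul]

namespace IsRepresentedBy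

variable {β : Coaction B (HopfDual H)} {ι : B →⋆ₐ[ℂ] C} {γ : Coaction C (HopfDual H)}
  {w : C ⊗[ℂ] HopfDual H}

/-- Slicing `trivial_mul` at 1 shows that this element acts on w as the identity; cancel w and apply
the counit of H⁰. -/
theorem slice_one (hw : β.IsRepresentedBy ι γ w) : slice (evalAt 1) w = 1 := by
  have h1 : (slice (evalAt 1) w ⊗ₜ[ℂ] (1 : HopfDual H)) * w = w := by
    have := congrArg (midSlice 1) hw.trivial_mul
    rwa [midSlice_tmulOne_mul, midSlice_one_idTensorComul] at this
  have h2 := congrArg (· * star w) h1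
  simp only [mul_assoc, Unitary.mul_star_self_of_mem hw.mem_unitary, mul_one] at h2
  have h3 := congrArg (slice (evalAt 1)) h2
  rw [slice_tmul, Algebra.TensorProduct.one_def, slice_tmul] at h3
  have h4 : evalAt (1 : H) 1 = 1 := by simp [one_apply]
  rwa [h4, one_smul, one_smul] at h3

variable {l : H}

theorem slice_tmul_one_mul (hw : β.IsRepresentedBy ι γ w)
    (hl : ∀ h, l * h = Coalgebra.counit (R := ℂ) h • l) :
    (slice (evalAt l) w ⊗ₜ 1) * w = slice (evalAt l) w ⊗ₜ 1 := by
  have := congrArg (midSlice l) hw.trivial_mul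
  rwa [midSlice_tmulOne_mul, midSlice_idTensorComul hl] at this

theorem mul_slice_tmul_one (hw : β.IsRepresentedBy ι γ w)
    (hl : ∀ h, h * l = Coalgebra.counit (R := ℂ) h • l) :
    w * (slice (evalAt l) w ⊗ₜ 1) = slice (evalAt l) w ⊗ₜ 1 := by
  have := congrArg (lastSlice l) hw.trivial_mul
  rwa [lastSlice_tmulOne_mul, lastSlice_idTensorComul hl] at this

/-- Let P be the slice of w at l. The relation (γ ⊗ id)(w)(w ⊗ 1) = (id ⊗ Δ)(w), sliced at l, gives
γ(P)w = P ⊗ 1. This equals (P ⊗ 1)w by the other relation, and w cancels. -/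
theorem apply_slice (hw : β.IsRepresentedBy ι γ w)
    (hl : ∀ h, h * l = Coalgebra.counit (R := ℂ) h • l)
    (hl' : ∀ h, l * h = Coalgebra.counit (R := ℂ) h • l) :
    γ (slice (evalAt l) w) = slice (evalAt l) w ⊗ₜ 1 := by
  have h1 := congrArg (lastSlice l) hw.mul_tmulOne
  rw [lastSlice_tensorId_mul, lastSlice_idTensorComul hl, ← hw.slice_tmul_one_mul hl'] at h1
  have h2 := congrArg (· * star w) h1
  simpa only [mul_assoc, Unitary.mul_star_self_of_mem hw.mem_unitary, mul_one] using h2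

/-- The implementation of β by w in the form w(ι(b) ⊗ 1) = (ι ⊗ id)(β(b))w. -/
theorem slice_mul_apply (hw : β.IsRepresentedBy ι γ w) (b : B) :
    slice (evalAt l) w * ι b
      = slice (evalAt l) (ι.toAlgHom.toLinearMap.rTensor (HopfDual H) (β b) * w) := by
  rw [hw.apply_eq, mul_assoc, mul_assoc, Unitary.star_mul_self_of_mem hw.mem_unitary, mul_one,
    slice_mul_tmul_one]

theorem slice_mul_apply_mul_slice (hw : β.IsRepresentedBy ι γ w)
    (hl : ∀ h, h * l = Coalgebra.counit (R := ℂ) h • l) (b : B) :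
    slice (evalAt l) w * ι b * slice (evalAt l) w
      = slice (evalAt l) (ι.toAlgHom.toLinearMap.rTensor (HopfDual H) (β b))
        * slice (evalAt l) w := by
  rw [hw.slice_mul_apply, ← slice_mul_tmul_one, mul_assoc, hw.mul_slice_tmul_one hl,
    slice_mul_tmul_one]

/-- Moving w past the second ι(b) produces (ι(b) ⊗ e)w; since e is an integral, (1 ⊗ e)w = (id ⊗
ε⁰)(w) ⊗ e, which is 1 ⊗ e. -/
theorem apply_mul_slice_mul_apply (hw : β.IsRepresentedBy ι γ w) {e : HopfDual H}
    (he : ∀ φ, e * φ = φ 1 • e) {b : B} (hb : (b ⊗ₜ 1) * β b = b ⊗ₜ e) :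
    ι b * slice (evalAt l) w * ι b = e l • ι b := by
  have h1 : ∀ x : C ⊗[ℂ] HopfDual H, ((1 : C) ⊗ₜ e) * x = slice (evalAt 1) x ⊗ₜ e := by
    intro x
    induction x with
    | zero => simp
    | add x y hx hy => simp only [mul_add, map_add, TensorProduct.add_tmul, hx, hy]
    | tmul c φ => simp [he, TensorProduct.smul_tmul]
  have h2 := congrArg (ι.toAlgHom.toLinearMap.rTensor (HopfDual H)) hb
  rw [rTensor_mul, LinearMap.rTensor_tmul, LinearMap.rTensor_tmul] at h2
  change (ι b ⊗ₜ 1) * _ = ι b ⊗ₜ e at h2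
  rw [mul_assoc, hw.slice_mul_apply, ← Coaction.slice_tmul_one_mul, ← mul_assoc, h2,
    show ι b ⊗ₜ[ℂ] e = (ι b ⊗ₜ 1) * (1 ⊗ₜ e) by simp, mul_assoc, h1, hw.slice_one]
  simp

end IsRepresentedBy

/-- If the dual coaction of `ρ` is represented in the crossed product of an equivariant extension,
then the extension contains a Rohlin element: it commutes with the image of the original algebra,
it generates a copy of the integral `l`, and its averages with respect to all perturbations of the
coaction by cocycles are equal to `e(l)`. -/
theorem exists_rohlin_element {A : Type*} [Ring A] [Algebra ℂ A] [StarRing A] [StarModule ℂ A]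
    {ρ : Coaction A H} {ρ' : Coaction B H} (f : A →⋆ₐ[ℂ] B)
    (hf : ∀ a, ρ' (f a) = f.toAlgHom.toLinearMap.rTensor H (ρ a))
    {w : CrossedProduct ρ' ⊗[ℂ] HopfDual H}
    (hw : (CrossedProduct.dualCoaction ρ).IsRepresentedBy (CrossedProduct.map f hf)
      (CrossedProduct.dualCoaction ρ') w)
    {l : H} (hl : ∀ h, h * l = Coalgebra.counit (R := ℂ) h • l)
    (hl' : ∀ h, l * h = Coalgebra.counit (R := ℂ) h • l)
    {e : HopfDual H} (he : ∀ φ, φ * e = φ 1 • e) (he' : ∀ φ, e * φ = φ 1 • e) (he1 : e 1 = 1) :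
    ∃ p : B, (∀ a, p * f a = f a * p) ∧ (p ⊗ₜ 1) * ρ' p = p ⊗ₜ l ∧
      ∀ v : A ⊗[ℂ] H, ρ.IsCocycle v → ρ'.IsCocycle (f.toAlgHom.toLinearMap.rTensor H v) →
        slice (toDual e) (f.toAlgHom.toLinearMap.rTensor H v * ρ' p
          * star (f.toAlgHom.toLinearMap.rTensor H v)) = e l • (1 : B) := by
  obtain ⟨p, hp⟩ := CrossedProduct.exists_mk_one_of_dualLin ρ' (hw.apply_slice hl hl')
  have hβ : ∀ x, CrossedProduct.dualCoaction ρ x = CrossedProduct.dualLin ρ x := fun _ => rfl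
  have hm : ∀ x, (CrossedProduct.map f hf).toAlgHom.toLinearMap x = CrossedProduct.map f hf x :=
    fun _ => rfl
  refine ⟨p, fun a => ?_, ?_, fun v hv hv' => ?_⟩
  -- The dual coaction is trivial on the coefficient algebra, and w implements it.
  · apply CrossedProduct.mk_one_injective ρ'
    have h1 := hw.slice_mul_apply (l := l) (CrossedProduct.mk ρ a 1)
    rw [hβ, CrossedProduct.dualLin_mk_one, LinearMap.rTensor_tmul, hm,
      slice_tmul_one_mul, CrossedProduct.map_mk, hp, CrossedProduct.mk_one_mul_mk_one,
      CrossedProduct.mk_one_mul_mk_one] at h1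
    exact h1
  · refine slice_dual_ext fun φ => ?_
    -- This is the functional h ↦ φ(hl). Compressing 1 ⋊ φ by p gives (p ⋊ 1)(1 ⋊ φ)(p ⋊ 1) = (1 ⋊
    -- ψ)(p ⋊ 1); comparing counit slices yields (id ⊗ φ) of (p ⊗ 1)ρ'(p) = ρ'(p)(1 ⊗ l) for all φ.
    let ψ : HopfDual H := TensorProduct.rid ℂ _ ((evalAt l).lTensor _ (Coalgebra.comul (R := ℂ) φ))
    have h1 := hw.slice_mul_apply_mul_slice hl (CrossedProduct.mk ρ 1 φ)
    have h2 : slice (evalAt l) ((CrossedProduct.map f hf).toAlgHom.toLinearMap.rTensor (HopfDual H)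
        (CrossedProduct.dualCoaction ρ (CrossedProduct.mk ρ 1 φ))) = CrossedProduct.mk ρ' 1 ψ := by
      rw [slice_rTensor, hβ, CrossedProduct.dualLin_mk, hm]
      simp only [ψ]
      generalize Coalgebra.comul (R := ℂ) φ = t
      induction t with
      | zero => simp [CrossedProduct.mk]
      | add x y hx hy =>
        simp only [TensorProduct.tmul_add, map_add, hx, hy]
        simp [CrossedProduct.mk, TensorProduct.tmul_add]
      | tmul α β =>
        simp only [CrossedProduct.reassoc_tmul, slice_tmul, map_smul, CrossedProduct.map_mk,
          map_one, LinearMap.lTensor_tmul, TensorProduct.rid_tmul]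
        simp [CrossedProduct.mk]
    rw [h2, CrossedProduct.map_mk, map_one, hp, ← CrossedProduct.twist_one,
      CrossedProduct.mk_one_mul_twist, mul_one, CrossedProduct.twist_mul_mk_one,
      ← CrossedProduct.twist_one, CrossedProduct.twist_mul_mk_one, one_mul] at h1
    have h3 := congrArg (fun x => slice (Coalgebra.counit (R := ℂ))
      ((CrossedProduct.ofTensor ρ').symm x)) h1
    simp only [CrossedProduct.slice_counit_twist] at h3
    have h4 : ∀ z : B ⊗[ℂ] H, slice (toDual ψ) z = slice (toDual φ) (z * (1 ⊗ₜ l)) := by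
      intro z
      induction z with
      | zero => simp
      | add x y hx hy => simp only [add_mul, map_add, hx, hy]
      | tmul b h =>
        rw [slice_tmul, Algebra.TensorProduct.tmul_mul_tmul, slice_tmul, mul_one,
          rid_lTensor_evalAt_comul_apply]
    rw [h3, h4, mul_one_tmul_integral hl, slice_counit_apply]
  -- For the twisted Haar element q, q(p ⋊ 1)q is e(l)q by the representation, and it is also the
  -- perturbed average of p times q; the factor q can be cancelled.
  · have h1 := hw.apply_mul_slice_mul_apply (l := l) he'
      (CrossedProduct.twist_haar_mul_dualLin ρ hv he')
    rw [CrossedProduct.map_twist, hp, CrossedProduct.twist_mul_mk_one,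
      CrossedProduct.twist_mul_twist_haar ρ' hv' he] at h1
    apply CrossedProduct.mk_one_mul_twist_injective ρ' hv'.mem_unitary he1
    rw [h1, show CrossedProduct.mk ρ' (e l • (1 : B)) 1 = e l • 1 by
      simp [CrossedProduct.one_def, CrossedProduct.mk, ← TensorProduct.smul_tmul'], smul_mul_assoc,
      one_mul]

end Coaction

/-! ### From A^∞ back to A: lifting and polar decomposition. -/

namespace Coaction

open CStarHopfAlgebra HopfDual SeqAlgebra

section Map

variable {B B' K : Type*} [Ring B] [Algebra ℂ B] [StarRing B] [StarModule ℂ B]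
  [Ring B'] [Algebra ℂ B'] [StarRing B'] [StarModule ℂ B']
  [Ring K] [Bialgebra ℂ K] [StarRing K] [StarModule ℂ K]

theorem IsCocycle.map {ρ : Coaction B K} {ρ' : Coaction B' K} {v : B ⊗[ℂ] K} (hv : ρ.IsCocycle v)
    (f : B →⋆ₐ[ℂ] B') (hf : ∀ b, ρ' (f b) = f.toAlgHom.toLinearMap.rTensor K (ρ b)) :
    ρ'.IsCocycle (f.toAlgHom.toLinearMap.rTensor K v) where
  mem_unitary := by
    rw [Unitary.mem_iff, ← rTensor_star, ← rTensor_mul, ← rTensor_mul,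
      Unitary.star_mul_self_of_mem hv.mem_unitary, Unitary.mul_star_self_of_mem hv.mem_unitary,
      rTensor_one]
    exact ⟨rfl, rfl⟩
  cocycle := by
    have h1 : tmulOne (f.toAlgHom.toLinearMap.rTensor K v)
        = f.toAlgHom.toLinearMap.rTensor (K ⊗[ℂ] K) (tmulOne v) := by
      generalize v = z
      induction z with
      | zero => simp [tmulOne]
      | add x y hx hy =>
        simp only [tmulOne, map_add, TensorProduct.add_tmul] at hx hy ⊢
        rw [hx, hy]
      | tmul b k => simp [tmulOne]
    have h2 : ρ'.tensorId (f.toAlgHom.toLinearMap.rTensor K v)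
        = f.toAlgHom.toLinearMap.rTensor (K ⊗[ℂ] K) (ρ.tensorId v) :=
      (rTensor_assoc f.toAlgHom.toLinearMap ρ.lin ρ'.lin hf v).symm
    have h3 : idTensorComul (f.toAlgHom.toLinearMap.rTensor K v)
        = f.toAlgHom.toLinearMap.rTensor (K ⊗[ℂ] K) (idTensorComul v) :=
      (rTensor_comul f.toAlgHom.toLinearMap v).symm
    rw [h1, h2, h3, ← hv.cocycle]
    exact (map_mul (Algebra.TensorProduct.map f.toAlgHom (AlgHom.id ℂ (K ⊗[ℂ] K))) _ _).symm

end Map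

variable {A H : Type*} [CStarAlgebra A]
  [Ring H] [HopfAlgebra ℂ H] [StarRing H] [CStarHopfAlgebra H]

/-- The fixed point algebra of a coaction. -/
noncomputable def fixedPoints (ρ : Coaction A H) : StarSubalgebra ℂ A where
  carrier := {a | ρ a = a ⊗ₜ 1}
  mul_mem' {a b} ha hb := by
    simp only [Set.mem_ofPred_eq] at ha hb ⊢
    rw [map_mul, ha, hb, Algebra.TensorProduct.tmul_mul_tmul, one_mul]
  add_mem' {a b} ha hb := by
    simp only [Set.mem_ofPred_eq] at ha hb ⊢
    rw [map_add, ha, hb, TensorProduct.add_tmul]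
  algebraMap_mem' c := by
    simp only [Set.mem_ofPred_eq]
    rw [Algebra.algebraMap_eq_smul_one, map_smul, map_one, Algebra.TensorProduct.one_def,
      TensorProduct.smul_tmul']
  star_mem' {a} ha := by
    simp only [Set.mem_ofPred_eq] at ha ⊢
    rw [map_star, ha, TensorProduct.star_tmul, star_one]

theorem mem_fixedPoints {ρ : Coaction A H} {a : A} : a ∈ ρ.fixedPoints ↔ ρ a = a ⊗ₜ 1 := Iff.rfl

/-- Being fixed is tested by slices, and these are continuous by `exists_norm_slice_le`. Closedness
puts the functional calculus of a fixed element inside the fixed point algebra. -/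
theorem isClosed_fixedPoints (ρ : Coaction A H) : IsClosed (ρ.fixedPoints : Set A) := by
  have h : (ρ.fixedPoints : Set A)
      = ⋂ φ : HopfDual H, {a | slice (toDual φ) (ρ a) = φ 1 • a} := by
    ext a
    rw [Set.mem_iInter]
    constructor
    · intro ha φ
      rw [Set.mem_ofPred_eq, mem_fixedPoints.1 ha, slice_tmul]
    · intro ha
      refine mem_fixedPoints.2 (slice_dual_ext fun φ => ?_)
      rw [slice_tmul]
      exact ha φ
  rw [h]
  refine isClosed_iInter fun φ => isClosed_eq ?_ (continuous_const_smul _)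
  exact ((slice (toDual φ) ∘ₗ ρ.lin).mkContinuousOfExistsBound
    (exists_norm_slice_le ρ (toDual φ))).continuous

/-- An invertible element that trivializes a cocycle can be replaced by a unitary, by polar
decomposition. -/
theorem IsCocycle.exists_unitary_of_isUnit {ρ : Coaction A H} {v : A ⊗[ℂ] H}
    (hv : ρ.IsCocycle v) {y : A} (hy : IsUnit y) (h : v * ρ y = y ⊗ₜ 1) :
    ∃ x ∈ unitary A, v * ρ x = x ⊗ₜ 1 := by
  let := CStarAlgebra.spectralOrder A
  have := CStarAlgebra.spectralOrderedRing A
  -- The unitary v drops out of (vρ(y))⋆(vρ(y)), which equals y⋆y ⊗ 1. Hence correcting y on the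
  -- right by (y⋆y)^(-1/2) preserves the equation.
  have ha : star y * y ∈ ρ.fixedPoints := by
    rw [mem_fixedPoints, map_mul, map_star]
    have h1 : star (v * ρ y) * (v * ρ y) = star (ρ y) * ρ y := by
      rw [star_mul, mul_assoc, ← mul_assoc (star v),
        Unitary.star_mul_self_of_mem hv.mem_unitary, one_mul]
    rw [← h1, h, TensorProduct.star_tmul, star_one, Algebra.TensorProduct.tmul_mul_tmul, one_mul]
  have hpos : IsStrictlyPositive (star y * y) :=
    CStarAlgebra.isStrictlyPositive_iff_eq_star_mul_self.2 ⟨y, hy, rfl⟩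
  set a := star y * y with hadef
  have hs : a ^ (-(1 / 2) : ℝ) ∈ ρ.fixedPoints := by
    have := ρ.isClosed_fixedPoints
    rw [CFC.rpow_eq_cfc_real hpos.nonneg]
    exact cfc_mem (𝕜' := ℂ) (s := ρ.fixedPoints) _ ha
  set s := a ^ (-(1 / 2) : ℝ) with hsdef
  have hsa : star s = s := (IsSelfAdjoint.of_nonneg CFC.rpow_nonneg).star_eq
  have h1 : s * a ^ (1 / 2 : ℝ) = 1 := CFC.rpow_neg_mul_rpow _ hpos
  have h2 : a ^ (1 / 2 : ℝ) * s = 1 := CFC.rpow_mul_rpow_neg _ hpos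
  have h3 : a ^ (1 / 2 : ℝ) * a ^ (1 / 2 : ℝ) = a := by
    rw [← CFC.rpow_add hpos.isUnit, add_halves, CFC.rpow_one a hpos.nonneg]
  have hu : star (y * s) * (y * s) = 1 := by
    rw [star_mul, hsa, mul_assoc, ← mul_assoc (star y), ← hadef, ← h3, mul_assoc (a ^ _), h2,
      mul_one, h1]
  have hsu : IsUnit s := ⟨⟨s, a ^ (1 / 2 : ℝ), h1, h2⟩, rfl⟩
  refine ⟨y * s, Unitary.mem_iff.2 ⟨hu, ?_⟩, ?_⟩
  -- An invertible isometry is unitary.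
  · exact (hy.mul hsu).mul_left_injective (by
      change y * s * star (y * s) * (y * s) = 1 * (y * s)
      rw [mul_assoc, hu, mul_one, one_mul])
  · rw [map_mul, ← mul_assoc, h, mem_fixedPoints.1 hs, Algebra.TensorProduct.tmul_mul_tmul,
      one_mul]

/-- The terms tend to 1 in norm, and the open unit ball around 1 consists of invertibles. -/
theorem eventually_isUnit_of_proj_eq_one {b : bddSeq A} (h : proj A b = 1) :
    ∀ᶠ n in Filter.atTop, IsUnit ((b : ℕ → A) n) := by
  have h1 : (1 - b) ∈ nullSeq A := proj_eq_zero.1 (by rw [map_sub, map_one, h, sub_self])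
  have h2 := (nullSeq.mem_iff.1 h1).eventually (gt_mem_nhds (show (0 : ℝ) < 1 from one_pos))
  filter_upwards [h2] with n hn
  have := isUnit_one_sub_of_norm_lt_one hn
  simpa using this

/-- The sequence `(id ⊗ φ)(v ρ(aₙ))`. -/
theorem exists_seq_slice (ρ : Coaction A H) (φ : HopfDual H) (v : A ⊗[ℂ] H) (a : bddSeq A) :
    ∃ b : bddSeq A, (∀ n, (b : ℕ → A) n = slice (toDual φ) (v * ρ ((a : ℕ → A) n))) ∧
      proj A b = slice (toDual φ)
        ((const A).toAlgHom.toLinearMap.rTensor H v * ρ.infty (proj A a)) := by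
  refine ⟨slice (toDual φ) ((constSeq A).toAlgHom.toLinearMap.rTensor H v * ρ.seq a),
    fun n => ?_, ?_⟩
  · have h1 : (ev A n).toAlgHom.toLinearMap.rTensor H
        ((constSeq A).toAlgHom.toLinearMap.rTensor H v) = v := by
      rw [← LinearMap.comp_apply, ← LinearMap.rTensor_comp]
      exact LinearMap.rTensor_id_apply _ _ _
    have h2 : (ev A n).toAlgHom.toLinearMap.rTensor H (ρ.seq a) = ρ ((a : ℕ → A) n) :=
      ρ.rTensor_ev_seqLin n a
    conv_rhs => rw [← h1, ← h2, ← rTensor_mul, slice_rTensor]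
    rfl
  · have h1 : (const A).toAlgHom.toLinearMap.rTensor H v = (proj A).toAlgHom.toLinearMap.rTensor H
        ((constSeq A).toAlgHom.toLinearMap.rTensor H v) := by
      rw [← LinearMap.comp_apply, ← LinearMap.rTensor_comp]
      rfl
    rw [h1, infty_proj, ← rTensor_mul, slice_rTensor]
    rfl

/-- A cocycle for a coaction with the Rohlin property is a coboundary. -/
theorem HasRohlinProperty.exists_unitary {ρ : Coaction A H} (hρ : ρ.HasRohlinProperty)
    {v : A ⊗[ℂ] H} (hv : ρ.IsCocycle v) : ∃ x ∈ unitary A, v * ρ x = x ⊗ₜ 1 := by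
  obtain ⟨w, hw⟩ := hρ
  obtain ⟨l, hl, hl', hl1⟩ := exists_integral (H := H)
  obtain ⟨e, he, he', he1, hec, hel⟩ := exists_haar (H := H)
  obtain ⟨p, hp1, hp2, hp3⟩ :=
    exists_rohlin_element (const A) ρ.infty_const hw hl hl' he he' he1
  have hv' := hv.map (const A) ρ.infty_const
  have h1' := (isCocycle_one ρ).map (const A) ρ.infty_const
  set V := (const A).toAlgHom.toLinearMap.rTensor H v with hV
  have h1 : slice (toDual e) (ρ.infty p) = e l • (1 : SeqAlgebra A) := by
    -- The unperturbed average of p is the case of the trivial cocycle.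
    have := hp3 1 (isCocycle_one ρ) h1'
    rwa [rTensor_one, star_one, one_mul, mul_one] at this
  have hpv : (p ⊗ₜ 1) * V = V * (p ⊗ₜ 1) := by
    rw [hV]
    generalize v = z
    induction z with
    | zero => simp
    | add x y hx hy => simp only [map_add, mul_add, add_mul, hx, hy]
    | tmul a h =>
      rw [LinearMap.rTensor_tmul, Algebra.TensorProduct.tmul_mul_tmul,
        Algebra.TensorProduct.tmul_mul_tmul, one_mul, mul_one]
      congr 1
      exact hp1 a
  obtain ⟨hxy, hyx⟩ := hv'.slice_mul_slice_of_rohlin he hec hl hl' hp2 hpv h1 (hp3 v hv hv')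
  have hc : e l * e l ≠ 0 := mul_ne_zero (hel l hl' hl1) (hel l hl' hl1)
  obtain ⟨a, rfl⟩ := proj_surjective p
  -- The lift of x is chosen termwise as a twisted average, so that each term solves the equation
  -- exactly; only invertibility has to survive the passage from A^∞ to A. Any lift of the inverse
  -- will do.
  obtain ⟨b, hb, hbx⟩ := ρ.exists_seq_slice e v a
  obtain ⟨d, hd⟩ := proj_surjective
    ((e l * e l)⁻¹ • slice (toDual e) (ρ.infty (proj A a) * star V))
  have hbd : proj A (b * d) = 1 := by
    rw [map_mul, hbx, hd, mul_smul_comm, hxy, smul_smul, inv_mul_cancel₀ hc, one_smul]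
  have hdb : proj A (d * b) = 1 := by
    rw [map_mul, hbx, hd, smul_mul_assoc, hyx, smul_smul, inv_mul_cancel₀ hc, one_smul]
  obtain ⟨n, hn1, hn2⟩ := ((eventually_isUnit_of_proj_eq_one hbd).and
    (eventually_isUnit_of_proj_eq_one hdb)).exists
  -- Invertibility of both products of b(n) and d(n) gives b(n) a right and a left inverse.
  have hunit : IsUnit ((b : ℕ → A) n) := by
    obtain ⟨s, hs⟩ := hn1.exists_right_inv
    obtain ⟨t, ht⟩ := hn2.exists_left_inv
    have hs' : (b : ℕ → A) n * ((d : ℕ → A) n * s) = 1 := (mul_assoc _ _ _).symm.trans hs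
    have ht' : (t * (d : ℕ → A) n) * (b : ℕ → A) n = 1 := (mul_assoc _ _ _).trans ht
    have hst := left_inv_eq_right_inv ht' hs'
    exact ⟨⟨_, _, hs', hst ▸ ht'⟩, rfl⟩
  refine hv.exists_unitary_of_isUnit hunit ?_
  rw [hb]
  exact hv.mul_apply_slice he _

end Coaction

theorem mainTheorem2 {A H : Type*} [CStarAlgebra A]
    [Ring H] [HopfAlgebra ℂ H] [StarRing H] [CStarHopfAlgebra H]
    (ρ σ : Coaction A H) (v : A ⊗[ℂ] H) (hv : ρ.IsCocycle v)
    (hσ : ∀ a : A, σ a = v * ρ a * star v) (hρ : ρ.HasRohlinProperty) :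
    ∃ x ∈ unitary A,
      (∀ a : A, σ a = (x ⊗ₜ[ℂ] (1 : H)) * ρ (star x * a * x) * star (x ⊗ₜ[ℂ] (1 : H))) ∧
      v = (x ⊗ₜ[ℂ] (1 : H)) * ρ (star x) := by
  obtain ⟨x, hx, h⟩ := hρ.exists_unitary hv
  have hv' : v = (x ⊗ₜ[ℂ] (1 : H)) * ρ (star x) := by
    rw [← h, mul_assoc, ← map_mul, Unitary.mul_star_self_of_mem hx, map_one, mul_one]
  refine ⟨x, hx, fun a => ?_, hv'⟩
  rw [hσ]
  conv_lhs => rw [hv']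
  rw [star_mul, ← map_star, star_star, map_mul, map_mul]
  simp only [mul_assoc]
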